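/- **Proposition 3.2.** Let $\mathbb T^2=\mathbb R^2/(2\pi\mathbb Z)^2$. For a function $g=\sum_k g_k e^{ik\cdot x}$ on $\mathbb T^2$ and $s\in\mathbb R$ let $\Lambda^s g=\sum_{k\ne0}|k|^s g_k e^{ik\cdot x}$ and $R_jg=\sum_{k\neq 0} \frac{ik_j}{|k|}g_ke^{ik\cdot x}$, $R=(R_1,R_2)=\nabla\Lambda^{-1}$. Let $f\in L^2(\mathbb T^2;\mathbb R^2)$, and let $\Phi:\mathbb T^2\to\mathbb R$ be a potential in $H^2$ with $\Delta\Phi\in L^4$. Put $$\mathcal F(\xi,v)=\big(v\cdot\nabla\xi+\Lambda\xi-\Delta\Phi,\;\; v\cdot\nabla v-\Delta v+\xi R\xi+\xi\nabla\Phi-f\big).$$ There is a universal constant $C_0>0$ (independent of $f,\Phi,q_1,q_2,u_1,u_2$) such that for all real scalar functions $q_1\in L^4$, $q_2\in L^2$ with zero average over $\mathbb T^2$ and all divergence-free vector fields $u_1\in H^2$, $u_2\in H^1$, $$\big(\mathcal F(q_1,u_1)-\mathcal F(q_2,u_2),\,(\Lambda^{-1}(q_1-q_2),\,u_1-u_2)\big)_{L^2}+C_0\,K(\Phi,u_1,q_1)\Big(\|\Lambda^{-1/2}(q_1-q_2)\|_{L^2}^2+\|u_1-u_2\|_{L^2}^2\Big)\ge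 0,$$ where $$K(\Phi,u_1,q_1)=\|\nabla\Phi\|_{L^\infty}^2+\|\nabla u_1\|_{L^2}^2+\|\nabla u_1\|_{L^2}+\|q_1\|_{L^4}^2+\|q_1\|_{L^4}^4+\|\Delta u_1\|_{L^2}^2 .$$ Here the pairing is understood in weak form: $(\mathcal F(q_1,u_1)-\mathcal F(q_2,u_2),(\psi,w))_{L^2}$ is the integral over $\mathbb T^2$ of $e(q_1,u_1)-e(q_2,u_2)$, where $$e(\xi,v)=-\xi\,v\cdot\nabla\psi+\xi\,\Lambda\psi-\Delta\Phi\,\psi+(v\cdot\nabla v)\cdot w+\nabla v:\nabla w+\xi\,R\xi\cdot w+\xi\,\nabla\Phi\cdot w-f\cdot w ,$$ and for $(\psi,w)=(\Lambda^{-1}(q_1-q_2),u_1-u_2)$ the function $e(q_1,u_1)-e(q_2,u_2)$ is Lebesgue integrable. -/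

import Mathlib

open MeasureTheory
open scoped ENNReal

noncomputable section

namespace Electroconvection

/-- The torus `ℝ² / (2πℤ)²`, parametrised by `θ ∈ (ℝ/ℤ)²` through `x = 2πθ`. In this
parametrisation `UnitAddTorus.mFourier k` is the character `x ↦ exp (i k·x)`. All differential
operators below are taken with respect to `x`, so that `∂ⱼ` has the symbol `i kⱼ`. -/
abbrev T2 : Type := UnitAddTorus (Fin 2)

/-- Values of vector fields, with the Euclidean norm. -/
abbrev Vec : Type := EuclideanSpace ℝ (Fin 2)

/-- The Lebesgue measure `dx` on `ℝ² / (2πℤ)²`, of total mass `(2π)²`. The Haar probability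
measure on each circle is the one used for the Fourier coefficients. -/
def dx : Measure T2 :=
  ENNReal.ofReal ((2 * Real.pi) ^ 2) •
    Measure.pi fun _ : Fin 2 => (AddCircle.haarAddCircle : Measure UnitAddCircle)

/-- The Fourier coefficient `f_k = (2π)⁻² ∫ f(x) exp (-i k·x) dx` of a real function. -/
def coeff (f : T2 → ℝ) (k : Fin 2 → ℤ) : ℂ :=
  UnitAddTorus.mFourierCoeff (fun x => (f x : ℂ)) k

/-- The Euclidean length `|k|` of a frequency. -/
def freq (k : Fin 2 → ℤ) : ℝ := Real.sqrt (∑ j, (k j : ℝ) ^ 2)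

/-- The Fourier multiplier with symbol `m`: the function in `L²` whose Fourier coefficients are
`m k * f_k`, whenever these are square summable (and `0` by convention otherwise). All symbols
used below satisfy `m (-k) = conj (m k)`, so the resulting function is real valued and taking the
real part loses nothing. -/
def multiplier (m : (Fin 2 → ℤ) → ℂ) (f : T2 → ℝ) : T2 → ℝ :=
  open Classical in
  if h : Memℓp (fun k => m k * coeff f k) 2 then
    fun x => ((UnitAddTorus.mFourierBasis (d := Fin 2)).repr.symm ⟨_, h⟩ x).re
  else 0

/-- The fractional Laplacian `Λ^s`, with symbol `|k|^s` on `k ≠ 0`. -/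
def lam (s : ℝ) (f : T2 → ℝ) : T2 → ℝ :=
  multiplier (fun k => if k = 0 then 0 else ((freq k ^ s : ℝ) : ℂ)) f

/-- The Riesz transforms `R = (R₁, R₂)`, with symbols `i kⱼ / |k|` on `k ≠ 0`. -/
def riesz (f : T2 → ℝ) (x : T2) : Vec :=
  WithLp.toLp 2 fun j =>
    multiplier (fun k => if k = 0 then 0 else Complex.I * (k j : ℂ) / (freq k : ℂ)) f x

/-- The partial derivative `∂ⱼ`. -/
def partialD (j : Fin 2) (f : T2 → ℝ) : T2 → ℝ :=
  multiplier (fun k => Complex.I * (k j : ℂ)) f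

/-- The gradient of a scalar function. -/
def grad (f : T2 → ℝ) (x : T2) : Vec := WithLp.toLp 2 fun j => partialD j f x

/-- The Laplacian of a scalar function. -/
def lap (f : T2 → ℝ) : T2 → ℝ := multiplier (fun k => -((freq k ^ 2 : ℝ) : ℂ)) f

/-- The Jacobian `(i, j) ↦ ∂ⱼ vᵢ` of a vector field, with the Euclidean (Frobenius) norm. -/
def gradV (v : T2 → Vec) (x : T2) : EuclideanSpace ℝ (Fin 2 × Fin 2) :=
  WithLp.toLp 2 fun p => partialD p.2 (fun y => v y p.1) x

/-- The componentwise Laplacian of a vector field. -/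
def lapV (v : T2 → Vec) (x : T2) : Vec :=
  WithLp.toLp 2 fun i => lap (fun y => v y i) x

/-- The transport term `v · ∇v`. -/
def advect (v : T2 → Vec) (x : T2) : Vec :=
  WithLp.toLp 2 fun i => ∑ j, v x j * gradV v x (i, j)

/-- Membership in `H^s`, `s > 0`, for scalar functions. -/
def InSobolev (s : ℝ) (f : T2 → ℝ) : Prop :=
  MemLp f 2 dx ∧ Summable fun k => (1 + freq k ^ s) ^ 2 * ‖coeff f k‖ ^ 2

/-- Membership in `H^s`, `s > 0`, for vector fields. -/
def InSobolevV (s : ℝ) (v : T2 → Vec) : Prop := ∀ i, InSobolev s fun x => v x i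

/-- `f` has zero average. -/
def MeanZero (f : T2 → ℝ) : Prop := ∫ x, f x ∂dx = 0

/-- `∇ · v = 0` in the sense of distributions: `∑ⱼ kⱼ (vⱼ)_k = 0` for every frequency `k`. -/
def DivFree (v : T2 → Vec) : Prop :=
  ∀ k : Fin 2 → ℤ, ∑ j, (k j : ℂ) * coeff (fun x => v x j) k = 0

/-- The integrand of the weak form of the drift
`F(ξ, v) = (v·∇ξ + Λξ - ΔΦ, v·∇v - Δv + ξ Rξ + ξ ∇Φ - f)` tested against `(ψ, w)`.
Since `ξ` is only in `L²` and `v` only in `H¹`, derivatives falling on `ξ` and second derivatives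
of `v` are transferred to the test functions, with `v` divergence free:
`(v·∇ξ, ψ) = -∫ ξ v·∇ψ`, `(Λξ, ψ) = ∫ ξ Λψ` and `(-Δv, w) = ∫ ∇v : ∇w`. -/
def driftDensity (Φ : T2 → ℝ) (f : T2 → Vec) (ξ : T2 → ℝ) (v : T2 → Vec)
    (ψ : T2 → ℝ) (w : T2 → Vec) (x : T2) : ℝ :=
  (-(ξ x * inner ℝ (v x) (grad ψ x)) + ξ x * lam 1 ψ x - lap Φ x * ψ x)
    + (inner ℝ (advect v x) (w x) + inner ℝ (gradV v x) (gradV w x)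
      + ξ x * inner ℝ (riesz ξ x) (w x) + ξ x * inner ℝ (grad Φ x) (w x)
      - inner ℝ (f x) (w x))

/-- The integrand of the pairing of `F(ξ₁, v₁) - F(ξ₂, v₂)` with `(ψ, w)`. -/
def driftDiffDensity (Φ : T2 → ℝ) (f : T2 → Vec) (ξ₁ : T2 → ℝ) (v₁ : T2 → Vec)
    (ξ₂ : T2 → ℝ) (v₂ : T2 → Vec) (ψ : T2 → ℝ) (w : T2 → Vec) (x : T2) : ℝ :=
  driftDensity Φ f ξ₁ v₁ ψ w x - driftDensity Φ f ξ₂ v₂ ψ w x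

/-- The pairing `(F(ξ₁, v₁) - F(ξ₂, v₂), (ψ, w))_{L²}`. -/
def driftDiffPairing (Φ : T2 → ℝ) (f : T2 → Vec) (ξ₁ : T2 → ℝ) (v₁ : T2 → Vec)
    (ξ₂ : T2 → ℝ) (v₂ : T2 → Vec) (ψ : T2 → ℝ) (w : T2 → Vec) : ℝ :=
  ∫ x, driftDiffDensity Φ f ξ₁ v₁ ξ₂ v₂ ψ w x ∂dx

/-- `K(Φ, u, q)`. -/
def bigK (Φ : T2 → ℝ) (u : T2 → Vec) (q : T2 → ℝ) : ℝ :=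
  lpNorm (grad Φ) ∞ dx ^ 2 + lpNorm (gradV u) 2 dx ^ 2 + lpNorm (gradV u) 2 dx
    + lpNorm q 4 dx ^ 2 + lpNorm q 4 dx ^ 4 + lpNorm (lapV u) 2 dx ^ 2

end Electroconvection

end

open Electroconvection

noncomputable section

namespace Electroconvection

open scoped ComplexConjugate
open UnitAddTorus (mFourier mFourierCoeff mFourierBasis)
open Filter Topology

/-! Write q = q₁ − q₂ and u = u₁ − u₂. Since ∇Λ⁻¹q = Rq and, for zero mean, ΛΛ⁻¹q = q, the pairing
produces the coercive terms ‖q‖² + ‖∇u‖². The transport contribution −q₂ u·Rq cancels the electric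
contribution q₂ Rq·u, so L² suffices for q₂. What is left (`driftDiffDensity_ae_eq`) is −∫ q u₁·Rq +
∫ (u·∇u₁)·u + ∫ (u₂·∇u)·u + ∫ q Rq₁·u + ∫ q ∇Φ·u.

The (u₂·∇u)·u term vanishes because u₂ is divergence free (`sum_integral_transport_eq_zero`). The
terms with ∇u₁ and Rq₁ are handled by Hölder, Ladyzhenskaya's inequality for u
(`integral_pow_four_le`) and boundedness of R on L⁴ (`eLpNorm_riesz_le`). The last term is Young's
inequality once ∇Φ is known to be bounded, which follows from ΔΦ ∈ L⁴ by a Morrey argument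
(`memLp_top_partialD`).

The delicate term is ∫ q u₁·Rq: a direct bound sees only ‖q‖², with a constant that cannot be
absorbed. Symmetrising the Fourier sum in the two copies of q, and using k·û₁(k) = 0, replaces 1/|n|
by 1/|n| − 1/|n−k| (`norm_commutator_term_le`). The gain bounds the term by ‖Δu₁‖ ‖q‖ ‖Λ^{-1/2}q‖
(`sq_sum_integral_commutator_le`), and Young's inequality finishes.

Boundedness of R on L⁴ comes from the method of rotations: R is an average over directions θ of
Hilbert transforms H, and f + iHf has only frequencies with θ·k > 0, so ∫ (f + iHf)⁴ = 0, which
controls ‖Hf‖₄ by ‖f‖₄. Such bounds are proved for trigonometric polynomials and passed to the limit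
by `eLpNorm_le_of_tendsto`. -/

/-- The Haar probability measure on the torus. -/
abbrev mu : Measure T2 :=
  Measure.pi fun _ : Fin 2 => (AddCircle.haarAddCircle : Measure UnitAddCircle)

/-- Frequencies. -/
abbrev Z2 : Type := Fin 2 → ℤ

/-! ### Fourier coefficients -/

lemma mFourierCoeff_eq (f : T2 → ℂ) (k : Z2) :
    mFourierCoeff f k = ∫ x, mFourier (-k) x * f x ∂mu := rfl

lemma norm_mFourier_apply (k : Z2) (x : T2) : ‖mFourier k x‖ = 1 := by
  simp only [UnitAddTorus.mFourier, fourier_apply, ContinuousMap.coe_mk, norm_prod,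
    Circle.norm_coe, Finset.prod_const_one]

lemma integrable_mFourier_mul {f : T2 → ℂ} (hf : Integrable f mu) (k : Z2) :
    Integrable (fun x => mFourier k x * f x) mu :=
  hf.bdd_mul (mFourier k).continuous.aestronglyMeasurable
    (.of_forall fun x => (norm_mFourier_apply k x).le)

lemma mFourierCoeff_congr {f g : T2 → ℂ} (h : f =ᵐ[mu] g) (k : Z2) :
    mFourierCoeff f k = mFourierCoeff g k := by
  rw [mFourierCoeff_eq, mFourierCoeff_eq]
  exact integral_congr_ae (h.mono fun x hx => by simp [hx])

lemma mFourierCoeff_add {f g : T2 → ℂ} (hf : Integrable f mu) (hg : Integrable g mu) (k : Z2) :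
    mFourierCoeff (fun x => f x + g x) k = mFourierCoeff f k + mFourierCoeff g k := by
  simp only [mFourierCoeff_eq, mul_add]
  exact integral_add (integrable_mFourier_mul hf _) (integrable_mFourier_mul hg _)

lemma mFourierCoeff_const_mul (c : ℂ) (f : T2 → ℂ) (k : Z2) :
    mFourierCoeff (fun x => c * f x) k = c * mFourierCoeff f k := by
  simp only [mFourierCoeff_eq, mul_left_comm _ c]
  exact integral_const_mul _ _

lemma mFourierCoeff_conj (f : T2 → ℂ) (k : Z2) :
    mFourierCoeff (fun x => conj (f x)) k = conj (mFourierCoeff f (-k)) := by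
  rw [mFourierCoeff_eq, mFourierCoeff_eq, ← integral_conj]
  refine integral_congr_ae (.of_forall fun x => ?_)
  simp only [map_mul, ← UnitAddTorus.mFourier_neg, neg_neg]

lemma mFourierCoeff_mFourier_mul (n : Z2) (f : T2 → ℂ) (k : Z2) :
    mFourierCoeff (fun x => mFourier n x * f x) k = mFourierCoeff f (k - n) := by
  rw [mFourierCoeff_eq, mFourierCoeff_eq]
  refine integral_congr_ae (.of_forall fun x => ?_)
  simp only [← mul_assoc, ← UnitAddTorus.mFourier_add, neg_sub, neg_add_eq_sub]

lemma hasSum_mFourierCoeff {f g : T2 → ℂ} (hf : MemLp f 2 mu) (hg : MemLp g 2 mu) :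
    HasSum (fun k => conj (mFourierCoeff f k) * mFourierCoeff g k) (∫ x, conj (f x) * g x ∂mu) := by
  have h : HasSum _ (∫ x, conj (hf.toLp f x) * hg.toLp g x ∂mu) :=
    UnitAddTorus.hasSum_prod_mFourierCoeff (d := Fin 2) (hf.toLp f) (hg.toLp g)
  have e : (∫ x, conj (f x) * g x ∂mu) = ∫ x, conj (hf.toLp f x) * hg.toLp g x ∂mu := by
    refine integral_congr_ae ?_
    filter_upwards [hf.coeFn_toLp, hg.coeFn_toLp] with x h1 h2
    rw [h1, h2]
  rw [e]
  convert h using 3 with k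
  · rw [mFourierCoeff_congr hf.coeFn_toLp.symm]
  · rw [mFourierCoeff_congr hg.coeFn_toLp.symm]

lemma ae_eq_of_mFourierCoeff_eq {f g : T2 → ℂ} (hf : MemLp f 2 mu) (hg : MemLp g 2 mu)
    (h : ∀ k, mFourierCoeff f k = mFourierCoeff g k) : f =ᵐ[mu] g := by
  have : hf.toLp f = hg.toLp g := by
    refine (mFourierBasis (d := Fin 2)).repr.injective ?_
    ext k
    erw [UnitAddTorus.mFourierBasis_repr, UnitAddTorus.mFourierBasis_repr]
    rw [mFourierCoeff_congr hf.coeFn_toLp, mFourierCoeff_congr hg.coeFn_toLp, h]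
  exact (MemLp.toLp_eq_toLp_iff hf hg).1 this

lemma integrable_of_memLp {f : T2 → ℝ} (hf : MemLp f 2 mu) : Integrable f mu :=
  hf.integrable one_le_two

lemma coeff_neg_freq (f : T2 → ℝ) (k : Z2) : coeff f (-k) = conj (coeff f k) := by
  have := mFourierCoeff_conj (fun x => (f x : ℂ)) (-k)
  simpa [coeff] using this

lemma coeff_add {f g : T2 → ℝ} (hf : Integrable f mu) (hg : Integrable g mu) (k : Z2) :
    coeff (f + g) k = coeff f k + coeff g k := by
  simpa [coeff] using mFourierCoeff_add hf.ofReal hg.ofReal k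

lemma coeff_const_mul (c : ℝ) (f : T2 → ℝ) (k : Z2) :
    coeff (fun x => c * f x) k = c * coeff f k := by
  simpa [coeff] using mFourierCoeff_const_mul (c : ℂ) (fun x => (f x : ℂ)) k

lemma coeff_sub {f g : T2 → ℝ} (hf : Integrable f mu) (hg : Integrable g mu) (k : Z2) :
    coeff (f - g) k = coeff f k - coeff g k := by
  have h : f - g = f + fun x => (-1 : ℝ) * g x := by ext; simp [sub_eq_add_neg]
  rw [h, coeff_add hf (hg.const_mul _), coeff_const_mul]
  push_cast; ring

lemma coeff_zero_freq (f : T2 → ℝ) : coeff f 0 = ((∫ x, f x ∂mu : ℝ) : ℂ) := by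
  rw [coeff, mFourierCoeff_eq, neg_zero, ← integral_complex_ofReal]
  simp [UnitAddTorus.mFourier_zero]

/-- Parseval's identity for real functions. -/
lemma hasSum_coeff {f g : T2 → ℝ} (hf : MemLp f 2 mu) (hg : MemLp g 2 mu) :
    HasSum (fun k => conj (coeff f k) * coeff g k) ((∫ x, f x * g x ∂mu : ℝ) : ℂ) := by
  have := hasSum_mFourierCoeff (hf.ofReal (K := ℂ)) hg.ofReal
  rw [← integral_complex_ofReal]
  simpa [coeff] using this

lemma hasSum_sq_coeff {f : T2 → ℝ} (hf : MemLp f 2 mu) :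
    HasSum (fun k => ‖coeff f k‖ ^ 2) (∫ x, f x ^ 2 ∂mu) := by
  have := hasSum_coeff hf hf
  have h2 := RCLike.hasSum_re ℂ this
  convert h2 using 2 with k
  · rw [← Complex.normSq_eq_norm_sq, mul_comm, Complex.mul_conj]; simp
  · simp [pow_two]

lemma ae_eq_of_coeff_eq {f g : T2 → ℝ} (hf : MemLp f 2 mu) (hg : MemLp g 2 mu)
    (h : ∀ k, coeff f k = coeff g k) : f =ᵐ[mu] g := by
  filter_upwards [ae_eq_of_mFourierCoeff_eq (hf.ofReal (K := ℂ)) hg.ofReal h] with x hx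
  exact Complex.ofReal_injective hx

/-- The Fourier coefficients of a product are the convolution of the Fourier coefficients. -/
lemma hasSum_coeff_mul {f g : T2 → ℝ} (hf : MemLp f 2 mu) (hg : MemLp g 2 mu) (n : Z2) :
    HasSum (fun k => coeff f k * coeff g (n - k)) (coeff (fun x => f x * g x) n) := by
  have hG : MemLp (fun x => mFourier (-n) x * (g x : ℂ)) 2 mu := by
    refine (hg.ofReal (K := ℂ)).of_le ((mFourier (-n)).continuous.aestronglyMeasurable.mul
      hg.ofReal.1) (.of_forall fun x => ?_)
    simp [norm_mFourier_apply]
  have h := hasSum_mFourierCoeff (hf.ofReal (K := ℂ)) hG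
  have e : (∫ x, conj ((f x : ℂ)) * (mFourier (-n) x * (g x : ℂ)) ∂mu)
      = coeff (fun x => f x * g x) n := by
    rw [coeff, mFourierCoeff_eq]
    refine integral_congr_ae (.of_forall fun x => ?_)
    simp; ring
  simp only [mFourierCoeff_mFourier_mul] at h
  erw [e] at h
  rw [← (Equiv.neg Z2).hasSum_iff] at h
  convert h using 2 with k
  simp only [Function.comp, Equiv.neg_apply]
  change _ = conj (coeff f (-k)) * coeff g (-k - -n)
  rw [coeff_neg_freq, Complex.conj_conj]
  congr 2; abel

/-! ### Fourier multipliers -/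

/-- Symbols which preserve real functions. -/
def Hermitian (m : Z2 → ℂ) : Prop := ∀ k, m (-k) = conj (m k)

lemma memLp_multiplier (m : Z2 → ℂ) (f : T2 → ℝ) : MemLp (multiplier m f) 2 mu := by
  unfold multiplier
  split_ifs with h
  · exact (Lp.memLp ((mFourierBasis (d := Fin 2)).repr.symm ⟨_, h⟩)).re
  · exact MemLp.zero

/-- Taking the real part replaces the coefficient c(k) by the mean of c(k) and the conjugate of
c(−k); for a Hermitian symbol and real `f` the two coincide. -/
lemma coeff_multiplier {m : Z2 → ℂ} (hm : Hermitian m) {f : T2 → ℝ}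
    (h : Memℓp (fun k => m k * coeff f k) 2) (k : Z2) :
    coeff (multiplier m f) k = m k * coeff f k := by
  set F := (mFourierBasis (d := Fin 2)).repr.symm ⟨_, h⟩ with hF
  have hc : ∀ k, mFourierCoeff F k = m k * coeff f k := fun k => by
    rw [← UnitAddTorus.mFourierBasis_repr, hF, LinearIsometryEquiv.apply_symm_apply]
  have hL : MemLp F 2 mu := Lp.memLp F
  have hI : Integrable F mu := hL.integrable one_le_two
  have hI' : Integrable (fun x => conj (F x)) mu := by
    refine hI.norm.mono' ?_ (.of_forall fun x => (RCLike.norm_conj _).le)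
    exact Complex.continuous_conj.comp_aestronglyMeasurable hI.1
  have e : (fun x => ((multiplier m f x : ℝ) : ℂ)) =
      fun x => (1 / 2 : ℂ) * (F x + conj (F x)) := by
    funext x
    rw [multiplier, dif_pos h, ← hF, Complex.add_conj]
    push_cast; ring
  rw [coeff, e, mFourierCoeff_const_mul, mFourierCoeff_add hI hI', mFourierCoeff_conj, hc, hc, hm,
    coeff_neg_freq]
  simp only [map_mul, Complex.conj_conj]
  ring

lemma memlp_iff_summable {a : Z2 → ℂ} : Memℓp a 2 ↔ Summable fun k => ‖a k‖ ^ 2 := by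
  rw [memℓp_gen_iff (by norm_num)]
  norm_num

lemma summable_coeff {f : T2 → ℝ} (hf : MemLp f 2 mu) : Summable fun k => ‖coeff f k‖ ^ 2 :=
  (hasSum_sq_coeff hf).summable

lemma memlp_of_bounded {m : Z2 → ℂ} {C : ℝ} (hm : ∀ k, ‖m k‖ ≤ C) {f : T2 → ℝ}
    (hf : MemLp f 2 mu) : Memℓp (fun k => m k * coeff f k) 2 := by
  rw [memlp_iff_summable]
  refine .of_nonneg_of_le (fun k => by positivity) (fun k => ?_) ((summable_coeff hf).mul_left (C ^ 2))
  rw [norm_mul, mul_pow]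
  have := hm k
  gcongr

/-! ### The measure `dx` -/

lemma dx_eq : dx = ENNReal.ofReal ((2 * Real.pi) ^ 2) • mu := rfl

lemma four_pi_sq_pos : (0 : ℝ) < (2 * Real.pi) ^ 2 := by positivity

lemma one_le_four_pi_sq : (1 : ℝ) ≤ (2 * Real.pi) ^ 2 := by
  nlinarith [Real.pi_gt_three]

lemma memLp_dx_iff {E : Type*} [NormedAddCommGroup E] {f : T2 → E} {p : ℝ≥0∞} :
    MemLp f p dx ↔ MemLp f p mu := by
  rw [dx_eq]
  refine ⟨fun h => ?_, fun h => h.smul_measure ENNReal.ofReal_ne_top⟩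
  have h0 : ENNReal.ofReal ((2 * Real.pi) ^ 2) ≠ 0 := by
    simp [Real.pi_ne_zero]
  have := h.smul_measure (c := (ENNReal.ofReal ((2 * Real.pi) ^ 2))⁻¹) (by simp [Real.pi_ne_zero])
  rwa [smul_smul, ENNReal.inv_mul_cancel h0 ENNReal.ofReal_ne_top, one_smul] at this

lemma integrable_dx_iff {f : T2 → ℝ} : Integrable f dx ↔ Integrable f mu := by
  rw [← memLp_one_iff_integrable, memLp_dx_iff, memLp_one_iff_integrable]

lemma integral_dx (f : T2 → ℝ) : ∫ x, f x ∂dx = (2 * Real.pi) ^ 2 * ∫ x, f x ∂mu := by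
  rw [dx_eq, integral_smul_measure, ENNReal.toReal_ofReal (by positivity), smul_eq_mul]

lemma ae_dx_iff {p : T2 → Prop} : (∀ᵐ x ∂dx, p x) ↔ ∀ᵐ x ∂mu, p x := by
  rw [dx_eq, Measure.ae_ennreal_smul_measure_iff]
  simp [Real.pi_ne_zero]

/-! ### Sums over the lattice of frequencies -/

/-- Hölder for the counting measure. Staying in [0, ∞] postpones every summability question to the
finiteness of the right-hand side. -/
lemma tsum_mul_sq_le {ι : Type*} (f g : ι → ℝ≥0∞) :
    (∑' i, f i * g i) ^ 2 ≤ (∑' i, f i ^ 2) * ∑' i, g i ^ 2 := by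
  let _ : MeasurableSpace ι := ⊤
  have h := ENNReal.lintegral_mul_le_Lp_mul_Lq (Measure.count : Measure ι)
    (Real.HolderConjugate.two_two) (f := f) (g := g) (measurable_from_top).aemeasurable
    (measurable_from_top).aemeasurable
  simp only [lintegral_count, Pi.mul_apply] at h
  have h2 := pow_le_pow_left' h 2
  rw [mul_pow] at h2
  simp only [← ENNReal.rpow_natCast, ← ENNReal.rpow_mul] at h2
  norm_num at h2
  exact h2

lemma freq_nonneg (k : Z2) : 0 ≤ freq k := Real.sqrt_nonneg _

lemma freq_eq_norm (k : Z2) : freq k = ‖(WithLp.toLp 2 fun j => (k j : ℝ) : Vec)‖ := by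
  rw [EuclideanSpace.norm_eq]; simp [freq]

lemma freq_sq (k : Z2) : freq k ^ 2 = ∑ j, (k j : ℝ) ^ 2 :=
  Real.sq_sqrt (Finset.sum_nonneg fun _ _ => sq_nonneg _)

@[simp] lemma freq_zero : freq 0 = 0 := by simp [freq]

@[simp] lemma freq_neg (k : Z2) : freq (-k) = freq k := by simp [freq]

lemma freq_add_le (k l : Z2) : freq (k + l) ≤ freq k + freq l := by
  simp only [freq_eq_norm]
  refine (le_of_eq ?_).trans (norm_add_le _ _)
  congr 1; ext j; simp

lemma freq_sub_le (k l : Z2) : freq (k - l) ≤ freq k + freq l := by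
  simpa [sub_eq_add_neg] using freq_add_le k (-l)

lemma abs_le_freq (k : Z2) (j : Fin 2) : |(k j : ℝ)| ≤ freq k := by
  refine Real.abs_le_sqrt ?_
  exact Finset.single_le_sum (f := fun j => (k j : ℝ) ^ 2) (fun _ _ => sq_nonneg _)
    (Finset.mem_univ j)

lemma one_le_freq {k : Z2} (hk : k ≠ 0) : 1 ≤ freq k := by
  obtain ⟨j, hj⟩ := Function.ne_iff.1 hk
  refine le_trans ?_ (abs_le_freq k j)
  exact_mod_cast Int.one_le_abs hj

lemma freq_pos {k : Z2} (hk : k ≠ 0) : 0 < freq k := one_pos.trans_le (one_le_freq hk)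

lemma freq_ne_zero {k : Z2} (hk : k ≠ 0) : freq k ≠ 0 := (freq_pos hk).ne'

lemma norm_le_freq (k : Z2) : ‖k‖ ≤ freq k := by
  refine (pi_norm_le_iff_of_nonneg (freq_nonneg k)).2 fun j => ?_
  simpa [Int.norm_eq_abs] using abs_le_freq k j

/-- The exponent 3 exceeds the dimension 2. The frequency 0 contributes nothing because the inverse
of 0 is 0. -/
lemma tsum_freq_cube_ne_top : ∑' k : Z2, ENNReal.ofReal ((freq k ^ 3)⁻¹) ≠ ∞ := by
  refine Summable.tsum_ofReal_ne_top ?_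
  refine .of_nonneg_of_le (fun k => by have := freq_nonneg k; positivity) (fun k => ?_)
    (EisensteinSeries.summable_one_div_norm_rpow (k := 3) (by norm_num))
  rcases eq_or_ne k 0 with rfl | hk
  · simp
  · have h : (0 : ℝ) < ‖k‖ := norm_pos_iff.2 hk
    rw [Real.rpow_neg h.le]
    have : ‖k‖ ^ (3 : ℝ) = ‖k‖ ^ 3 := by norm_cast
    rw [this]
    have := norm_le_freq k
    gcongr

/-- A telescoping bound: with x = s(N+1), (1 + x − s)(1 + x) ≤ (1 + x)² ≤ 2(1 + x²), and the
reciprocal of the left side is a difference of consecutive terms divided by s. -/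
lemma sum_range_inv_one_add_sq_le {s : ℝ} (hs : 0 < s) (N : ℕ) :
    ∑ n ∈ Finset.range N, (1 + (s * (n + 1)) ^ 2)⁻¹ ≤ 2 / s * (1 - (1 + s * N)⁻¹) := by
  induction N with
  | zero => simp
  | succ N ih =>
    rw [Finset.sum_range_succ]
    have h1 : 0 < 1 + s * N := by positivity
    have h2 : 0 < 1 + s * (N + 1) := by positivity
    have key : (1 + (s * (N + 1)) ^ 2)⁻¹ ≤
        2 / s * ((1 + s * N)⁻¹ - (1 + s * (N + 1))⁻¹) := by
      have e : 2 / s * ((1 + s * N)⁻¹ - (1 + s * (N + 1))⁻¹)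
          = 2 * ((1 + s * N) * (1 + s * (N + 1)))⁻¹ := by
        field_simp; ring
      rw [e, inv_eq_one_div, ← div_eq_mul_inv, div_le_div_iff₀ (by positivity) (by positivity)]
      nlinarith [sq_nonneg (s * (N + 1) - 1)]
    push_cast
    calc _ ≤ 2 / s * (1 - (1 + s * N)⁻¹) +
          2 / s * ((1 + s * N)⁻¹ - (1 + s * (N + 1))⁻¹) := add_le_add ih key
      _ = _ := by ring

lemma tsum_int_inv_one_add_sq_le {s : ℝ} (hs : 0 < s) :
    ∑' n : ℤ, ENNReal.ofReal ((1 + (s * n) ^ 2)⁻¹) ≤ ENNReal.ofReal (1 + 4 / s) := by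
  have hN : ∑' n : ℕ, ENNReal.ofReal ((1 + (s * (n + 1)) ^ 2)⁻¹) ≤ ENNReal.ofReal (2 / s) := by
    refine ENNReal.tsum_le_of_sum_range_le fun N => ?_
    rw [← ENNReal.ofReal_sum_of_nonneg fun _ _ => by positivity]
    refine ENNReal.ofReal_le_ofReal ((sum_range_inv_one_add_sq_le hs N).trans ?_)
    have : 0 < (1 + s * N)⁻¹ := by positivity
    have h2 : 0 < 2 / s := by positivity
    nlinarith
  have e := HasSum.of_nat_of_neg_add_one
    (f := fun n : ℤ => ENNReal.ofReal ((1 + (s * n) ^ 2)⁻¹))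
    ENNReal.summable.hasSum ENNReal.summable.hasSum
  rw [e.tsum_eq, tsum_eq_zero_add' ENNReal.summable]
  have h3 : ∀ n : ℕ, (s * ((-(n + 1) : ℤ) : ℝ)) ^ 2 = (s * (n + 1)) ^ 2 := fun n => by
    push_cast; ring
  simp only [h3]
  push_cast
  calc _ ≤ ENNReal.ofReal 1 + ENNReal.ofReal (2 / s) + ENNReal.ofReal (2 / s) := by
        gcongr
        simp
    _ = _ := by
        rw [← ENNReal.ofReal_add (by positivity) (by positivity),
          ← ENNReal.ofReal_add (by positivity) (by positivity)]
        congr 1; ring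

/-- The Japanese-bracket weight `1 + c |k|²`. -/
def wt (c : ℝ) (k : Z2) : ℝ := 1 + c * freq k ^ 2

lemma one_le_wt {c : ℝ} (hc : 0 ≤ c) (k : Z2) : 1 ≤ wt c k := by
  unfold wt; have : 0 ≤ c * freq k ^ 2 := by positivity
  linarith

lemma wt_pos {c : ℝ} (hc : 0 ≤ c) (k : Z2) : 0 < wt c k := one_pos.trans_le (one_le_wt hc k)

/-- The weight dominates 1 + c kⱼ² for both j, so its square dominates their product and the lattice
sum factors into two sums over ℤ. The constant comes from (1 + 4/s)² ≤ 32(1 + 1/s²) with s = √c. -/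
lemma tsum_wt_le {c : ℝ} (hc : 0 < c) :
    ∑' k : Z2, ENNReal.ofReal ((wt c k)⁻¹ ^ 2) ≤ ENNReal.ofReal (32 * (1 + 1 / c)) := by
  set s := Real.sqrt c
  have hs : 0 < s := Real.sqrt_pos.2 hc
  have hsc : s ^ 2 = c := Real.sq_sqrt hc.le
  set F : ℤ → ℝ≥0∞ := fun n => ENNReal.ofReal ((1 + (s * n) ^ 2)⁻¹)
  have h1 : ∀ k : Z2, ENNReal.ofReal ((wt c k)⁻¹ ^ 2) ≤ F (k 0) * F (k 1) := fun k => by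
    rw [← ENNReal.ofReal_mul (by positivity), pow_two]
    refine ENNReal.ofReal_le_ofReal ?_
    have hf := freq_sq k
    rw [Fin.sum_univ_two] at hf
    have a : 1 + (s * k 0) ^ 2 ≤ wt c k := by
      rw [wt, hf, mul_pow, hsc]; nlinarith [mul_nonneg hc.le (sq_nonneg (k 1 : ℝ))]
    have b : 1 + (s * k 1) ^ 2 ≤ wt c k := by
      rw [wt, hf, mul_pow, hsc]; nlinarith [mul_nonneg hc.le (sq_nonneg (k 0 : ℝ))]
    have hw := wt_pos hc.le k
    gcongr
  calc _ ≤ ∑' k : Z2, F (k 0) * F (k 1) := ENNReal.tsum_le_tsum h1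
    _ = ∑' p : ℤ × ℤ, F p.1 * F p.2 :=
        (finTwoArrowEquiv ℤ).tsum_eq (fun p : ℤ × ℤ => F p.1 * F p.2)
    _ = (∑' n, F n) * ∑' n, F n := by
        rw [ENNReal.tsum_prod (f := fun a b => F a * F b)]
        simp only [ENNReal.tsum_mul_left, ENNReal.tsum_mul_right]
    _ ≤ ENNReal.ofReal (1 + 4 / s) * ENNReal.ofReal (1 + 4 / s) := by
        gcongr <;> exact tsum_int_inv_one_add_sq_le hs
    _ ≤ _ := by
        rw [← ENNReal.ofReal_mul (by positivity)]
        refine ENNReal.ofReal_le_ofReal ?_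
        have e : 1 / c = (1 / s) ^ 2 := by rw [← hsc]; field_simp
        rw [e, show 4 / s = 4 * (1 / s) by ring]
        nlinarith [sq_nonneg (1 / s - 1)]

lemma tsum_wt_conv_le {c : ℝ} (hc : 0 < c) (n : Z2) :
    ∑' k : Z2, ENNReal.ofReal ((wt c k)⁻¹) * ENNReal.ofReal ((wt c (n - k))⁻¹) ≤
      ENNReal.ofReal (32 * (1 + 1 / c)) := by
  have h := tsum_mul_sq_le (fun k : Z2 => ENNReal.ofReal ((wt c k)⁻¹))
    (fun k : Z2 => ENNReal.ofReal ((wt c (n - k))⁻¹))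
  have hp : ∀ k : Z2, 0 ≤ (wt c k)⁻¹ := fun k => (inv_pos.2 (wt_pos hc.le k)).le
  simp only [← ENNReal.ofReal_pow (hp _)] at h
  have e := (Equiv.subLeft n).tsum_eq (fun k : Z2 => ENNReal.ofReal ((wt c k)⁻¹ ^ 2))
  simp only [Equiv.subLeft_apply] at e
  rw [e, ← pow_two] at h
  exact ((ENNReal.pow_le_pow_left_iff two_ne_zero).1 h).trans (tsum_wt_le hc)

/-! ### Trigonometric polynomials -/

lemma integral_mFourier {m : Z2} (hm : m ≠ 0) : ∫ x, mFourier m x ∂mu = 0 := by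
  have h := (UnitAddTorus.orthonormal_mFourier (d := Fin 2)).2 hm.symm
  simp only [ContinuousMap.inner_toLp, ← UnitAddTorus.mFourier_neg,
    ← UnitAddTorus.mFourier_add] at h
  simp only [neg_zero, add_zero] at h
  exact h

lemma mFourierCoeff_mFourier (n k : Z2) :
    mFourierCoeff (mFourier n) k = if n = k then 1 else 0 := by
  rw [mFourierCoeff_eq]
  simp only [← UnitAddTorus.mFourier_add]
  split_ifs with h
  · subst h; simp [UnitAddTorus.mFourier_zero]
  · exact integral_mFourier (by rw [neg_add_eq_sub]; exact sub_ne_zero.2 h)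

/-- The trigonometric polynomial with given coefficients. -/
def trig : (Z2 →₀ ℂ) →ₗ[ℂ] C(T2, ℂ) := Finsupp.linearCombination ℂ (mFourier (d := Fin 2))

lemma trig_apply (a : Z2 →₀ ℂ) (x : T2) : trig a x = a.sum fun k c => c * mFourier k x := by
  simp only [trig, Finsupp.linearCombination_apply, Finsupp.sum, ContinuousMap.coe_sum,
    Finset.sum_apply, ContinuousMap.smul_apply, smul_eq_mul]

lemma integrable_continuousMap (f : C(T2, ℂ)) : Integrable f mu :=
  f.continuous.integrable_of_hasCompactSupport (HasCompactSupport.of_compactSpace f)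

lemma mFourierCoeff_trig (a : Z2 →₀ ℂ) (k : Z2) : mFourierCoeff (trig a) k = a k := by
  induction a using Finsupp.induction_linear with
  | zero => simp [mFourierCoeff_eq]
  | add f g hf hg =>
    rw [map_add, Finsupp.add_apply, ← hf, ← hg]
    exact mFourierCoeff_add (integrable_continuousMap _) (integrable_continuousMap _) k
  | single n c =>
    have : (trig (Finsupp.single n c) : T2 → ℂ) = fun x => c * mFourier n x := by
      ext x; simp [trig_apply]
    rw [this, mFourierCoeff_const_mul, mFourierCoeff_mFourier, Finsupp.single_apply]
    simp

/-- The real part of a trigonometric polynomial. -/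
def rtrig (a : Z2 →₀ ℂ) (x : T2) : ℝ := (trig a x).re

lemma continuous_rtrig (a : Z2 →₀ ℂ) : Continuous (rtrig a) :=
  Complex.continuous_re.comp (trig a).continuous

lemma memLp_of_continuous {f : T2 → ℝ} (hf : Continuous f) (p : ℝ≥0∞) : MemLp f p mu := by
  obtain ⟨C, hC⟩ := (isCompact_range hf).isBounded.exists_norm_le
  exact (memLp_top_of_bound hf.aestronglyMeasurable C
    (.of_forall fun x => hC _ ⟨x, rfl⟩)).mono_exponent le_top

lemma memLp_rtrig (a : Z2 →₀ ℂ) (p : ℝ≥0∞) : MemLp (rtrig a) p mu :=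
  memLp_of_continuous (continuous_rtrig a) p

/-- The coefficients of the conjugate of a trigonometric polynomial. -/
def conjCoeff (a : Z2 →₀ ℂ) : Z2 →₀ ℂ :=
  Finsupp.equivMapDomain (Equiv.neg Z2) (a.mapRange conj (map_zero _))

lemma conjCoeff_apply (a : Z2 →₀ ℂ) (k : Z2) : conjCoeff a k = conj (a (-k)) := rfl

lemma trig_conjCoeff (a : Z2 →₀ ℂ) (x : T2) : trig (conjCoeff a) x = conj (trig a x) := by
  rw [conjCoeff, trig, Finsupp.linearCombination_equivMapDomain,
    Finsupp.linearCombination_apply, Finsupp.sum_mapRange_index (by simp), ← trig, trig_apply]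
  simp only [Finsupp.sum, ContinuousMap.coe_sum, Finset.sum_apply, ContinuousMap.smul_apply,
    smul_eq_mul, map_sum, map_mul, Function.comp, Equiv.neg_apply, UnitAddTorus.mFourier_neg]

/-- The coefficients of the real part of a trigonometric polynomial. -/
def reCoeff (a : Z2 →₀ ℂ) : Z2 →₀ ℂ := (1 / 2 : ℂ) • (a + conjCoeff a)

lemma hermitian_reCoeff (a : Z2 →₀ ℂ) : Hermitian (reCoeff a) := fun k => by
  simp [reCoeff, conjCoeff_apply, add_comm, map_ofNat]

lemma trig_reCoeff (a : Z2 →₀ ℂ) (x : T2) : trig (reCoeff a) x = rtrig a x := by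
  rw [reCoeff, map_smul, map_add, ContinuousMap.smul_apply, ContinuousMap.add_apply,
    trig_conjCoeff, Complex.add_conj, rtrig]
  simp

lemma rtrig_reCoeff (a : Z2 →₀ ℂ) : rtrig (reCoeff a) = rtrig a := by
  ext x; rw [rtrig, trig_reCoeff, Complex.ofReal_re]

lemma reCoeff_of_hermitian {a : Z2 →₀ ℂ} (ha : Hermitian a) : reCoeff a = a := by
  ext k
  have : conj (a (-k)) = a k := by rw [ha, Complex.conj_conj]
  simp only [reCoeff, Finsupp.smul_apply, Finsupp.add_apply, conjCoeff_apply, this, smul_eq_mul]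
  ring

lemma trig_of_hermitian {a : Z2 →₀ ℂ} (ha : Hermitian a) (x : T2) : trig a x = rtrig a x := by
  conv_lhs => rw [← reCoeff_of_hermitian ha]
  exact trig_reCoeff a x

lemma coeff_rtrig {a : Z2 →₀ ℂ} (ha : Hermitian a) (k : Z2) : coeff (rtrig a) k = a k := by
  rw [← mFourierCoeff_trig a k, coeff]
  congr 1; ext x; rw [trig_of_hermitian ha]

/-- Action of a Fourier multiplier on the coefficients of a trigonometric polynomial. -/
def symMul (m : Z2 → ℂ) (a : Z2 →₀ ℂ) : Z2 →₀ ℂ :=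
  Finsupp.onFinset a.support (fun k => m k * a k) fun k hk => by
    rw [Finsupp.mem_support_iff]; exact right_ne_zero_of_mul hk

@[simp] lemma symMul_apply (m : Z2 → ℂ) (a : Z2 →₀ ℂ) (k : Z2) : symMul m a k = m k * a k := rfl

lemma Hermitian.symMul {m : Z2 → ℂ} (hm : Hermitian m) {a : Z2 →₀ ℂ} (ha : Hermitian a) :
    Hermitian (symMul m a) := fun k => by simp [hm k, ha k]

/-! ### Convergence in `L²` and approximation by trigonometric polynomials -/

lemma eLpNorm_two_eq {f : T2 → ℝ} (hf : MemLp f 2 mu) :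
    eLpNorm f 2 mu = ENNReal.ofReal (Real.sqrt (∫ x, f x ^ 2 ∂mu)) := by
  rw [hf.eLpNorm_eq_integral_rpow_norm (by norm_num) (by norm_num), Real.sqrt_eq_rpow]
  simp

lemma eLpNorm_two_le_of_coeff {f g : T2 → ℝ} (hf : MemLp f 2 mu) (hg : MemLp g 2 mu) {C : ℝ}
    (hC : 0 ≤ C) (h : ∀ k, ‖coeff f k‖ ≤ C * ‖coeff g k‖) :
    eLpNorm f 2 mu ≤ ENNReal.ofReal C * eLpNorm g 2 mu := by
  rw [eLpNorm_two_eq hf, eLpNorm_two_eq hg, ← ENNReal.ofReal_mul hC]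
  refine ENNReal.ofReal_le_ofReal ?_
  have : C = Real.sqrt (C ^ 2) := (Real.sqrt_sq hC).symm
  rw [this, ← Real.sqrt_mul (by positivity)]
  refine Real.sqrt_le_sqrt ?_
  refine hasSum_le (fun k => ?_) (hasSum_sq_coeff hf) ((hasSum_sq_coeff hg).mul_left (C ^ 2))
  rw [← mul_pow]
  exact pow_le_pow_left₀ (norm_nonneg _) (h k) 2

/-- A bound in `L^p` passes to limits in `L²`. -/
lemma eLpNorm_le_of_tendsto {f : ℕ → T2 → ℝ} {g : T2 → ℝ} (hf : ∀ n, AEStronglyMeasurable (f n) mu)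
    (hg : AEStronglyMeasurable g mu)
    (hlim : Tendsto (fun n => eLpNorm (f n - g) 2 mu) atTop (𝓝 0)) {p C : ℝ≥0∞}
    (h : ∀ᶠ n in atTop, eLpNorm (f n) p mu ≤ C) : eLpNorm g p mu ≤ C := by
  obtain ⟨ns, hns, hae⟩ :=
    (tendstoInMeasure_of_tendsto_eLpNorm two_ne_zero hf hg hlim).exists_seq_tendsto_ae
  exact Lp.eLpNorm_le_of_ae_tendsto (hns.tendsto_atTop.eventually h) (fun n => hf _) hae

/-- Complex trigonometric polynomials are dense; taking the real part of an approximant does not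
increase its distance to a real function, and makes the coefficients Hermitian. -/
lemma exists_rtrig_approx {p : ℝ≥0∞} [Fact (1 ≤ p)] (hp : p ≠ ∞) {f : T2 → ℝ} (hf : MemLp f p mu)
    {ε : ℝ≥0∞} (hε : ε ≠ 0) :
    ∃ a : Z2 →₀ ℂ, Hermitian a ∧ eLpNorm (f - rtrig a) p mu ≤ ε := by
  have hf' : MemLp (fun x => (f x : ℂ)) p mu := hf.ofReal
  have hmem : hf'.toLp ∈ closure
      (Submodule.span ℂ (Set.range (UnitAddTorus.mFourierLp (d := Fin 2) p)) : Set (Lp ℂ p mu)) := by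
    have := UnitAddTorus.span_mFourierLp_closure_eq_top (d := Fin 2) hp
    rw [← Submodule.topologicalClosure_coe]
    erw [this]
    trivial
  obtain ⟨g, hg, hd⟩ := EMetric.mem_closure_iff.1 hmem ε (pos_iff_ne_zero.2 hε)
  obtain ⟨a, ha⟩ := (Finsupp.mem_span_range_iff_exists_finsupp).1 hg
  have hga : (g : T2 → ℂ) =ᵐ[mu] trig a := by
    have e : g = ContinuousMap.toLp (E := ℂ) p mu ℂ (trig a) := by
      rw [← ha, trig, Finsupp.linearCombination_apply, Finsupp.sum, Finsupp.sum, map_sum]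
      refine Finset.sum_congr rfl fun k _ => ?_
      rw [map_smul]; rfl
    rw [e]
    exact ContinuousMap.coeFn_toLp mu (trig a)
  refine ⟨reCoeff a, hermitian_reCoeff a, ?_⟩
  rw [rtrig_reCoeff]
  rw [Lp.edist_def] at hd
  refine le_trans ?_ hd.le
  refine eLpNorm_mono_ae ?_
  filter_upwards [hf'.coeFn_toLp, hga] with x h1 h2
  simp only [Pi.sub_apply, h1, h2]
  have : f x - rtrig a x = ((f x : ℂ) - trig a x).re := by simp [rtrig]
  rw [this]
  exact Complex.abs_re_le_norm _

lemma exists_rtrig_tendsto {p : ℝ≥0∞} [Fact (1 ≤ p)] (hp : p ≠ ∞) {f : T2 → ℝ}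
    (hf : MemLp f p mu) :
    ∃ a : ℕ → Z2 →₀ ℂ, (∀ n, Hermitian (a n)) ∧
      Tendsto (fun n => eLpNorm (f - rtrig (a n)) p mu) atTop (𝓝 0) := by
  have h : ∀ n : ℕ, ∃ a : Z2 →₀ ℂ, Hermitian a ∧ eLpNorm (f - rtrig a) p mu ≤ (n : ℝ≥0∞)⁻¹ :=
    fun n => exists_rtrig_approx hp hf (by simp)
  choose a h1 h2 using h
  exact ⟨a, h1, tendsto_of_tendsto_of_tendsto_of_le_of_le tendsto_const_nhds
    ENNReal.tendsto_inv_nat_nhds_zero (fun _ => zero_le) h2⟩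

/-- A bounded symbol acts continuously on L² by Parseval. Combined with `eLpNorm_le_of_tendsto`,
this extends estimates in other L^p norms from polynomials to general functions. -/
lemma tendsto_multiplier {m : Z2 → ℂ} (hm : Hermitian m) {C : ℝ} (hC : ∀ k, ‖m k‖ ≤ C)
    {f : T2 → ℝ} (hf : MemLp f 2 mu) {a : ℕ → Z2 →₀ ℂ} (ha : ∀ n, Hermitian (a n))
    (h : Tendsto (fun n => eLpNorm (f - rtrig (a n)) 2 mu) atTop (𝓝 0)) :
    Tendsto (fun n => eLpNorm (rtrig (symMul m (a n)) - multiplier m f) 2 mu) atTop (𝓝 0) := by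
  have hC0 : 0 ≤ C := (norm_nonneg _).trans (hC 0)
  have h2 := ENNReal.Tendsto.const_mul (a := ENNReal.ofReal C) h (.inr ENNReal.ofReal_ne_top)
  rw [mul_zero] at h2
  refine tendsto_of_tendsto_of_tendsto_of_le_of_le tendsto_const_nhds h2 (fun _ => zero_le)
    fun n => ?_
  refine eLpNorm_two_le_of_coeff ((memLp_rtrig _ _).sub (memLp_multiplier m f))
    (hf.sub (memLp_rtrig _ _)) hC0 fun k => ?_
  rw [coeff_sub (integrable_of_memLp (memLp_rtrig _ 2)) (integrable_of_memLp (memLp_multiplier m f)),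
    coeff_sub (integrable_of_memLp hf) (integrable_of_memLp (memLp_rtrig _ 2)), coeff_rtrig (hm.symMul (ha n)),
    coeff_rtrig (ha n), coeff_multiplier hm (memlp_of_bounded hC hf), symMul_apply, ← mul_sub,
    norm_mul, norm_sub_rev]
  gcongr
  exact hC k

/-- The cube of frequencies `|kⱼ| ≤ N`. -/
def cube (N : ℕ) : Finset Z2 := Finset.Icc (fun _ => -(N : ℤ)) (fun _ => (N : ℤ))

lemma mem_cube {N : ℕ} {k : Z2} : k ∈ cube N ↔ ∀ j, |k j| ≤ N := by
  simp only [cube, Finset.mem_Icc, Pi.le_def, ← forall_and, abs_le]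

/-- The truncated Fourier series of `f`. -/
def trunc (f : T2 → ℝ) (N : ℕ) : Z2 →₀ ℂ :=
  Finsupp.onFinset (cube N) (fun k => if k ∈ cube N then coeff f k else 0) fun k hk => by
    by_contra h; simp [h] at hk

lemma trunc_apply (f : T2 → ℝ) (N : ℕ) (k : Z2) :
    trunc f N k = if k ∈ cube N then coeff f k else 0 := rfl

lemma norm_trunc_le (f : T2 → ℝ) (N : ℕ) (k : Z2) : ‖trunc f N k‖ ≤ ‖coeff f k‖ := by
  rw [trunc_apply]; split_ifs <;> simp

lemma hermitian_trunc (f : T2 → ℝ) (N : ℕ) : Hermitian (trunc f N) := fun k => by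
  have : -k ∈ cube N ↔ k ∈ cube N := by simp [mem_cube]
  simp only [trunc_apply, this, coeff_neg_freq]
  split_ifs <;> simp

/-- By Parseval the squared error is the tail of a convergent series. Truncations are preferred to
arbitrary approximants when a bound is expressed by weighted coefficients, since they never enlarge
a coefficient. -/
lemma tendsto_trunc {f : T2 → ℝ} (hf : MemLp f 2 mu) :
    Tendsto (fun N => eLpNorm (rtrig (trunc f N) - f) 2 mu) atTop (𝓝 0) := by
  have hmono : Tendsto cube atTop atTop := by
    refine tendsto_atTop_finset_of_monotone (fun M N h k hk => ?_) fun k => ?_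
    · rw [mem_cube] at hk ⊢
      exact fun j => (hk j).trans (by exact_mod_cast h)
    · refine ⟨(|k 0| + |k 1|).toNat, mem_cube.2 fun j => ?_⟩
      have := abs_nonneg (k 0); have := abs_nonneg (k 1)
      rw [Int.toNat_of_nonneg (by positivity)]
      fin_cases j <;> simp
  have h1 := (tendsto_tsum_compl_atTop_zero fun k => ‖coeff f k‖ ^ 2).comp hmono
  have h2 : ∀ N, eLpNorm (rtrig (trunc f N) - f) 2 mu = ENNReal.ofReal
      (Real.sqrt (∑' k : {k // k ∉ cube N}, ‖coeff f k‖ ^ 2)) := fun N => by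
    have hm := (memLp_rtrig (trunc f N) 2).sub hf
    rw [eLpNorm_two_eq hm, ← (hasSum_sq_coeff hm).tsum_eq]
    congr 2
    have e : ∀ k, ‖coeff (rtrig (trunc f N) - f) k‖ ^ 2 =
        Set.indicator {k | k ∉ cube N} (fun k => ‖coeff f k‖ ^ 2) k := fun k => by
      rw [coeff_sub (integrable_of_memLp (memLp_rtrig _ 2)) (integrable_of_memLp hf),
        coeff_rtrig (hermitian_trunc f N), trunc_apply]
      by_cases h : k ∈ cube N <;> simp [h]
    simp only [e]
    exact (tsum_subtype {k | k ∉ cube N} fun k => ‖coeff f k‖ ^ 2).symm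
  simp only [h2]
  have h3 := (ENNReal.continuous_ofReal.comp Real.continuous_sqrt).tendsto 0
  simp only [Function.comp, Real.sqrt_zero, ENNReal.ofReal_zero] at h3
  exact h3.comp h1

/-! ### Directional Hilbert transforms -/

/-- The direction `(cos t, sin t)`. -/
def dir (t : ℝ) (j : Fin 2) : ℝ := if j = 0 then Real.cos t else Real.sin t

/-- The product `θ · k` with the direction `θ = (cos t, sin t)`. -/
def dirDot (t : ℝ) (k : Z2) : ℝ := k 0 * Real.cos t + k 1 * Real.sin t

/-- The symbol `-i sgn (θ · k)` of the directional Hilbert transform. -/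
def hsym (t : ℝ) (k : Z2) : ℂ := -Complex.I * (Real.sign (dirDot t k) : ℂ)

lemma dirDot_neg (t : ℝ) (k : Z2) : dirDot t (-k) = -dirDot t k := by
  simp [dirDot]; ring

lemma dirDot_add (t : ℝ) (k l : Z2) : dirDot t (k + l) = dirDot t k + dirDot t l := by
  simp [dirDot]; ring

lemma hermitian_hsym (t : ℝ) : Hermitian (hsym t) := fun k => by
  rw [hsym, hsym, dirDot_neg, Real.sign_neg]
  simp

/-- Trigonometric polynomials whose frequencies satisfy `θ · k > 0`. -/
def positiveSpan (t : ℝ) : Submodule ℂ C(T2, ℂ) :=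
  Submodule.span ℂ (mFourier (d := Fin 2) '' {k | 0 < dirDot t k})

/-- The open half-plane θ·k > 0 is closed under addition and omits 0, so powers of an analytic
polynomial remain analytic and have zero integral. -/
lemma mul_mem_positiveSpan {t : ℝ} {f g : C(T2, ℂ)} (hf : f ∈ positiveSpan t)
    (hg : g ∈ positiveSpan t) : f * g ∈ positiveSpan t := by
  have h := Submodule.mul_mem_mul hf hg
  rw [positiveSpan, Submodule.span_mul_span] at h
  refine Submodule.span_mono ?_ h
  rintro _ ⟨_, ⟨k, hk, rfl⟩, _, ⟨l, hl, rfl⟩, rfl⟩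
  refine ⟨k + l, ?_, ?_⟩
  · simp only [Set.mem_ofPred_eq] at hk hl ⊢
    rw [dirDot_add]; positivity
  · ext x; simp [UnitAddTorus.mFourier_add]

lemma integral_eq_zero_of_mem_positiveSpan {t : ℝ} {f : C(T2, ℂ)} (hf : f ∈ positiveSpan t) :
    ∫ x, f x ∂mu = 0 := by
  induction hf using Submodule.span_induction with
  | mem f hf =>
    obtain ⟨k, hk, rfl⟩ := hf
    refine integral_mFourier ?_
    rintro rfl
    simp [dirDot] at hk
  | zero => simp
  | add f g _ _ hf hg =>
    simp only [ContinuousMap.add_apply]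
    rw [integral_add (integrable_continuousMap f) (integrable_continuousMap g), hf, hg, add_zero]
  | smul c f _ hf =>
    simp only [ContinuousMap.smul_apply]
    rw [integral_smul, hf, smul_zero]

/-- The analytic part `f + i H f` of a trigonometric polynomial has positive frequencies. -/
lemma trig_add_hilbert_mem {t : ℝ} {b : Z2 →₀ ℂ} (hb : ∀ k ∈ b.support, dirDot t k ≠ 0) :
    trig b + Complex.I • trig (symMul (hsym t) b) ∈ positiveSpan t := by
  rw [← map_smul, ← map_add, trig, Finsupp.linearCombination_apply]
  refine Submodule.sum_mem _ fun k hk => ?_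
  rw [Finsupp.mem_support_iff] at hk
  refine Submodule.smul_mem _ _ ?_
  refine Submodule.subset_span ⟨k, ?_, rfl⟩
  by_contra hneg
  simp only [Set.mem_ofPred_eq, not_lt] at hneg
  apply hk
  by_cases h0 : b k = 0
  · simp [h0]
  · have h1 := hb k (by simpa using h0)
    simp only [Finsupp.add_apply, Finsupp.smul_apply, symMul_apply, hsym,
      Real.sign_of_neg (lt_of_le_of_ne hneg h1), smul_eq_mul]
    push_cast
    linear_combination (b k) * Complex.I_mul_I

/-- With h = Hf, the function F = f + ih is analytic in the direction `t`, hence ∫ F⁴ = 0. The real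
part says that ∫ (f⁴ − 6f²h² + h⁴) = 0, and the mixed term is absorbed by Young's inequality. -/
lemma integral_hilbert_pow_four_le {t : ℝ} {b : Z2 →₀ ℂ} (hh : Hermitian b)
    (hb : ∀ k ∈ b.support, dirDot t k ≠ 0) :
    ∫ x, rtrig (symMul (hsym t) b) x ^ 4 ∂mu ≤ 34 * ∫ x, rtrig b x ^ 4 ∂mu := by
  set f := rtrig b with hf
  set h := rtrig (symMul (hsym t) b) with hhd
  have hF := trig_add_hilbert_mem hb
  set F := trig b + Complex.I • trig (symMul (hsym t) b)
  have hz := integral_eq_zero_of_mem_positiveSpan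
    (mul_mem_positiveSpan (mul_mem_positiveSpan hF hF) (mul_mem_positiveSpan hF hF))
  have hFx : ∀ x, F x = f x + Complex.I * h x := fun x => by
    simp only [F, ContinuousMap.add_apply, ContinuousMap.smul_apply, smul_eq_mul,
      trig_of_hermitian hh, trig_of_hermitian ((hermitian_hsym t).symMul hh), hf, hhd]
  have hre : ∫ x, (f x ^ 4 - 6 * (f x ^ 2 * h x ^ 2) + h x ^ 4) ∂mu = 0 := by
    have := congrArg Complex.re hz
    have e : ∀ x, (F * F * (F * F)) x
        = ((f x ^ 4 - 6 * (f x ^ 2 * h x ^ 2) + h x ^ 4 : ℝ) : ℂ)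
          + ((4 * f x ^ 3 * h x - 4 * f x * h x ^ 3 : ℝ) : ℂ) * Complex.I := fun x => by
      simp only [ContinuousMap.mul_apply, hFx]
      push_cast
      have i2 : Complex.I ^ 2 = -1 := Complex.I_sq
      have i3 : Complex.I ^ 3 = -Complex.I := Complex.I_pow_three
      have i4 : Complex.I ^ 4 = 1 := Complex.I_pow_four
      ring_nf
      rw [i2, i3, i4]
      ring
    have e2 : (∫ x, (F * F * (F * F)) x ∂mu).re = ∫ x, ((F * F * (F * F)) x).re ∂mu :=
      (integral_re (integrable_continuousMap (F * F * (F * F)))).symm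
    rw [e2] at this
    simpa only [e, Complex.add_re, Complex.ofReal_re, Complex.mul_I_re, Complex.ofReal_im, neg_zero,
      add_zero, Complex.zero_re] using this
  have cf : Continuous f := continuous_rtrig b
  have ch : Continuous h := continuous_rtrig _
  have i1 : ∀ {g : T2 → ℝ}, Continuous g → Integrable g mu := fun hg =>
    memLp_one_iff_integrable.1 (memLp_of_continuous hg 1)
  have key : ∫ x, (h x ^ 4 / 2 - 17 * f x ^ 4) ∂mu ≤
      ∫ x, (f x ^ 4 - 6 * (f x ^ 2 * h x ^ 2) + h x ^ 4) ∂mu := by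
    refine integral_mono (i1 (by fun_prop)) (i1 (by fun_prop)) fun x => ?_
    simp only
    -- The difference of the two sides is (h² − 6f²)²/2; the final constant is 34 = 2 · 17.
    nlinarith [sq_nonneg (h x ^ 2 - 6 * f x ^ 2)]
  rw [hre, integral_sub (i1 (by fun_prop)) (i1 (by fun_prop)), integral_div,
    integral_const_mul] at key
  linarith

/-! ### Averages over directions -/

lemma dirDot_eq {k : Z2} (_hk : k ≠ 0) : ∃ φ : ℝ, freq k * Real.cos φ = k 0 ∧
    freq k * Real.sin φ = k 1 ∧ ∀ t, dirDot t k = freq k * Real.cos (t - φ) := by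
  set z : ℂ := ⟨k 0, k 1⟩
  have hz : ‖z‖ = freq k := by
    rw [Complex.norm_def, Complex.normSq_apply, freq, Fin.sum_univ_two]
    congr 1; simp [z]; ring
  have h0 : freq k * Real.cos z.arg = k 0 := by rw [← hz, Complex.norm_mul_cos_arg]
  have h1 : freq k * Real.sin z.arg = k 1 := by rw [← hz, Complex.norm_mul_sin_arg]
  refine ⟨z.arg, h0, h1, fun t => ?_⟩
  rw [dirDot, Real.cos_sub, ← h0, ← h1]; ring

lemma ae_dirDot_ne_zero {k : Z2} (hk : k ≠ 0) : ∀ᵐ t : ℝ, dirDot t k ≠ 0 := by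
  obtain ⟨φ, -, -, h⟩ := dirDot_eq hk
  have hc : (Set.range fun n : ℤ => (2 * (n : ℝ) + 1) * Real.pi / 2 + φ).Countable :=
    Set.countable_range _
  filter_upwards [hc.ae_notMem volume] with t ht h0
  rw [h, mul_eq_zero, Real.cos_eq_zero_iff] at h0
  obtain h0 | ⟨n, hn⟩ := h0
  · exact freq_ne_zero hk h0
  · exact ht ⟨n, by simp only; linarith⟩

/-- By periodicity the interval may start at φ − π/2; the sign is then +1 on the first half period
and −1 on the second, and each half is evaluated by the antiderivative. -/
lemma integral_mul_sign_cos {g G : ℝ → ℝ} (hg : Continuous g)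
    (hG : ∀ t, HasDerivAt G (g t) t) (hper : Function.Periodic g (2 * Real.pi)) (φ : ℝ) :
    ∫ t in (0 : ℝ)..(2 * Real.pi), g t * Real.sign (Real.cos (t - φ)) =
      2 * G (φ + Real.pi / 2) - G (φ - Real.pi / 2) - G (φ + 3 * Real.pi / 2) := by
  have hpi := Real.pi_pos
  have hp : Function.Periodic (fun t => g t * Real.sign (Real.cos (t - φ))) (2 * Real.pi) :=
    fun t => by
      simp only [hper t, show t + 2 * Real.pi - φ = t - φ + 2 * Real.pi by ring,
        Real.cos_add_two_pi]
  have h1 : ∫ t in (φ - Real.pi / 2)..(φ + Real.pi / 2), g t * Real.sign (Real.cos (t - φ)) =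
      ∫ t in (φ - Real.pi / 2)..(φ + Real.pi / 2), g t := by
    refine intervalIntegral.integral_congr_Ioo_of_le (by linarith) fun t ht => ?_
    have : 0 < Real.cos (t - φ) :=
      Real.cos_pos_of_mem_Ioo ⟨by linarith [ht.1], by linarith [ht.2]⟩
    simp only [Real.sign_of_pos this, mul_one]
  have h2 : ∫ t in (φ + Real.pi / 2)..(φ + 3 * Real.pi / 2),
      g t * Real.sign (Real.cos (t - φ)) =
      ∫ t in (φ + Real.pi / 2)..(φ + 3 * Real.pi / 2), -g t := by
    refine intervalIntegral.integral_congr_Ioo_of_le (by linarith) fun t ht => ?_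
    have : Real.cos (t - φ) < 0 :=
      Real.cos_neg_of_pi_div_two_lt_of_lt (by linarith [ht.1]) (by linarith [ht.2])
    simp only [Real.sign_of_neg this]
    ring
  have hm : Measurable fun t => g t * Real.sign (Real.cos (t - φ)) := by
    refine hg.measurable.mul (Measurable.comp (g := Real.sign) ?_ (by fun_prop))
    unfold Real.sign
    exact Measurable.ite measurableSet_Iio measurable_const
      (Measurable.ite measurableSet_Ioi measurable_const measurable_const)
  have hint : ∀ a b : ℝ, IntervalIntegrable
      (fun t => g t * Real.sign (Real.cos (t - φ))) volume a b := fun a b => by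
    refine (hg.norm.intervalIntegrable a b).mono_fun hm.aestronglyMeasurable
      (.of_forall fun t => ?_)
    simp only [norm_mul, norm_norm]
    refine mul_le_of_le_one_right (norm_nonneg _) ?_
    rcases Real.sign_apply_eq (Real.cos (t - φ)) with h | h | h <;> simp [h]
  have e := hp.intervalIntegral_add_eq 0 (φ - Real.pi / 2)
  rw [zero_add, show φ - Real.pi / 2 + 2 * Real.pi = φ + 3 * Real.pi / 2 by ring] at e
  rw [e, ← intervalIntegral.integral_add_adjacent_intervals (hint _ (φ + Real.pi / 2)) (hint _ _),
    h1, h2, intervalIntegral.integral_neg,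
    intervalIntegral.integral_eq_sub_of_hasDerivAt (fun t _ => hG t) (hg.intervalIntegrable _ _),
    intervalIntegral.integral_eq_sub_of_hasDerivAt (fun t _ => hG t) (hg.intervalIntegrable _ _)]
  ring

/-- The average of θ sgn(θ·k) points along k by symmetry; its length is computed with `sin` and
`-cos` as antiderivatives. This is the identity behind the method of rotations. -/
lemma integral_dir_mul_sign {k : Z2} (hk : k ≠ 0) (j : Fin 2) :
    ∫ t in (0 : ℝ)..(2 * Real.pi), dir t j * Real.sign (dirDot t k) = 4 * k j / freq k := by
  obtain ⟨φ, h0, h1, h⟩ := dirDot_eq hk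
  have hs : ∀ t, Real.sign (dirDot t k) = Real.sign (Real.cos (t - φ)) := fun t => by
    rw [h]
    rcases lt_trichotomy (Real.cos (t - φ)) 0 with hc | hc | hc
    · rw [Real.sign_of_neg hc, Real.sign_of_neg (mul_neg_of_pos_of_neg (freq_pos hk) hc)]
    · rw [hc, mul_zero]
    · rw [Real.sign_of_pos hc, Real.sign_of_pos (mul_pos (freq_pos hk) hc)]
  simp only [hs]
  have hf := freq_ne_zero hk
  have e1 : φ + 3 * Real.pi / 2 = φ - Real.pi / 2 + 2 * Real.pi := by ring
  fin_cases j
  · have := integral_mul_sign_cos (g := Real.cos) (G := Real.sin) Real.continuous_cos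
      Real.hasDerivAt_sin Real.cos_periodic φ
    simp only [dir, Fin.zero_eta, if_true]
    rw [this, e1, Real.sin_add_two_pi, Real.sin_add_pi_div_two, Real.sin_sub_pi_div_two, ← h0]
    field_simp; ring
  · have := integral_mul_sign_cos (g := Real.sin) (G := fun t => -Real.cos t)
      Real.continuous_sin (fun t => (neg_neg (Real.sin t)) ▸ (Real.hasDerivAt_cos t).neg)
      Real.sin_periodic φ
    simp only [dir, Fin.mk_one, one_ne_zero, if_false]
    rw [this, e1, Real.cos_add_two_pi, Real.cos_add_pi_div_two, Real.cos_sub_pi_div_two, ← h1]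
    field_simp; ring

/-! ### The Riesz transforms on `L⁴` -/

instance fact_one_le_four : Fact ((1 : ℝ≥0∞) ≤ 4) := ⟨by norm_num⟩

/-- The symbol of the Riesz transform `Rⱼ`. -/
def rsym (j : Fin 2) (k : Z2) : ℂ :=
  if k = 0 then 0 else Complex.I * (k j : ℂ) / (freq k : ℂ)

lemma rsym_zero (j : Fin 2) : rsym j 0 = 0 := if_pos rfl

lemma hermitian_rsym (j : Fin 2) : Hermitian (rsym j) := fun k => by
  unfold rsym
  by_cases hk : k = 0
  · simp [hk]
  · simp [hk]

lemma norm_rsym_le (j : Fin 2) (k : Z2) : ‖rsym j k‖ ≤ 1 := by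
  unfold rsym
  split_ifs with hk
  · simp
  · have h := freq_pos hk
    rw [norm_div, norm_mul, Complex.norm_I, one_mul, Complex.norm_real, Real.norm_eq_abs,
      abs_of_pos h, div_le_one h, Complex.norm_intCast]
    exact abs_le_freq k j

lemma eLpNorm_four_eq {f : T2 → ℝ} (hf : MemLp f 4 mu) :
    eLpNorm f 4 mu = ENNReal.ofReal ((∫ x, f x ^ 4 ∂mu) ^ (1 / 4 : ℝ)) := by
  rw [hf.eLpNorm_eq_integral_rpow_norm (by norm_num) (by norm_num)]
  have e : ∀ x, ‖f x‖ ^ (4 : ℝ≥0∞).toReal = f x ^ 4 := fun x => by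
    have : (4 : ℝ≥0∞).toReal = ((4 : ℕ) : ℝ) := by norm_num
    rw [this, Real.rpow_natCast, Real.norm_eq_abs]
    exact (by decide : Even 4).pow_abs _
  simp only [e]
  norm_num

lemma eLpNorm_hilbert_le {t : ℝ} {b : Z2 →₀ ℂ} (hh : Hermitian b)
    (hb : ∀ k ∈ b.support, dirDot t k ≠ 0) :
    eLpNorm (rtrig (symMul (hsym t) b)) 4 mu ≤ ENNReal.ofReal (5 / 2) * eLpNorm (rtrig b) 4 mu := by
  rw [eLpNorm_four_eq (memLp_rtrig _ _), eLpNorm_four_eq (memLp_rtrig _ _),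
    ← ENNReal.ofReal_mul (by norm_num)]
  refine ENNReal.ofReal_le_ofReal ?_
  have h0 : ∀ c : Z2 →₀ ℂ, 0 ≤ ∫ x, rtrig c x ^ 4 ∂mu := fun c =>
    integral_nonneg fun x => (by decide : Even 4).pow_nonneg _
  -- The constant 5/2 is a convenient upper bound for the fourth root of 34.
  have e : (5 / 2 : ℝ) = ((5 / 2 : ℝ) ^ 4) ^ (1 / 4 : ℝ) := by
    rw [← Real.rpow_natCast, ← Real.rpow_mul (by norm_num)]; norm_num
  rw [e, ← Real.mul_rpow (by norm_num) (h0 b)]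
  refine Real.rpow_le_rpow (h0 _) ((integral_hilbert_pow_four_le hh hb).trans ?_) (by norm_num)
  have := h0 b
  gcongr
  norm_num

/-- A trigonometric polynomial as an element of `L⁴`. -/
def trigLp : (Z2 →₀ ℂ) →ₗ[ℂ] Lp ℂ 4 mu :=
  (ContinuousMap.toLp (E := ℂ) 4 mu ℂ).toLinearMap ∘ₗ trig

lemma norm_trigLp {a : Z2 →₀ ℂ} (ha : Hermitian a) :
    ‖trigLp a‖ = (eLpNorm (rtrig a) 4 mu).toReal := by
  rw [Lp.norm_def]
  congr 1
  refine eLpNorm_congr_norm_ae ?_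
  filter_upwards [ContinuousMap.coeFn_toLp (p := 4) (𝕜 := ℂ) mu (trig a)] with x hx
  have : (trigLp a : T2 → ℂ) x = trig a x := hx
  rw [this, trig_of_hermitian ha, Complex.norm_real]

lemma trigLp_symMul (m : Z2 → ℂ) (b : Z2 →₀ ℂ) :
    trigLp (symMul m b) = ∑ k ∈ b.support, m k • trigLp (Finsupp.single k (b k)) := by
  have : symMul m b = ∑ k ∈ b.support, m k • Finsupp.single k (b k) := by
    ext l
    simp only [symMul_apply, Finsupp.coe_finsetSum, Finset.sum_apply, Finsupp.smul_apply,
      Finsupp.single_apply, smul_eq_mul, mul_ite, mul_zero, Finset.sum_ite_eq',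
      Finsupp.mem_support_iff]
    split_ifs with h
    · rfl
    · simp [not_not.1 h]
  rw [this, map_sum]
  simp only [map_smul]

lemma real_smul_eq_complex_smul (r : ℝ) (v : Lp ℂ 4 mu) : r • v = (r : ℂ) • v := by
  refine Lp.ext ?_
  filter_upwards [Lp.coeFn_smul r v, Lp.coeFn_smul (r : ℂ) v] with x h1 h2
  rw [h1, h2, Pi.smul_apply, Pi.smul_apply, Complex.coe_smul]

/-- The Riesz transform as an average of directional Hilbert transforms. -/
lemma integral_hilbert_eq {b : Z2 →₀ ℂ} (h0 : b 0 = 0) (j : Fin 2) :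
    ∫ t in (0 : ℝ)..(2 * Real.pi), (dir t j : ℂ) • trigLp (symMul (hsym t) b) =
      (-4 : ℂ) • trigLp (symMul (rsym j) b) := by
  have hm : ∀ k, IntervalIntegrable (fun t => dir t j * Real.sign (dirDot t k)) volume 0
      (2 * Real.pi) := fun k => by
    have hsign : Measurable Real.sign := by
      unfold Real.sign
      exact Measurable.ite measurableSet_Iio measurable_const
        (Measurable.ite measurableSet_Ioi measurable_const measurable_const)
    have hd : Continuous fun t => dir t j := by
      unfold dir; split_ifs <;> fun_prop
    have hdd : Continuous fun t => dirDot t k := by unfold dirDot; fun_prop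
    refine (hd.norm.intervalIntegrable 0 (2 * Real.pi)).mono_fun
      (hd.measurable.mul (hsign.comp hdd.measurable)).aestronglyMeasurable (.of_forall fun t => ?_)
    simp only [norm_mul, norm_norm]
    refine mul_le_of_le_one_right (norm_nonneg _) ?_
    rcases Real.sign_apply_eq (dirDot t k) with h | h | h <;> simp [h]
  -- The L⁴-valued integrand is a finite combination of fixed vectors with scalar coefficients
  -- depending on t, so the Bochner integral reduces to scalar integrals.
  have e : ∀ t, (dir t j : ℂ) • trigLp (symMul (hsym t) b) = ∑ k ∈ b.support,
      (dir t j * Real.sign (dirDot t k)) • (-Complex.I • trigLp (Finsupp.single k (b k))) :=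
    fun t => by
      rw [trigLp_symMul, Finset.smul_sum]
      refine Finset.sum_congr rfl fun k _ => ?_
      rw [real_smul_eq_complex_smul, smul_smul, smul_smul, hsym]
      congr 1
      push_cast; ring
  simp only [e]
  rw [intervalIntegral.integral_finsetSum fun k _ => ⟨(hm k).1.smul_const _, (hm k).2.smul_const _⟩]
  simp only [intervalIntegral.integral_smul_const]
  rw [trigLp_symMul, Finset.smul_sum]
  refine Finset.sum_congr rfl fun k hk => ?_
  have hk0 : k ≠ 0 := by
    rintro rfl; exact (Finsupp.mem_support_iff.1 hk) h0
  rw [integral_dir_mul_sign hk0, real_smul_eq_complex_smul, smul_smul, smul_smul, rsym, if_neg hk0]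
  congr 1
  push_cast; ring

lemma eLpNorm_rtrig_riesz_le_of_zero {b : Z2 →₀ ℂ} (hh : Hermitian b) (h0 : b 0 = 0) (j : Fin 2) :
    eLpNorm (rtrig (symMul (rsym j) b)) 4 mu ≤ 4 * eLpNorm (rtrig b) 4 mu := by
  have hae : ∀ᵐ t : ℝ, t ∈ Set.uIoc 0 (2 * Real.pi) →
      ‖(dir t j : ℂ) • trigLp (symMul (hsym t) b)‖ ≤ 5 / 2 * ‖trigLp b‖ := by
    -- The L⁴ bound for the directional transform needs every frequency of `b` to be transverse to
    -- the direction; finitely many frequencies exclude only a null set of angles.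
    have : ∀ᵐ t : ℝ, ∀ k ∈ b.support, dirDot t k ≠ 0 := by
      rw [eventually_all_finset]
      intro k hk
      refine ae_dirDot_ne_zero ?_
      rintro rfl; exact (Finsupp.mem_support_iff.1 hk) h0
    filter_upwards [this] with t ht _
    have hd : ‖(dir t j : ℂ)‖ ≤ 1 := by
      rw [Complex.norm_real, Real.norm_eq_abs, dir]
      split_ifs
      · exact Real.abs_cos_le_one t
      · exact Real.abs_sin_le_one t
    have hn : ‖trigLp (symMul (hsym t) b)‖ ≤ 5 / 2 * ‖trigLp b‖ := by
      rw [norm_trigLp ((hermitian_hsym t).symMul hh), norm_trigLp hh]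
      have h := ENNReal.toReal_mono (ENNReal.mul_ne_top ENNReal.ofReal_ne_top
        (memLp_rtrig b 4).eLpNorm_ne_top) (eLpNorm_hilbert_le hh ht)
      rwa [ENNReal.toReal_mul, ENNReal.toReal_ofReal (by norm_num)] at h
    rw [norm_smul]
    exact (mul_le_of_le_one_left (norm_nonneg _) hd).trans hn
  have h := intervalIntegral.norm_integral_le_of_norm_le_const_ae hae
  rw [integral_hilbert_eq h0, norm_smul, norm_trigLp ((hermitian_rsym j).symMul hh),
    norm_trigLp hh, sub_zero, abs_of_pos Real.two_pi_pos] at h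
  have e4 : ‖(-4 : ℂ)‖ = 4 := by norm_num
  rw [e4] at h
  have hX := (memLp_rtrig (symMul (rsym j) b) 4).eLpNorm_ne_top
  have hY := (memLp_rtrig b 4).eLpNorm_ne_top
  rw [← ENNReal.toReal_le_toReal hX (ENNReal.mul_ne_top (by norm_num) hY), ENNReal.toReal_mul]
  -- The averaged bound is (5/2) · 2π / 4 = 5π/4, which is below 4.
  have hp := Real.pi_lt_d2
  have hy : 0 ≤ (eLpNorm (rtrig b) 4 mu).toReal := ENNReal.toReal_nonneg
  norm_num
  nlinarith

/-- Removal of the zero mode. -/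
lemma eLpNorm_rtrig_erase_le {b : Z2 →₀ ℂ} (hh : Hermitian b) :
    Hermitian (b.erase 0) ∧ eLpNorm (rtrig (b.erase 0)) 4 mu ≤ 2 * eLpNorm (rtrig b) 4 mu := by
  have hz : Hermitian (b.erase 0) := fun k => by
    by_cases hk : k = 0
    · simp [hk]
    · rw [Finsupp.erase_ne hk, Finsupp.erase_ne (neg_ne_zero.2 hk), hh k]
  refine ⟨hz, ?_⟩
  set c : ℝ := ∫ x, rtrig b x ∂mu
  have hb0 : b 0 = (c : ℂ) := by rw [← coeff_rtrig hh, coeff_zero_freq]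
  have e : rtrig (b.erase 0) = rtrig b - fun _ => c := by
    have h1 : b.erase 0 = b - Finsupp.single 0 (b 0) := by
      rw [eq_sub_iff_add_eq]; exact Finsupp.erase_add_single 0 b
    funext x
    simp only [rtrig, h1, map_sub, ContinuousMap.sub_apply, Complex.sub_re, Pi.sub_apply]
    rw [trig_apply (Finsupp.single 0 (b 0)), Finsupp.sum_single_index (by simp),
      UnitAddTorus.mFourier_zero, hb0]
    simp
  -- The mean is at most the L¹ norm, hence at most the L⁴ norm, because `mu` has mass one.
  have hc : eLpNorm (fun _ : T2 => c) 4 mu ≤ eLpNorm (rtrig b) 4 mu := by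
    rw [eLpNorm_const _ (by norm_num) (NeZero.ne _)]
    simp only [measure_univ, ENNReal.one_rpow, mul_one]
    calc ‖c‖ₑ ≤ ∫⁻ x, ‖rtrig b x‖ₑ ∂mu := enorm_integral_le_lintegral_enorm _
      _ = eLpNorm (rtrig b) 1 mu := eLpNorm_one_eq_lintegral_enorm.symm
      _ ≤ eLpNorm (rtrig b) 4 mu := eLpNorm_le_eLpNorm_of_exponent_le (by norm_num)
          (memLp_rtrig b 4).1
  rw [e]
  calc _ ≤ eLpNorm (rtrig b) 4 mu + eLpNorm (fun _ : T2 => c) 4 mu :=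
        eLpNorm_sub_le (memLp_rtrig b 4).1 aestronglyMeasurable_const (by norm_num)
    _ ≤ _ := by rw [two_mul]; gcongr

lemma eLpNorm_rtrig_riesz_le {b : Z2 →₀ ℂ} (hh : Hermitian b) (j : Fin 2) :
    eLpNorm (rtrig (symMul (rsym j) b)) 4 mu ≤ 8 * eLpNorm (rtrig b) 4 mu := by
  obtain ⟨h1, h2⟩ := eLpNorm_rtrig_erase_le hh
  have e : symMul (rsym j) b = symMul (rsym j) (b.erase 0) := by
    ext k
    by_cases hk : k = 0
    · simp [hk, rsym_zero]
    · simp [Finsupp.erase_ne hk]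
  rw [e]
  calc _ ≤ 4 * eLpNorm (rtrig (b.erase 0)) 4 mu :=
        eLpNorm_rtrig_riesz_le_of_zero h1 Finsupp.erase_same j
    _ ≤ 4 * (2 * eLpNorm (rtrig b) 4 mu) := by gcongr
    _ = _ := by rw [← mul_assoc]; norm_num

/-- The Riesz transforms are bounded on `L⁴`. -/
theorem eLpNorm_riesz_le {f : T2 → ℝ} (hf : MemLp f 4 mu) (j : Fin 2) :
    eLpNorm (multiplier (rsym j) f) 4 mu ≤ 8 * eLpNorm f 4 mu := by
  obtain ⟨a, ha, hlim⟩ := exists_rtrig_tendsto (by norm_num) hf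
  have hf2 : MemLp f 2 mu := hf.mono_exponent (by norm_num)
  have hlim2 : Tendsto (fun n => eLpNorm (f - rtrig (a n)) 2 mu) atTop (𝓝 0) :=
    tendsto_of_tendsto_of_tendsto_of_le_of_le tendsto_const_nhds hlim (fun _ => zero_le)
      fun n => eLpNorm_le_eLpNorm_of_exponent_le (by norm_num) (hf.1.sub (memLp_rtrig _ 4).1)
  have h3 := tendsto_multiplier (hermitian_rsym j) (norm_rsym_le j) hf2 ha hlim2
  refine le_of_forall_pos_le_add fun ε hε => ?_
  refine eLpNorm_le_of_tendsto (fun n => (memLp_rtrig _ 2).1) (memLp_multiplier _ f).1 h3 ?_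
  have hε' : ε / 8 ≠ 0 := by
    simp [hε.ne']
  filter_upwards [hlim.eventually (gt_mem_nhds (pos_iff_ne_zero.2 hε'))] with n hn
  refine (eLpNorm_rtrig_riesz_le (ha n) j).trans ?_
  have e : rtrig (a n) = f - (f - rtrig (a n)) := by simp
  calc 8 * eLpNorm (rtrig (a n)) 4 mu ≤ 8 * (eLpNorm f 4 mu + ε / 8) := by
        gcongr
        nth_rewrite 1 [e]
        exact (eLpNorm_sub_le hf.1 (hf.1.sub (memLp_rtrig _ 4).1) (by norm_num)).trans (by gcongr)
    _ = _ := by rw [mul_add, ENNReal.mul_div_cancel (by norm_num) (by norm_num)]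

/-! ### Weighted convolution estimates and Sobolev embeddings -/

lemma enorm_sq_eq (z : ℂ) : ‖z‖ₑ ^ 2 = ENNReal.ofReal (‖z‖ ^ 2) := by
  rw [ENNReal.ofReal_pow (norm_nonneg _), ofReal_norm]

lemma tsum_tsum_sub_mul (F G : Z2 → ℝ≥0∞) :
    ∑' n, ∑' k, F k * G (n - k) = (∑' k, F k) * ∑' k, G k := by
  rw [ENNReal.tsum_comm, ← ENNReal.tsum_mul_right]
  congr 1; ext k
  rw [ENNReal.tsum_mul_left]
  congr 1
  exact (Equiv.subRight k).tsum_eq G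

/-- Cauchy–Schwarz in k after inserting the square roots of the weights at k and n − k together with
their inverses; the sum of inverse weights is bounded uniformly in n by `tsum_wt_conv_le`. -/
lemma tsum_conv_sq_le {c : ℝ} (hc : 0 < c) (G H : Z2 → ℝ≥0∞) :
    ∑' n, (∑' k, G k * H (n - k)) ^ 2 ≤ ENNReal.ofReal (32 * (1 + 1 / c)) *
      ((∑' k, ENNReal.ofReal (wt c k) * G k ^ 2) *
        ∑' k, ENNReal.ofReal (wt c k) * H k ^ 2) := by
  rw [← tsum_tsum_sub_mul, ← ENNReal.tsum_mul_left]
  refine ENNReal.tsum_le_tsum fun n => ?_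
  set r : Z2 → ℝ≥0∞ := fun k => ENNReal.ofReal (Real.sqrt (wt c k))⁻¹
  set s : Z2 → ℝ≥0∞ := fun k => ENNReal.ofReal (Real.sqrt (wt c k))
  have hs : ∀ k, 0 < Real.sqrt (wt c k) := fun k => Real.sqrt_pos.2 (wt_pos hc.le k)
  have hrs : ∀ k, r k * s k = 1 := fun k => by
    rw [← ENNReal.ofReal_mul (inv_pos.2 (hs k)).le, inv_mul_cancel₀ (hs k).ne', ENNReal.ofReal_one]
  have hr2 : ∀ k, r k ^ 2 = ENNReal.ofReal (wt c k)⁻¹ := fun k => by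
    rw [← ENNReal.ofReal_pow (inv_pos.2 (hs k)).le, inv_pow, Real.sq_sqrt (wt_pos hc.le k).le]
  have hs2 : ∀ k, s k ^ 2 = ENNReal.ofReal (wt c k) := fun k => by
    rw [← ENNReal.ofReal_pow (hs k).le, Real.sq_sqrt (wt_pos hc.le k).le]
  have e : ∀ k, G k * H (n - k) = (r k * r (n - k)) * ((s k * G k) * (s (n - k) * H (n - k))) :=
    fun k => by
      calc G k * H (n - k) = (r k * s k) * G k * ((r (n - k) * s (n - k)) * H (n - k)) := by
            rw [hrs, hrs, one_mul, one_mul]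
        _ = _ := by ring
  simp only [e]
  refine (tsum_mul_sq_le _ _).trans ?_
  simp only [mul_pow, hr2, hs2]
  gcongr
  exact tsum_wt_conv_le hc n

/-- The trilinear form controlled by one `L²` norm and two `H¹` norms. -/
lemma tsum_trilinear_sq_le (F G H : Z2 → ℝ≥0∞) :
    (∑' n, F n * ∑' k, G k * H (n - k)) ^ 2 ≤ (∑' n, F n ^ 2) * (ENNReal.ofReal 64 *
      ((∑' k, ENNReal.ofReal (wt 1 k) * G k ^ 2) *
        ∑' k, ENNReal.ofReal (wt 1 k) * H k ^ 2)) := by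
  refine (tsum_mul_sq_le _ _).trans ?_
  gcongr
  refine (tsum_conv_sq_le one_pos G H).trans (le_of_eq ?_)
  norm_num

/-- By Parseval ∫ f⁴ is the sum of squared coefficients of f², which are convolutions. The parameter
c stays free so that it can be optimised later. -/
lemma integral_rtrig_pow_four_le {c : ℝ} (hc : 0 < c) {a : Z2 →₀ ℂ} (ha : Hermitian a) :
    ENNReal.ofReal (∫ x, rtrig a x ^ 4 ∂mu) ≤ ENNReal.ofReal (32 * (1 + 1 / c)) *
      (∑' k, ENNReal.ofReal (wt c k) * ‖a k‖ₑ ^ 2) ^ 2 := by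
  have hg : MemLp (fun x => rtrig a x * rtrig a x) 2 mu :=
    memLp_of_continuous ((continuous_rtrig a).mul (continuous_rtrig a)) 2
  have e1 : ∫ x, rtrig a x ^ 4 ∂mu = ∑' n, ‖coeff (fun x => rtrig a x * rtrig a x) n‖ ^ 2 := by
    rw [(hasSum_sq_coeff hg).tsum_eq]
    congr 1; ext x; ring
  rw [e1, ENNReal.ofReal_tsum_of_nonneg (fun _ => by positivity) (summable_coeff hg)]
  refine le_trans (ENNReal.tsum_le_tsum fun n => ?_)
    ((tsum_conv_sq_le hc (fun k => ‖a k‖ₑ) fun k => ‖a k‖ₑ).trans (by rw [← pow_two]))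
  rw [← enorm_sq_eq]
  gcongr
  have h := hasSum_coeff_mul (memLp_rtrig a 2) (memLp_rtrig a 2) n
  rw [← h.tsum_eq]
  refine enorm_tsum_le_tsum_enorm.trans (le_of_eq ?_)
  simp only [enorm_mul, coeff_rtrig ha]

lemma tsum_wt_trunc_le (c : ℝ) (f : T2 → ℝ) (N : ℕ) :
    ∑' k, ENNReal.ofReal (wt c k) * ‖trunc f N k‖ₑ ^ 2 ≤
      ∑' k, ENNReal.ofReal (wt c k) * ‖coeff f k‖ₑ ^ 2 := by
  refine ENNReal.tsum_le_tsum fun k => ?_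
  gcongr
  rw [← ofReal_norm, ← ofReal_norm]
  exact ENNReal.ofReal_le_ofReal (norm_trunc_le f N k)

lemma tsum_wt_eq {c : ℝ} (hc : 0 < c) {f : T2 → ℝ} (hf : MemLp f 2 mu)
    (h1 : Summable fun k => freq k ^ 2 * ‖coeff f k‖ ^ 2) :
    ∑' k, ENNReal.ofReal (wt c k) * ‖coeff f k‖ₑ ^ 2 =
      ENNReal.ofReal (∫ x, f x ^ 2 ∂mu + c * ∑' k, freq k ^ 2 * ‖coeff f k‖ ^ 2) := by
  have h := (hasSum_sq_coeff hf).add (h1.hasSum.mul_left c)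
  rw [← h.tsum_eq, ENNReal.ofReal_tsum_of_nonneg (fun k => by positivity) h.summable]
  congr 1; ext k
  rw [enorm_sq_eq, ← ENNReal.ofReal_mul (wt_pos hc.le k).le, wt]
  congr 1; ring

lemma memLp_four_and_le {c : ℝ} (hc : 0 < c) {f : T2 → ℝ} (hf : MemLp f 2 mu)
    (h1 : Summable fun k => freq k ^ 2 * ‖coeff f k‖ ^ 2) :
    MemLp f 4 mu ∧ ∫ x, f x ^ 4 ∂mu ≤ 32 * (1 + 1 / c) *
      (∫ x, f x ^ 2 ∂mu + c * ∑' k, freq k ^ 2 * ‖coeff f k‖ ^ 2) ^ 2 := by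
  set W := ∫ x, f x ^ 2 ∂mu + c * ∑' k, freq k ^ 2 * ‖coeff f k‖ ^ 2
  have hW : 0 ≤ W := add_nonneg (integral_nonneg fun x => sq_nonneg _)
    (mul_nonneg hc.le (tsum_nonneg fun k => by positivity))
  have hX : 0 ≤ 32 * (1 + 1 / c) * W ^ 2 := by positivity
  have hN : ∀ N, eLpNorm (rtrig (trunc f N)) 4 mu ≤
      ENNReal.ofReal ((32 * (1 + 1 / c) * W ^ 2) ^ (1 / 4 : ℝ)) := fun N => by
    rw [eLpNorm_four_eq (memLp_rtrig _ _)]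
    refine ENNReal.ofReal_le_ofReal (Real.rpow_le_rpow
      (integral_nonneg fun x => (by decide : Even 4).pow_nonneg _) ?_ (by norm_num))
    rw [← ENNReal.ofReal_le_ofReal_iff hX, ENNReal.ofReal_mul (by positivity),
      ENNReal.ofReal_pow hW, ← tsum_wt_eq hc hf h1]
    refine (integral_rtrig_pow_four_le hc (hermitian_trunc f N)).trans ?_
    exact mul_le_mul' le_rfl (pow_le_pow_left' (tsum_wt_trunc_le c f N) 2)
  have h4 := eLpNorm_le_of_tendsto (fun N => (memLp_rtrig (trunc f N) 2).1) hf.1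
    (tendsto_trunc hf) (.of_forall hN)
  have hm : MemLp f 4 mu := ⟨hf.1, h4.trans_lt ENNReal.ofReal_lt_top⟩
  refine ⟨hm, ?_⟩
  rw [eLpNorm_four_eq hm, ENNReal.ofReal_le_ofReal_iff (Real.rpow_nonneg hX _)] at h4
  exact (Real.rpow_le_rpow_iff (integral_nonneg fun x => (by decide : Even 4).pow_nonneg _) hX
    (by norm_num)).1 h4

/-- **Ladyzhenskaya's inequality** on the torus. -/
theorem integral_pow_four_le {f : T2 → ℝ} (hf : MemLp f 2 mu)
    (h1 : Summable fun k => freq k ^ 2 * ‖coeff f k‖ ^ 2) :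
    ∫ x, f x ^ 4 ∂mu ≤ 128 * (∫ x, f x ^ 2 ∂mu) *
      (∫ x, f x ^ 2 ∂mu + ∑' k, freq k ^ 2 * ‖coeff f k‖ ^ 2) := by
  set A := ∫ x, f x ^ 2 ∂mu with hA
  set B := ∑' k, freq k ^ 2 * ‖coeff f k‖ ^ 2
  have hA0 : 0 ≤ A := integral_nonneg fun x => sq_nonneg _
  have hB0 : 0 ≤ B := tsum_nonneg fun k => by positivity
  rcases hA0.eq_or_lt with hA1 | hA1
  · have : f =ᵐ[mu] 0 := by
      have h := (integral_eq_zero_iff_of_nonneg (fun x => sq_nonneg (f x)) hf.integrable_sq).1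
        (hA.symm.trans hA1.symm)
      filter_upwards [h] with x hx
      simpa using hx
    have e : ∫ x, f x ^ 4 ∂mu = 0 := by
      rw [integral_congr_ae (g := fun _ => (0 : ℝ)) (this.mono fun x hx => by simp [hx])]
      simp
    rw [e, ← hA1]; simp
  rcases hB0.eq_or_lt with hB1 | hB1
  · have h := (memLp_four_and_le one_pos hf h1).2
    change _ ≤ 32 * (1 + 1 / 1) * (A + 1 * B) ^ 2 at h
    rw [← hB1] at h ⊢
    nlinarith [sq_nonneg A]
  -- The choice c = A/B balances the two terms: 32(1 + B/A)(2A)² = 128 A(A + B).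
  · have h := (memLp_four_and_le (div_pos hA1 hB1) hf h1).2
    change _ ≤ 32 * (1 + 1 / (A / B)) * (A + A / B * B) ^ 2 at h
    refine h.trans (le_of_eq ?_)
    field_simp; ring

/-- Cauchy–Schwarz against the inverse weight, which is square summable in dimension two: H²
functions have absolutely convergent Fourier series. -/
lemma tsum_enorm_coeff_ne_top {f : T2 → ℝ}
    (h2 : Summable fun k => (1 + freq k ^ 2) ^ 2 * ‖coeff f k‖ ^ 2) :
    ∑' k, ‖coeff f k‖ₑ ≠ ∞ := by
  have h := tsum_mul_sq_le (fun k : Z2 => ENNReal.ofReal (wt 1 k)⁻¹)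
    fun k => ENNReal.ofReal (wt 1 k) * ‖coeff f k‖ₑ
  have hw := fun k => wt_pos zero_le_one k
  have e : ∀ k, ENNReal.ofReal (wt 1 k)⁻¹ * (ENNReal.ofReal (wt 1 k) * ‖coeff f k‖ₑ)
      = ‖coeff f k‖ₑ := fun k => by
    rw [← mul_assoc, ← ENNReal.ofReal_mul (inv_pos.2 (hw k)).le, inv_mul_cancel₀ (hw k).ne',
      ENNReal.ofReal_one, one_mul]
  have e2 : ∀ k, (ENNReal.ofReal (wt 1 k) * ‖coeff f k‖ₑ) ^ 2 =
      ENNReal.ofReal ((1 + freq k ^ 2) ^ 2 * ‖coeff f k‖ ^ 2) := fun k => by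
    rw [mul_pow, enorm_sq_eq, ← ENNReal.ofReal_pow (hw k).le, ← ENNReal.ofReal_mul (by positivity),
      wt, one_mul]
  simp only [e, e2, ← ENNReal.ofReal_pow (inv_pos.2 (hw _)).le] at h
  have hfin : (∑' k : Z2, ENNReal.ofReal ((wt 1 k)⁻¹ ^ 2)) *
      ∑' k, ENNReal.ofReal ((1 + freq k ^ 2) ^ 2 * ‖coeff f k‖ ^ 2) ≠ ∞ :=
    ENNReal.mul_ne_top ((tsum_wt_le one_pos).trans_lt ENNReal.ofReal_lt_top).ne
      h2.tsum_ofReal_ne_top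
  intro htop
  rw [htop] at h
  exact hfin (top_le_iff.1 (by simpa using h))

/-- `H²` functions on the torus are bounded. -/
theorem memLp_top_of_summable {f : T2 → ℝ} (hf : MemLp f 2 mu)
    (h2 : Summable fun k => (1 + freq k ^ 2) ^ 2 * ‖coeff f k‖ ^ 2) : MemLp f ∞ mu := by
  refine ⟨hf.1, lt_of_le_of_lt (eLpNorm_le_of_tendsto (C := ∑' k, ‖coeff f k‖ₑ)
    (fun N => (memLp_rtrig (trunc f N) 2).1) hf.1
    (tendsto_trunc hf) (.of_forall fun N => ?_)) (tsum_enorm_coeff_ne_top h2).lt_top⟩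
  rw [eLpNorm_exponent_top]
  refine essSup_le_of_ae_le _ (.of_forall fun x => ?_)
  calc ‖rtrig (trunc f N) x‖ₑ ≤ ‖trig (trunc f N) x‖ₑ := by
        rw [← ofReal_norm, ← ofReal_norm]
        exact ENNReal.ofReal_le_ofReal (Complex.abs_re_le_norm _)
    _ ≤ ∑ k ∈ (trunc f N).support, ‖trunc f N k * mFourier k x‖ₑ := by
        rw [trig_apply, Finsupp.sum]
        exact enorm_sum_le _ _
    _ ≤ ∑ k ∈ (trunc f N).support, ‖coeff f k‖ₑ := by
        refine Finset.sum_le_sum fun k _ => ?_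
        rw [← ofReal_norm, ← ofReal_norm, norm_mul, norm_mFourier_apply, mul_one]
        exact ENNReal.ofReal_le_ofReal (norm_trunc_le f N k)
    _ ≤ ∑' k, ‖coeff f k‖ₑ := ENNReal.sum_le_tsum _

/-! ### Symbols of the differential operators -/

lemma hermitian_partial (j : Fin 2) : Hermitian fun k : Z2 => Complex.I * (k j : ℂ) := fun k => by
  simp

lemma norm_partial_le (j : Fin 2) (k : Z2) : ‖Complex.I * (k j : ℂ)‖ ≤ freq k := by
  rw [norm_mul, Complex.norm_I, one_mul, Complex.norm_intCast]
  exact abs_le_freq k j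

lemma coeff_partialD {f : T2 → ℝ} (h : Summable fun k => freq k ^ 2 * ‖coeff f k‖ ^ 2)
    (j : Fin 2) (k : Z2) : coeff (partialD j f) k = Complex.I * (k j : ℂ) * coeff f k := by
  refine coeff_multiplier (hermitian_partial j) (memlp_iff_summable.2 ?_) k
  refine .of_nonneg_of_le (fun k => by positivity) (fun k => ?_) h
  rw [norm_mul, mul_pow]
  have := norm_partial_le j k
  gcongr

lemma memLp_partialD (j : Fin 2) (f : T2 → ℝ) : MemLp (partialD j f) 2 mu := memLp_multiplier _ _

lemma sum_integral_partialD_sq {f : T2 → ℝ}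
    (h : Summable fun k => freq k ^ 2 * ‖coeff f k‖ ^ 2) :
    ∑ j, ∫ x, partialD j f x ^ 2 ∂mu = ∑' k, freq k ^ 2 * ‖coeff f k‖ ^ 2 := by
  have := hasSum_sum fun j (_ : j ∈ Finset.univ) => hasSum_sq_coeff (memLp_partialD j f)
  rw [← this.tsum_eq]
  congr 1; ext k
  simp only [coeff_partialD h, norm_mul, Complex.norm_I, one_mul, mul_pow, Complex.norm_intCast,
    sq_abs, ← Finset.sum_mul, freq_sq]

lemma coeff_lap {f : T2 → ℝ} (h : Summable fun k => freq k ^ 4 * ‖coeff f k‖ ^ 2) (k : Z2) :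
    coeff (lap f) k = -((freq k ^ 2 : ℝ) : ℂ) * coeff f k := by
  refine coeff_multiplier (fun k => by simp) (memlp_iff_summable.2 ?_) k
  refine h.congr fun k => ?_
  rw [norm_mul, mul_pow, norm_neg, Complex.norm_real, Real.norm_eq_abs, sq_abs]
  ring

lemma integral_lap_sq {f : T2 → ℝ} (h : Summable fun k => freq k ^ 4 * ‖coeff f k‖ ^ 2) :
    ∫ x, lap f x ^ 2 ∂mu = ∑' k, freq k ^ 4 * ‖coeff f k‖ ^ 2 := by
  rw [← (hasSum_sq_coeff (f := lap f) (memLp_multiplier _ _)).tsum_eq]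
  congr 1; ext k
  rw [coeff_lap h, norm_mul, mul_pow, norm_neg, Complex.norm_real, Real.norm_eq_abs, sq_abs]
  ring

lemma coeff_riesz (j : Fin 2) {f : T2 → ℝ} (hf : MemLp f 2 mu) (k : Z2) :
    coeff (multiplier (rsym j) f) k = rsym j k * coeff f k :=
  coeff_multiplier (hermitian_rsym j) (memlp_of_bounded (norm_rsym_le j) hf) k

lemma coeff_lam {s : ℝ} (hs : s ≤ 0) {f : T2 → ℝ} (hf : MemLp f 2 mu) (k : Z2) :
    coeff (lam s f) k = (if k = 0 then 0 else ((freq k ^ s : ℝ) : ℂ)) * coeff f k := by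
  refine coeff_multiplier (fun k => ?_) (memlp_of_bounded (C := 1) (fun k => ?_) hf) k
  · by_cases hk : k = 0
    · simp [hk]
    · simp [hk]
  · split_ifs with hk
    · simp
    · rw [Complex.norm_real, Real.norm_eq_abs, abs_of_nonneg (Real.rpow_nonneg (freq_nonneg k) s)]
      exact Real.rpow_le_one_of_one_le_of_nonpos (one_le_freq hk) hs

/-! ### Trilinear forms in Fourier variables -/

lemma hasSum_of_fiberwise {F : Z2 × Z2 → ℂ} (hF : Summable F) {c : Z2 → ℂ}
    (h0 : ∀ n, HasSum (fun k => F (n, k)) (c n)) : HasSum c (∑' q, F q) :=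
  HasSum.prod_fiberwise hF.hasSum h0

/-- Parseval in n and the convolution formula in k. Absolute summability over pairs is required
because the pairs are later permuted by `swapFreq`, which does not respect the iterated sum. -/
lemma hasSum_integral_triple {p g h : T2 → ℝ} (hp : MemLp p 2 mu) (hg : MemLp g 2 mu)
    (hh : MemLp h 2 mu) (hgh : MemLp (fun x => g x * h x) 2 mu) {F : Z2 × Z2 → ℂ}
    (hF : ∀ n k, F (n, k) = conj (coeff p n) * (coeff g k * coeff h (n - k)))
    (hs : Summable F) :
    HasSum F ((∫ x, p x * (g x * h x) ∂mu : ℝ) : ℂ) := by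
  have h0 : ∀ n, HasSum (fun k => F (n, k))
      (conj (coeff p n) * coeff (fun x => g x * h x) n) := fun n => by
    simp only [hF]
    exact (hasSum_coeff_mul hg hh n).mul_left _
  have h1 := hasSum_of_fiberwise hs h0
  have h2 := hasSum_coeff hp hgh
  rw [h2.unique h1]
  exact hs.hasSum

/-- The involution of pairs of frequencies exchanging the two equal factors. -/
def swapFreq : Z2 × Z2 ≃ Z2 × Z2 where
  toFun q := (q.2 - q.1, q.2)
  invFun q := (q.2 - q.1, q.2)
  left_inv q := by simp
  right_inv q := by simp

lemma ne_top_of_sq_le {a b : ℝ≥0∞} (h : a ^ 2 ≤ b) (hb : b ≠ ∞) : a ≠ ∞ := by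
  rintro rfl
  exact hb (top_le_iff.1 (by simpa using h))

lemma summable_of_tsum_enorm {ι : Type*} {f : ι → ℂ} (h : ∑' i, ‖f i‖ₑ ≠ ∞) : Summable f := by
  refine .of_norm ?_
  have := ENNReal.summable_toReal h
  simpa using this

lemma sum_mul_sub_eq {v : Fin 2 → T2 → ℝ}
    (hdiv : ∀ k : Z2, ∑ j, (k j : ℂ) * coeff (v j) k = 0) (n k : Z2) :
    ∑ j, ((k - n) j : ℂ) * coeff (v j) k = -∑ j, (n j : ℂ) * coeff (v j) k := by
  have : ∑ j, ((k - n) j : ℂ) * coeff (v j) k =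
      ∑ j, (k j : ℂ) * coeff (v j) k - ∑ j, (n j : ℂ) * coeff (v j) k := by
    rw [← Finset.sum_sub_distrib]
    refine Finset.sum_congr rfl fun j _ => ?_
    simp only [Pi.sub_apply, Int.cast_sub, sub_mul]
  rw [this, hdiv, zero_sub]

/-- Transport by a divergence free field is antisymmetric: `∫ (v·∇a) a = 0`. -/
theorem sum_integral_transport_eq_zero {v : Fin 2 → T2 → ℝ} {a : T2 → ℝ}
    (hv : ∀ j, MemLp (v j) 2 mu)
    (hv1 : ∀ j, Summable fun k => freq k ^ 2 * ‖coeff (v j) k‖ ^ 2)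
    (hdiv : ∀ k : Z2, ∑ j, (k j : ℂ) * coeff (v j) k = 0)
    (ha : MemLp a 2 mu) (ha1 : Summable fun k => freq k ^ 2 * ‖coeff a k‖ ^ 2)
    (hva : ∀ j, MemLp (fun x => v j x * a x) 2 mu) :
    ∑ j, ∫ x, partialD j a x * (v j x * a x) ∂mu = 0 := by
  set T : Fin 2 → Z2 × Z2 → ℂ := fun j q =>
    conj (coeff (partialD j a) q.1) * (coeff (v j) q.2 * coeff a (q.1 - q.2)) with hT
  -- The trilinear bound takes the derivative in L² and the other two factors in H¹, so no
  -- regularity beyond H¹ is needed.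
  have hsum : ∀ j, Summable (T j) := fun j => by
    refine summable_of_tsum_enorm ?_
    have h := tsum_trilinear_sq_le (fun n => ‖coeff (partialD j a) n‖ₑ)
      (fun n => ‖coeff (v j) n‖ₑ) (fun n => ‖coeff a n‖ₑ)
    rw [tsum_wt_eq one_pos (hv j) (hv1 j), tsum_wt_eq one_pos ha ha1] at h
    have h0 : ∑' n, ‖coeff (partialD j a) n‖ₑ ^ 2 ≠ ∞ := by
      simp only [enorm_sq_eq]
      exact (summable_coeff (memLp_partialD j a)).tsum_ofReal_ne_top
    have e : ∑' q, ‖T j q‖ₑ = ∑' n, ‖coeff (partialD j a) n‖ₑ *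
        ∑' k, ‖coeff (v j) k‖ₑ * ‖coeff a (n - k)‖ₑ := by
      rw [ENNReal.tsum_prod (f := fun n k => ‖T j (n, k)‖ₑ)]
      simp only [← ENNReal.tsum_mul_left, hT, enorm_mul, RCLike.enorm_conj]
    rw [e]
    refine ne_top_of_sq_le h (ENNReal.mul_ne_top h0 ?_)
    exact ENNReal.mul_ne_top ENNReal.ofReal_ne_top
      (ENNReal.mul_ne_top ENNReal.ofReal_ne_top ENNReal.ofReal_ne_top)
  have hI : HasSum (fun q => ∑ j, T j q)
      (∑ j, ((∫ x, partialD j a x * (v j x * a x) ∂mu : ℝ) : ℂ)) := hasSum_sum fun j (_ : j ∈ Finset.univ) =>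
    hasSum_integral_triple (memLp_partialD j a) (hv j) ha (hva j) (fun _ _ => rfl) (hsum j)
  -- The swap exchanges the two coefficients of `a`, and since k·v(k) = 0 it turns n·v(k) into its
  -- negative. The total therefore equals its own opposite.
  have hodd : ∀ q, ∑ j, T j (swapFreq q) = -∑ j, T j q := by
    rintro ⟨n, k⟩
    have key : ∀ n : Z2, ∑ j, T j (n, k) = -Complex.I * conj (coeff a n) * coeff a (n - k) *
        ∑ j, (n j : ℂ) * coeff (v j) k := fun n => by
      rw [Finset.mul_sum]
      refine Finset.sum_congr rfl fun j _ => ?_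
      simp only [hT, coeff_partialD ha1, map_mul, Complex.conj_I, map_intCast]
      ring
    rw [swapFreq, Equiv.coe_fn_mk, key, key, sum_mul_sub_eq hdiv,
      show k - n - k = -n by abel, show k - n = -(n - k) by abel, coeff_neg_freq, coeff_neg_freq,
      Complex.conj_conj]
    ring
  have h2 := (swapFreq.hasSum_iff).2 hI
  have h3 := hI.neg
  have e : (fun q => ∑ j, T j q) ∘ swapFreq = fun q => -∑ j, T j q := funext hodd
  have h4 := h2.unique (e ▸ h3)
  have h5 : (∑ j, ((∫ x, partialD j a x * (v j x * a x) ∂mu : ℝ) : ℂ)) = 0 := self_eq_neg.1 h4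
  exact_mod_cast h5

/-! ### The commutator estimate -/

lemma enorm_eq_ofReal_norm (z : ℂ) : ‖z‖ₑ = ENNReal.ofReal ‖z‖ := (ofReal_norm z).symm

lemma tsum_prod_mul_sub (F G : Z2 → ℝ≥0∞) :
    ∑' q : Z2 × Z2, F q.2 * G (q.1 - q.2) = (∑' k, F k) * ∑' k, G k := by
  rw [← tsum_tsum_sub_mul, ENNReal.tsum_prod (f := fun n k => F k * G (n - k))]

lemma tsum_prod_mul (F G : Z2 → ℝ≥0∞) :
    ∑' q : Z2 × Z2, F q.1 * G q.2 = (∑' k, F k) * ∑' k, G k := by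
  rw [ENNReal.tsum_prod (f := fun n k => F n * G k)]
  simp only [ENNReal.tsum_mul_left, ENNReal.tsum_mul_right]

lemma add_sq_le_of_sq_le {a b P : ℝ≥0∞} (ha : a ^ 2 ≤ P) (hb : b ^ 2 ≤ P) :
    (a + b) ^ 2 ≤ 4 * P := by
  rcases le_total a b with h | h
  · calc (a + b) ^ 2 ≤ (b + b) ^ 2 := by gcongr
      _ = 4 * b ^ 2 := by ring
      _ ≤ _ := by gcongr
  · calc (a + b) ^ 2 ≤ (a + a) ^ 2 := by gcongr
      _ = 4 * a ^ 2 := by ring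
      _ ≤ _ := by gcongr

/-- The factor |n|^{-1/2} is given up for |k|^{-1/2}, up to √2. Writing |k|^{1/2} as |k|²|k|^{-3/2}
then separates two full derivatives from a square-summable weight. -/
lemma freq_mul_div_sqrt_le {k n : Z2} (hk : k ≠ 0) {y : ℝ} (hy : 0 ≤ y)
    (hkn : freq k ≤ 2 * freq n) :
    freq k * (y / Real.sqrt (freq n)) ≤
      freq k ^ 2 * (y * Real.sqrt (2 * (freq k ^ 3)⁻¹)) := by
  have hk0 := freq_pos hk
  have hn0 : 0 < freq n := by linarith
  have h : 1 ≤ Real.sqrt (freq n) * (freq k * Real.sqrt (2 * (freq k ^ 3)⁻¹)) := by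
    have e : freq k * Real.sqrt (2 * (freq k ^ 3)⁻¹) = Real.sqrt (2 / freq k) := by
      rw [← Real.sqrt_sq hk0.le, ← Real.sqrt_mul (by positivity), Real.sqrt_sq hk0.le]
      congr 1; field_simp
    rw [e, ← Real.sqrt_mul hn0.le]
    refine Real.one_le_sqrt.2 ?_
    rw [mul_div_assoc', le_div_iff₀ hk0]
    linarith
  have hs : 0 < Real.sqrt (freq n) := Real.sqrt_pos.2 hn0
  rw [mul_div_assoc', div_le_iff₀ hs]
  calc freq k * y = freq k * y * 1 := by ring
    _ ≤ freq k * y * (Real.sqrt (freq n) * (freq k * Real.sqrt (2 * (freq k ^ 3)⁻¹))) := by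
        gcongr
    _ = _ := by ring

/-- The trilinear form with the loss of one derivative on the first factor. -/
lemma tsum_commutator_sq_le (V Y : Z2 → ℝ) (hV : ∀ k, 0 ≤ V k) (hY : ∀ k, 0 ≤ Y k) :
    (∑' q : Z2 × Z2, ENNReal.ofReal (freq q.2 * V q.2 * (Y q.1 / Real.sqrt (freq q.1)) *
      (Y (q.1 - q.2) / Real.sqrt (freq (q.1 - q.2))))) ^ 2 ≤
    4 * (((∑' k, ENNReal.ofReal ((freq k ^ 2 * V k) ^ 2)) *
        ∑' k, ENNReal.ofReal ((Y k / Real.sqrt (freq k)) ^ 2)) *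
      ((∑' k, ENNReal.ofReal (Y k ^ 2)) * ∑' k : Z2, ENNReal.ofReal (2 * (freq k ^ 3)⁻¹))) := by
  set b : Z2 → ℝ := fun k => Y k / Real.sqrt (freq k)
  set U : Z2 → ℝ := fun k => freq k ^ 2 * V k
  set z : Z2 → ℝ := fun k => Real.sqrt (2 * (freq k ^ 3)⁻¹)
  have hf := freq_nonneg
  have hb : ∀ k, 0 ≤ b k := fun k => div_nonneg (hY k) (Real.sqrt_nonneg _)
  have hU : ∀ k, 0 ≤ U k := fun k => mul_nonneg (sq_nonneg _) (hV k)
  have hz : ∀ k, 0 ≤ z k := fun k => Real.sqrt_nonneg _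
  have hz2 : ∀ k, z k ^ 2 = 2 * (freq k ^ 3)⁻¹ := fun k =>
    Real.sq_sqrt (mul_nonneg two_pos.le (inv_nonneg.2 (pow_nonneg (hf k) 3)))
  -- By the triangle inequality the larger of |n| and |n − k| is at least |k|/2. The half derivative
  -- is given up on that factor only; the other one keeps its weight.
  have hterm : ∀ q : Z2 × Z2, freq q.2 * V q.2 * b q.1 * b (q.1 - q.2) ≤
      U q.2 * b (q.1 - q.2) * (Y q.1 * z q.2) + U q.2 * b q.1 * (Y (q.1 - q.2) * z q.2) := by
    rintro ⟨n, k⟩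
    simp only
    have p1 : 0 ≤ U k * b (n - k) * (Y n * z k) :=
      mul_nonneg (mul_nonneg (hU k) (hb _)) (mul_nonneg (hY n) (hz k))
    have p2 : 0 ≤ U k * b n * (Y (n - k) * z k) :=
      mul_nonneg (mul_nonneg (hU k) (hb _)) (mul_nonneg (hY _) (hz k))
    by_cases hk : k = 0
    · have : freq k = 0 := by rw [hk, freq_zero]
      rw [this]; simp only [zero_mul]; linarith
    have htri : freq k ≤ freq n + freq (n - k) := by
      simpa using freq_sub_le n (n - k)
    rcases le_total (freq (n - k)) (freq n) with h | h
    · have := freq_mul_div_sqrt_le hk (hY n) (n := n) (by linarith)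
      have h2 := mul_le_mul_of_nonneg_right this (mul_nonneg (hV k) (hb (n - k)))
      calc _ = freq k * (Y n / Real.sqrt (freq n)) * (V k * b (n - k)) := by ring
        _ ≤ _ := h2
        _ = U k * b (n - k) * (Y n * z k) := by ring
        _ ≤ _ := by linarith
    · have := freq_mul_div_sqrt_le hk (hY (n - k)) (n := n - k) (by linarith)
      have h2 := mul_le_mul_of_nonneg_right this (mul_nonneg (hV k) (hb n))
      calc _ = freq k * (Y (n - k) / Real.sqrt (freq (n - k))) * (V k * b n) := by ring
        _ ≤ _ := h2
        _ = U k * b n * (Y (n - k) * z k) := by ring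
        _ ≤ _ := by linarith
  set U' : Z2 → ℝ≥0∞ := fun k => ENNReal.ofReal (U k)
  set b' : Z2 → ℝ≥0∞ := fun k => ENNReal.ofReal (b k)
  set Y' : Z2 → ℝ≥0∞ := fun k => ENNReal.ofReal (Y k)
  set z' : Z2 → ℝ≥0∞ := fun k => ENNReal.ofReal (z k)
  have eU : ∀ k, ENNReal.ofReal ((freq k ^ 2 * V k) ^ 2) = U' k ^ 2 := fun k =>
    ENNReal.ofReal_pow (hU k) 2
  have eb : ∀ k, ENNReal.ofReal ((Y k / Real.sqrt (freq k)) ^ 2) = b' k ^ 2 := fun k =>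
    ENNReal.ofReal_pow (hb k) 2
  have eY : ∀ k, ENNReal.ofReal (Y k ^ 2) = Y' k ^ 2 := fun k => ENNReal.ofReal_pow (hY k) 2
  have ez : ∀ k : Z2, ENNReal.ofReal (2 * (freq k ^ 3)⁻¹) = z' k ^ 2 := fun k => by
    rw [← hz2]; exact ENNReal.ofReal_pow (hz k) 2
  simp only [eU, eb, eY, ez]
  have hle : ∑' q : Z2 × Z2, ENNReal.ofReal (freq q.2 * V q.2 * b q.1 * b (q.1 - q.2)) ≤
      ∑' q : Z2 × Z2, (U' q.2 * b' (q.1 - q.2)) * (Y' q.1 * z' q.2) +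
      ∑' q : Z2 × Z2, (U' q.2 * b' q.1) * (Y' (q.1 - q.2) * z' q.2) := by
    rw [← ENNReal.tsum_add]
    refine ENNReal.tsum_le_tsum fun q => ?_
    simp only [U', b', Y', z']
    rw [← ENNReal.ofReal_mul (hU _), ← ENNReal.ofReal_mul (hU _), ← ENNReal.ofReal_mul (hY _),
      ← ENNReal.ofReal_mul (hY _), ← ENNReal.ofReal_mul (mul_nonneg (hU _) (hb _)),
      ← ENNReal.ofReal_mul (mul_nonneg (hU _) (hb _)),
      ← ENNReal.ofReal_add (mul_nonneg (mul_nonneg (hU _) (hb _)) (mul_nonneg (hY _) (hz _)))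
        (mul_nonneg (mul_nonneg (hU _) (hb _)) (mul_nonneg (hY _) (hz _)))]
    exact ENNReal.ofReal_le_ofReal (hterm q)
  refine (pow_le_pow_left' hle 2).trans (add_sq_le_of_sq_le ?_ ?_)
  -- Cauchy–Schwarz over pairs with grouping U(k)b(n−k) against Y(n)z(k): each squared group factors
  -- after a change of variables.
  · refine (tsum_mul_sq_le _ _).trans (le_of_eq ?_)
    simp only [mul_pow]
    rw [tsum_prod_mul_sub (fun k => U' k ^ 2) (fun k => b' k ^ 2),
      tsum_prod_mul (fun k => Y' k ^ 2) (fun k => z' k ^ 2)]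
  · refine (tsum_mul_sq_le _ _).trans (le_of_eq ?_)
    have e1 := tsum_prod_mul (fun k => b' k ^ 2) (fun k => U' k ^ 2)
    have e2 := tsum_prod_mul_sub (fun k => z' k ^ 2) (fun k => Y' k ^ 2)
    simp only [mul_pow]
    simp only [mul_comm (b' _ ^ 2)] at e1
    simp only [mul_comm (z' _ ^ 2)] at e2
    rw [e1, e2]
    ring

lemma norm_sum_freq_mul_le (v : Fin 2 → T2 → ℝ) (n k : Z2) :
    ‖∑ j, (n j : ℂ) * coeff (v j) k‖ ≤ freq n * ∑ j, ‖coeff (v j) k‖ := by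
  rw [Finset.mul_sum]
  refine (norm_sum_le _ _).trans (Finset.sum_le_sum fun j _ => ?_)
  rw [norm_mul, Complex.norm_intCast]
  have := abs_le_freq n j
  gcongr

/-- Symmetrisation gains a derivative in `∫ q v·Rq`. -/
lemma norm_commutator_term_le {v : Fin 2 → T2 → ℝ} {q : T2 → ℝ} (hq : MemLp q 2 mu)
    (hq0 : coeff q 0 = 0) (hdiv : ∀ k : Z2, ∑ j, (k j : ℂ) * coeff (v j) k = 0) (n k : Z2) :
    ‖∑ j, conj (coeff (multiplier (rsym j) q) n) * (coeff (v j) k * coeff q (n - k)) +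
      ∑ j, conj (coeff (multiplier (rsym j) q) (k - n)) *
        (coeff (v j) k * coeff q (k - n - k))‖ ≤
    freq k * (∑ j, ‖coeff (v j) k‖) * (‖coeff q n‖ / Real.sqrt (freq n)) *
      (‖coeff q (n - k)‖ / Real.sqrt (freq (n - k))) := by
  have hV : 0 ≤ ∑ j, ‖coeff (v j) k‖ := Finset.sum_nonneg fun _ _ => norm_nonneg _
  have hRHS : 0 ≤ freq k * (∑ j, ‖coeff (v j) k‖) * (‖coeff q n‖ / Real.sqrt (freq n)) *
      (‖coeff q (n - k)‖ / Real.sqrt (freq (n - k))) := by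
    have := freq_nonneg k
    positivity
  have hR0 : ∀ j, coeff (multiplier (rsym j) q) 0 = 0 := fun j => by
    rw [coeff_riesz j hq, rsym_zero, zero_mul]
  -- The degenerate cases n = 0 and n = k are trivial because the zero modes of q and Rq vanish.
  by_cases hn : n = 0
  · subst hn
    simp [hR0, hq0]
  by_cases hnk : n - k = 0
  · have : k = n := (sub_eq_zero.1 hnk).symm
    subst this
    simp [hR0, hq0]
  have hkn : k - n ≠ 0 := fun h => hnk (by rw [← neg_sub, h, neg_zero])
  have key : ∀ m l : Z2, m ≠ 0 →
      ∑ j, conj (coeff (multiplier (rsym j) q) m) * (coeff (v j) k * coeff q l) =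
      -Complex.I / (freq m : ℂ) * conj (coeff q m) * coeff q l *
        ∑ j, (m j : ℂ) * coeff (v j) k := fun m l hm => by
    rw [Finset.mul_sum]
    refine Finset.sum_congr rfl fun j _ => ?_
    rw [coeff_riesz j hq, rsym, if_neg hm]
    simp only [map_mul, map_div₀, Complex.conj_I, map_intCast, Complex.conj_ofReal]
    ring
  set d := ∑ j, (n j : ℂ) * coeff (v j) k with hd
  have hd1 : ‖d‖ ≤ freq n * ∑ j, ‖coeff (v j) k‖ := norm_sum_freq_mul_le v n k
  have hd2 : ‖d‖ ≤ freq (n - k) * ∑ j, ‖coeff (v j) k‖ := by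
    have h := norm_sum_freq_mul_le v (k - n) k
    rwa [sum_mul_sub_eq hdiv, norm_neg, ← neg_sub, freq_neg] at h
  have p1 := freq_pos hn
  have p2 := freq_pos hnk
  -- Incompressibility gives n·v(k) = (n−k)·v(k), so both |n| and |n−k| are available as bounds;
  -- their geometric mean distributes half a derivative to each copy of q.
  have hd3 : ‖d‖ ≤ Real.sqrt (freq n) * Real.sqrt (freq (n - k)) * ∑ j, ‖coeff (v j) k‖ := by
    refine abs_le_of_sq_le_sq' ?_ (by positivity) |>.2
    rw [mul_pow, mul_pow, Real.sq_sqrt p1.le, Real.sq_sqrt p2.le]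
    calc ‖d‖ ^ 2 = ‖d‖ * ‖d‖ := pow_two _
      _ ≤ (freq n * ∑ j, ‖coeff (v j) k‖) * (freq (n - k) * ∑ j, ‖coeff (v j) k‖) := by gcongr
      _ = _ := by ring
  rw [key n (n - k) hn, key (k - n) _ hkn, sum_mul_sub_eq hdiv, ← hd,
    show k - n - k = -n by abel, show k - n = -(n - k) by abel, coeff_neg_freq, coeff_neg_freq,
    Complex.conj_conj, freq_neg]
  -- The symmetrised symbol is 1/|n| − 1/|n−k|, whose numerator is at most |k|: the derivative moves
  -- from q to v.
  have e : -Complex.I / (freq n : ℂ) * conj (coeff q n) * coeff q (n - k) * d +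
      -Complex.I / (freq (n - k) : ℂ) * coeff q (n - k) * conj (coeff q n) * -d =
      -Complex.I * conj (coeff q n) * coeff q (n - k) * d *
        (((freq (n - k) - freq n) / (freq n * freq (n - k)) : ℝ) : ℂ) := by
    have c1 : (freq n : ℂ) ≠ 0 := by exact_mod_cast p1.ne'
    have c2 : (freq (n - k) : ℂ) ≠ 0 := by exact_mod_cast p2.ne'
    push_cast
    field_simp
    ring
  have hfk : |freq (n - k) - freq n| ≤ freq k := by
    have t1 := freq_sub_le n k
    have t2 := freq_add_le (n - k) k
    rw [sub_add_cancel] at t2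
    rw [abs_le]; constructor <;> linarith
  rw [e]
  simp only [norm_mul, norm_neg, Complex.norm_I, one_mul, RCLike.norm_conj, Complex.norm_real,
    Real.norm_eq_abs, abs_div]
  rw [abs_of_pos (mul_pos p1 p2)]
  have s1 : 0 < Real.sqrt (freq n) := Real.sqrt_pos.2 p1
  have s2 : 0 < Real.sqrt (freq (n - k)) := Real.sqrt_pos.2 p2
  calc ‖coeff q n‖ * ‖coeff q (n - k)‖ * ‖d‖ *
        (|freq (n - k) - freq n| / (freq n * freq (n - k))) ≤
      ‖coeff q n‖ * ‖coeff q (n - k)‖ *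
        (Real.sqrt (freq n) * Real.sqrt (freq (n - k)) * ∑ j, ‖coeff (v j) k‖) *
        (freq k / (freq n * freq (n - k))) := by gcongr
    _ = _ := by
        have q1 : freq n = Real.sqrt (freq n) ^ 2 := (Real.sq_sqrt p1.le).symm
        have q2 : freq (n - k) = Real.sqrt (freq (n - k)) ^ 2 := (Real.sq_sqrt p2.le).symm
        generalize Real.sqrt (freq n) = a at *
        generalize Real.sqrt (freq (n - k)) = c at *
        rw [q1, q2]
        field_simp

/-- For fixed k, Cauchy–Schwarz in n bounds the correlation of the outer factors uniformly; an
absolutely summable middle factor then closes the sum, with only L² asked of the others. -/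
lemma summable_triple_of_bounded {p g h : T2 → ℝ} (hp : MemLp p 2 mu)
    (hg : ∑' k, ‖coeff g k‖ₑ ≠ ∞) (hh : MemLp h 2 mu) :
    Summable fun q : Z2 × Z2 => conj (coeff p q.1) * (coeff g q.2 * coeff h (q.1 - q.2)) := by
  refine summable_of_tsum_enorm ?_
  have hfin : ∀ {f : T2 → ℝ}, MemLp f 2 mu → ∑' n, ‖coeff f n‖ₑ ^ 2 ≠ ∞ := fun hf => by
    simp only [enorm_sq_eq]
    exact (summable_coeff hf).tsum_ofReal_ne_top
  set M := (∑' n, ‖coeff p n‖ₑ ^ 2) * ∑' n, ‖coeff h n‖ₑ ^ 2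
  have hM : M ≠ ∞ := ENNReal.mul_ne_top (hfin hp) (hfin hh)
  have hin : ∀ k, (∑' n, ‖coeff p n‖ₑ * ‖coeff h (n - k)‖ₑ) ^ 2 ≤ M := fun k => by
    refine (tsum_mul_sq_le _ _).trans (le_of_eq ?_)
    congr 1
    exact (Equiv.subRight k).tsum_eq fun n => ‖coeff h n‖ₑ ^ 2
  -- M + 1 stands in for √M, since only finiteness matters.
  have hin2 : ∀ k, ∑' n, ‖coeff p n‖ₑ * ‖coeff h (n - k)‖ₑ ≤ M + 1 := fun k => by
    by_contra hlt
    have h1 := (not_le.1 hlt).le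
    have : (M + 1) ^ 2 ≤ M := (pow_le_pow_left' h1 2).trans (hin k)
    have h2 : M + 1 ≤ (M + 1) ^ 2 := by
      rw [pow_two]; exact le_mul_of_one_le_right' le_add_self
    exact absurd (h2.trans this) (not_le.2 (ENNReal.lt_add_right hM one_ne_zero))
  have e : ∑' q : Z2 × Z2, ‖conj (coeff p q.1) * (coeff g q.2 * coeff h (q.1 - q.2))‖ₑ =
      ∑' k, ‖coeff g k‖ₑ * ∑' n, ‖coeff p n‖ₑ * ‖coeff h (n - k)‖ₑ := by
    rw [ENNReal.tsum_prod
      (f := fun n k => ‖conj (coeff p n) * (coeff g k * coeff h (n - k))‖ₑ), ENNReal.tsum_comm]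
    simp only [← ENNReal.tsum_mul_left, enorm_mul, RCLike.enorm_conj]
    congr 1; ext k; congr 1; ext n; ring
  rw [e]
  refine ne_top_of_le_ne_top (ENNReal.mul_ne_top hg (ENNReal.add_ne_top.2 ⟨hM, ENNReal.one_ne_top⟩))
    ?_
  rw [← ENNReal.tsum_mul_right]
  exact ENNReal.tsum_le_tsum fun k => by gcongr; exact hin2 k

lemma memLp_mul_of_top {f g : T2 → ℝ} (hf : MemLp f ∞ mu) (hg : MemLp g 2 mu) :
    MemLp (fun x => f x * g x) 2 mu := MemLp.mul (p := ∞) (q := 2) (r := 2) hg hf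

lemma summable_freq_four {f : T2 → ℝ}
    (h : Summable fun k => (1 + freq k ^ 2) ^ 2 * ‖coeff f k‖ ^ 2) :
    Summable fun k => freq k ^ 4 * ‖coeff f k‖ ^ 2 := by
  refine .of_nonneg_of_le (fun k => by positivity) (fun k => ?_) h
  gcongr
  nlinarith [sq_nonneg (freq k)]

lemma tsum_ofReal_sq_coeff {f : T2 → ℝ} (hf : MemLp f 2 mu) :
    ∑' k, ENNReal.ofReal (‖coeff f k‖ ^ 2) = ENNReal.ofReal (∫ x, f x ^ 2 ∂mu) := by
  have hs := hasSum_sq_coeff hf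
  rw [← hs.tsum_eq, ENNReal.ofReal_tsum_of_nonneg (fun k => by positivity) hs.summable]

/-- At k = 0 division by √0 gives 0, which agrees with Λ^{-1/2} killing the mean. -/
lemma tsum_ofReal_lam_half {q : T2 → ℝ} (hq : MemLp q 2 mu) :
    ∑' k, ENNReal.ofReal ((‖coeff q k‖ / Real.sqrt (freq k)) ^ 2) =
      ENNReal.ofReal (∫ x, lam (-(1 / 2)) q x ^ 2 ∂mu) := by
  rw [← tsum_ofReal_sq_coeff (f := lam (-(1 / 2)) q) (memLp_multiplier _ _)]
  refine tsum_congr fun k => ?_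
  congr 2
  rw [coeff_lam (by norm_num) hq]
  by_cases hk : k = 0
  · simp [hk]
  · rw [if_neg hk, norm_mul, Complex.norm_real, Real.norm_eq_abs,
      abs_of_nonneg (Real.rpow_nonneg (freq_nonneg k) _), Real.rpow_neg (freq_nonneg k),
      ← Real.sqrt_eq_rpow, div_eq_inv_mul]

lemma tsum_ofReal_lap_le {v : Fin 2 → T2 → ℝ}
    (hv2 : ∀ j, Summable fun k => (1 + freq k ^ 2) ^ 2 * ‖coeff (v j) k‖ ^ 2) :
    ∑' k, ENNReal.ofReal ((freq k ^ 2 * ∑ j, ‖coeff (v j) k‖) ^ 2) ≤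
      ENNReal.ofReal (2 * ∑ j, ∫ x, lap (v j) x ^ 2 ∂mu) := by
  have hs : HasSum (fun k : Z2 => 2 * ∑ j, freq k ^ 4 * ‖coeff (v j) k‖ ^ 2)
      (2 * ∑ j, ∫ x, lap (v j) x ^ 2 ∂mu) := by
    refine HasSum.mul_left 2 (hasSum_sum fun j _ => ?_)
    rw [integral_lap_sq (summable_freq_four (hv2 j))]
    exact (summable_freq_four (hv2 j)).hasSum
  rw [← hs.tsum_eq, ENNReal.ofReal_tsum_of_nonneg
    (fun k => mul_nonneg two_pos.le (Finset.sum_nonneg fun j _ => by positivity)) hs.summable]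
  refine ENNReal.tsum_le_tsum fun k => ENNReal.ofReal_le_ofReal ?_
  simp only [Fin.sum_univ_two]
  nlinarith [mul_nonneg (pow_nonneg (freq_nonneg k) 4)
    (sq_nonneg (‖coeff (v 0) k‖ - ‖coeff (v 1) k‖))]

/-- The Fourier form of the commutator estimate. -/
lemma enorm_sq_commutator_le {v : Fin 2 → T2 → ℝ} {q : T2 → ℝ} (hv : ∀ j, MemLp (v j) 2 mu)
    (hv2 : ∀ j, Summable fun k => (1 + freq k ^ 2) ^ 2 * ‖coeff (v j) k‖ ^ 2)
    (hdiv : ∀ k : Z2, ∑ j, (k j : ℂ) * coeff (v j) k = 0) (hq : MemLp q 2 mu)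
    (hq0 : coeff q 0 = 0) {I : ℝ}
    (hI : I = ∑ j, ∫ x, multiplier (rsym j) q x * (v j x * q x) ∂mu) :
    ‖(I : ℂ) + I‖ₑ ^ 2 ≤
      4 * ((ENNReal.ofReal (2 * ∑ j, ∫ x, lap (v j) x ^ 2 ∂mu) *
        ENNReal.ofReal (∫ x, lam (-(1 / 2)) q x ^ 2 ∂mu)) *
      (ENNReal.ofReal (∫ x, q x ^ 2 ∂mu) * ∑' k : Z2, ENNReal.ofReal (2 * (freq k ^ 3)⁻¹))) := by
  set T : Z2 × Z2 → ℂ := fun p =>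
    ∑ j, conj (coeff (multiplier (rsym j) q) p.1) * (coeff (v j) p.2 * coeff q (p.1 - p.2))
  have hTI : HasSum T (I : ℂ) := by
    rw [hI, Complex.ofReal_sum]
    refine hasSum_sum fun j _ => ?_
    exact hasSum_integral_triple (memLp_multiplier _ _) (hv j) hq
      (memLp_mul_of_top (memLp_top_of_summable (hv j) (hv2 j)) hq) (fun _ _ => rfl)
      (summable_triple_of_bounded (memLp_multiplier _ _) (tsum_enorm_coeff_ne_top (hv2 j)) hq)
  -- Reindexing leaves the sum unchanged, so symmetrisation computes twice the integral.
  have h2 : HasSum (fun p => T p + T (swapFreq p)) ((I : ℂ) + I) :=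
    hTI.add ((swapFreq.hasSum_iff).2 hTI)
  have h3 := tsum_commutator_sq_le (fun k => ∑ j, ‖coeff (v j) k‖) (fun k => ‖coeff q k‖)
    (fun k => Finset.sum_nonneg fun _ _ => norm_nonneg _) fun k => norm_nonneg _
  rw [tsum_ofReal_lam_half hq, tsum_ofReal_sq_coeff hq] at h3
  refine le_trans (pow_le_pow_left' ?_ 2) (h3.trans ?_)
  · rw [← h2.tsum_eq]
    refine enorm_tsum_le_tsum_enorm.trans (ENNReal.tsum_le_tsum fun p => ?_)
    rw [enorm_eq_ofReal_norm]
    exact ENNReal.ofReal_le_ofReal (norm_commutator_term_le hq hq0 hdiv p.1 p.2)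
  · exact mul_le_mul' le_rfl (mul_le_mul' (mul_le_mul' (tsum_ofReal_lap_le hv2) le_rfl) le_rfl)

lemma sq_le_of_enorm_sq_le {I D E Q : ℝ} {Z : ℝ≥0∞} (hZ : Z ≠ ∞) (hD : 0 ≤ D) (hE : 0 ≤ E)
    (hQ : 0 ≤ Q) (h : ‖(I : ℂ) + I‖ₑ ^ 2 ≤
      4 * ((ENNReal.ofReal (2 * D) * ENNReal.ofReal E) * (ENNReal.ofReal Q * Z))) :
    I ^ 2 ≤ 2 * Z.toReal * D * Q * E := by
  have hz : 0 ≤ Z.toReal := ENNReal.toReal_nonneg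
  have e : ‖(I : ℂ) + I‖ₑ ^ 2 = ENNReal.ofReal ((2 * I) ^ 2) := by
    rw [enorm_sq_eq, ← Complex.ofReal_add, Complex.norm_real, Real.norm_eq_abs, sq_abs, two_mul]
  have e4 : (4 : ℝ≥0∞) = ENNReal.ofReal 4 := by norm_num
  rw [e, ← ENNReal.ofReal_toReal hZ, e4, ← ENNReal.ofReal_mul (by positivity),
    ← ENNReal.ofReal_mul hQ, ← ENNReal.ofReal_mul (by positivity),
    ← ENNReal.ofReal_mul (by norm_num), ENNReal.ofReal_le_ofReal_iff (by positivity)] at h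
  nlinarith

/-- **Commutator estimate**: for divergence free `v`, the form `∫ q v·Rq` is controlled by
`‖Δv‖ ‖q‖ ‖Λ^{-1/2} q‖`. -/
theorem sq_sum_integral_commutator_le : ∃ C : ℝ, 0 ≤ C ∧ ∀ (v : Fin 2 → T2 → ℝ) (q : T2 → ℝ),
    (∀ j, MemLp (v j) 2 mu) →
    (∀ j, Summable fun k => (1 + freq k ^ 2) ^ 2 * ‖coeff (v j) k‖ ^ 2) →
    (∀ k : Z2, ∑ j, (k j : ℂ) * coeff (v j) k = 0) → MemLp q 2 mu → coeff q 0 = 0 →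
    (∑ j, ∫ x, multiplier (rsym j) q x * (v j x * q x) ∂mu) ^ 2 ≤
      C * (∑ j, ∫ x, lap (v j) x ^ 2 ∂mu) * (∫ x, q x ^ 2 ∂mu) *
        ∫ x, lam (-(1 / 2)) q x ^ 2 ∂mu := by
  have hZt : (∑' k : Z2, ENNReal.ofReal (2 * (freq k ^ 3)⁻¹)) ≠ ∞ := by
    simp only [ENNReal.ofReal_mul zero_le_two]
    rw [ENNReal.tsum_mul_left]
    exact ENNReal.mul_ne_top ENNReal.ofReal_ne_top tsum_freq_cube_ne_top
  refine ⟨2 * (∑' k : Z2, ENNReal.ofReal (2 * (freq k ^ 3)⁻¹)).toReal, by positivity,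
    fun v q hv hv2 hdiv hq hq0 => ?_⟩
  exact sq_le_of_enorm_sq_le hZt
    (Finset.sum_nonneg fun j _ => integral_nonneg fun x => sq_nonneg _)
    (integral_nonneg fun x => sq_nonneg _) (integral_nonneg fun x => sq_nonneg _)
    (enorm_sq_commutator_le hv hv2 hdiv hq hq0 rfl)

section Morrey

open Set

/-! ### Morrey's inequality for trigonometric polynomials -/

/-- The covering map of the torus by the plane. -/
def cov (y : Fin 2 → ℝ) : T2 := fun i => (y i : UnitAddCircle)

lemma continuous_cov : Continuous cov :=
  continuous_pi fun i => (AddCircle.continuous_mk' 1).comp (continuous_apply i)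

/-- The unit square. -/
def unitSq : Set (Fin 2 → ℝ) := {y | ∀ i, y i ∈ Ioc ((0 : Fin 2 → ℝ) i) ((0 : Fin 2 → ℝ) i + 1)}

lemma mem_unitSq {y : Fin 2 → ℝ} : y ∈ unitSq ↔ ∀ i, 0 < y i ∧ y i ≤ 1 := by
  simp [unitSq]

lemma measurableSet_unitSq : MeasurableSet unitSq :=
  MeasurableSet.univ_pi' fun _ => measurableSet_Ioc

lemma lintegral_unitSq (f : T2 → ℝ≥0∞) :
    ∫⁻ y in unitSq, f (cov y) = ∫⁻ x, f x ∂mu :=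
  (UnitAddTorus.lintegral_preimage f 0).symm

lemma lintegral_unitSq_add {f : T2 → ℝ≥0∞} (z : T2) :
    ∫⁻ y in unitSq, f (z + cov y) = ∫⁻ x, f x ∂mu := by
  rw [lintegral_unitSq fun x => f (z + x)]
  exact lintegral_add_left_eq_self f z

lemma volume_unitSq : volume unitSq = 1 := by
  have := lintegral_unitSq fun _ => 1
  simpa using this

lemma integral_unitSq_add (f : T2 → ℂ) (z : T2) :
    ∫ y in unitSq, f (z + cov y) = ∫ x, f x ∂mu := by
  have h : ∫ x, f (z + x) ∂mu = ∫ y in unitSq, f (z + cov y) :=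
    UnitAddTorus.integral_preimage (fun x => f (z + x)) 0
  rw [← h]
  exact integral_add_left_eq_self f z

/-- Contraction by t ≤ 1 keeps the unit square inside itself, and the Jacobian in dimension two is
t². -/
lemma lintegral_unitSq_smul_le {f : (Fin 2 → ℝ) → ℝ≥0∞} (hf : Measurable f) {t : ℝ}
    (ht0 : 0 < t) (ht1 : t ≤ 1) :
    ∫⁻ y in unitSq, f (t • y) ≤ ENNReal.ofReal ((t ^ 2)⁻¹) * ∫⁻ y in unitSq, f y := by
  have hm : Measurable (unitSq.indicator f) := hf.indicator measurableSet_unitSq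
  have h1 : ∫⁻ y in unitSq, f (t • y) ≤ ∫⁻ y, unitSq.indicator f (t • y) := by
    rw [← lintegral_indicator measurableSet_unitSq]
    refine lintegral_mono fun y => ?_
    by_cases hy : y ∈ unitSq
    · have : t • y ∈ unitSq := by
        rw [mem_unitSq] at hy ⊢
        intro i
        have := hy i
        exact ⟨mul_pos ht0 this.1, by
          simp only [Pi.smul_apply, smul_eq_mul]; nlinarith [this.1, this.2]⟩
      rw [indicator_of_mem hy, indicator_of_mem this]
    · rw [indicator_of_notMem hy]; exact zero_le
  refine h1.trans (le_of_eq ?_)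
  have h2 := lintegral_map (μ := (volume : Measure (Fin 2 → ℝ))) hm (measurable_const_smul t)
  rw [← h2, Measure.map_addHaar_smul _ ht0.ne', lintegral_smul_measure,
    lintegral_indicator measurableSet_unitSq, Module.finrank_fin_fun, abs_of_pos (by positivity),
    smul_eq_mul]

/-- The finite constant `∫₀¹ t^{-1/2} dt`. -/
def coneConst : ℝ≥0∞ := ∫⁻ t in Ioc (0 : ℝ) 1, ENNReal.ofReal ((Real.sqrt t)⁻¹)

lemma coneConst_ne_top : coneConst ≠ ∞ := by
  have h : IntervalIntegrable (fun t : ℝ => t ^ (-(1 / 2) : ℝ)) volume 0 1 :=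
    intervalIntegral.intervalIntegrable_rpow' (by norm_num)
  have h2 := h.1.lintegral_lt_top
  refine ne_of_lt (lt_of_le_of_lt (setLIntegral_mono' measurableSet_Ioc fun t ht => ?_) h2)
  rw [Real.rpow_neg ht.1.le, Real.sqrt_eq_rpow]

/-- Young's inequality with weight √t, then rescaling, give t^{-1/2} + t^{3/2} t^{-2} ∫ G⁴, and
t^{-1/2} is integrable at 0. The bound is not homogeneous in G, but only finiteness will be used. -/
lemma lintegral_cone_le {G : T2 → ℝ} (hG : Continuous G) (hG0 : ∀ x, 0 ≤ G x) (z : T2) :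
    ∫⁻ y in unitSq, ∫⁻ t in Ioc (0 : ℝ) 1, ENNReal.ofReal (G (z + cov (t • y))) ≤
      coneConst * (1 + ∫⁻ x, ENNReal.ofReal (G x ^ 4) ∂mu) := by
  have hc : Continuous fun p : (Fin 2 → ℝ) × ℝ => G (z + cov (p.2 • p.1)) :=
    hG.comp (continuous_const.add (continuous_cov.comp (continuous_snd.smul continuous_fst)))
  have hm : Measurable fun p : (Fin 2 → ℝ) × ℝ => ENNReal.ofReal (G (z + cov (p.2 • p.1))) :=
    ENNReal.measurable_ofReal.comp hc.measurable
  rw [lintegral_lintegral_swap (f := fun y t => ENNReal.ofReal (G (z + cov (t • y))))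
    hm.aemeasurable, coneConst, ← lintegral_mul_const _ (by fun_prop)]
  refine setLIntegral_mono' measurableSet_Ioc fun t ht => ?_
  set s := Real.sqrt t with hs
  have hs0 : 0 < s := Real.sqrt_pos.2 ht.1
  have hst : s ^ 2 = t := Real.sq_sqrt ht.1.le
  have hyoung : ∀ x : ℝ, 0 ≤ x → x ≤ s⁻¹ + s ^ 3 * x ^ 4 := fun x hx => by
    have h3 : 0 ≤ s ^ 3 * x ^ 4 := by positivity
    rcases le_total (s * x) 1 with h | h
    · have : x ≤ s⁻¹ := by rw [← one_div, le_div_iff₀ hs0]; linarith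
      linarith
    · have h1 : 1 ≤ (s * x) ^ 3 := one_le_pow₀ h
      have : x * 1 ≤ x * (s * x) ^ 3 := mul_le_mul_of_nonneg_left h1 hx
      have h4 : 0 < s⁻¹ := by positivity
      calc x = x * 1 := by ring
        _ ≤ x * (s * x) ^ 3 := this
        _ = s ^ 3 * x ^ 4 := by ring
        _ ≤ _ := by linarith
  have hct : Measurable fun y : Fin 2 → ℝ => ENNReal.ofReal (G (z + cov y) ^ 4) :=
    ENNReal.measurable_ofReal.comp
      ((hG.comp (continuous_const.add continuous_cov)).pow 4).measurable
  calc ∫⁻ y in unitSq, ENNReal.ofReal (G (z + cov (t • y))) ≤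
      ∫⁻ y in unitSq, (ENNReal.ofReal s⁻¹ +
        ENNReal.ofReal (s ^ 3) * ENNReal.ofReal (G (z + cov (t • y)) ^ 4)) := by
        refine lintegral_mono fun y => ?_
        rw [← ENNReal.ofReal_mul (by positivity), ← ENNReal.ofReal_add (by positivity)
          (by positivity)]
        exact ENNReal.ofReal_le_ofReal (hyoung _ (hG0 _))
    _ = ENNReal.ofReal s⁻¹ + ENNReal.ofReal (s ^ 3) *
        ∫⁻ y in unitSq, ENNReal.ofReal (G (z + cov (t • y)) ^ 4) := by
        rw [lintegral_add_left measurable_const, lintegral_const, Measure.restrict_apply_univ,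
          volume_unitSq, mul_one, lintegral_const_mul' _ _ ENNReal.ofReal_ne_top]
    _ ≤ ENNReal.ofReal s⁻¹ + ENNReal.ofReal (s ^ 3) * (ENNReal.ofReal ((t ^ 2)⁻¹) *
        ∫⁻ x, ENNReal.ofReal (G x ^ 4) ∂mu) := by
        gcongr
        refine (lintegral_unitSq_smul_le hct ht.1 ht.2).trans (le_of_eq ?_)
        rw [lintegral_unitSq_add (f := fun x => ENNReal.ofReal (G x ^ 4)) z]
    _ = _ := by
        rw [← mul_assoc, ← ENNReal.ofReal_mul (by positivity), mul_add, mul_one]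
        congr 3
        rw [← hst]; field_simp

lemma mFourier_apply_add (k : Z2) (x y : T2) :
    mFourier k (x + y) = mFourier k x * mFourier k y := by
  simp only [UnitAddTorus.mFourier, ContinuousMap.coe_mk, ← Finset.prod_mul_distrib]
  refine Finset.prod_congr rfl fun i _ => ?_
  simp only [fourier_apply, Pi.add_apply, smul_add, AddCircle.toCircle_add, Circle.coe_mul]

lemma mFourier_cov (k : Z2) (y : Fin 2 → ℝ) :
    mFourier k (cov y) = Complex.exp (2 * Real.pi * Complex.I * ∑ j, (k j : ℂ) * (y j : ℂ)) := by
  simp only [UnitAddTorus.mFourier, ContinuousMap.coe_mk, cov, fourier_coe_apply, Finset.mul_sum,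
    Complex.exp_sum]
  refine Finset.prod_congr rfl fun i _ => ?_
  congr 1; push_cast; ring

lemma trig_symMul (m : Z2 → ℂ) (a : Z2 →₀ ℂ) (x : T2) :
    trig (symMul m a) x = ∑ k ∈ a.support, m k * a k * mFourier k x := by
  rw [trig_apply, Finsupp.sum_of_support_subset (s := a.support)]
  · rfl
  · exact Finsupp.support_onFinset_subset
  · simp

/-- The factor 2π appears because the path is parametrised in ℝ/ℤ coordinates while the symbols i kⱼ
differentiate with respect to x = 2πθ. -/
lemma hasDerivAt_trig (a : Z2 →₀ ℂ) (z : T2) (y : Fin 2 → ℝ) (t : ℝ) :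
    HasDerivAt (fun t : ℝ => trig a (z + cov (t • y)))
      (2 * Real.pi * ∑ j, (y j : ℂ) *
        trig (symMul (fun k => Complex.I * (k j : ℂ)) a) (z + cov (t • y))) t := by
  have hk : ∀ k : Z2, HasDerivAt (fun t : ℝ => a k * mFourier k (z + cov (t • y)))
      (a k * (mFourier k (z + cov (t • y)) *
        (2 * Real.pi * Complex.I * ∑ j, (k j : ℂ) * (y j : ℂ)))) t := fun k => by
    have e : ∀ t : ℝ, mFourier k (z + cov (t • y)) = mFourier k z *
        Complex.exp ((t : ℂ) * (2 * Real.pi * Complex.I * ∑ j, (k j : ℂ) * (y j : ℂ))) :=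
      fun t => by
        rw [mFourier_apply_add, mFourier_cov]
        congr 2
        simp only [Pi.smul_apply, smul_eq_mul, Complex.ofReal_mul, Finset.mul_sum]
        refine Finset.sum_congr rfl fun j _ => ?_
        ring
    simp only [e]
    have h1 := ((hasDerivAt_id (t : ℂ)).mul_const
      (2 * Real.pi * Complex.I * ∑ j, (k j : ℂ) * (y j : ℂ))).comp_ofReal
    have h2 := (h1.cexp.const_mul (mFourier k z)).const_mul (a k)
    simp only [id, one_mul] at h2
    rw [mul_assoc (mFourier k z)]
    exact h2
  have hs := HasDerivAt.fun_sum fun k (_ : k ∈ a.support) => hk k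
  have e1 : (fun t : ℝ => trig a (z + cov (t • y))) =
      fun t => ∑ k ∈ a.support, a k * mFourier k (z + cov (t • y)) := by
    funext t; rw [trig_apply]; rfl
  have e2 : 2 * Real.pi * ∑ j, (y j : ℂ) *
        trig (symMul (fun k => Complex.I * (k j : ℂ)) a) (z + cov (t • y)) =
      ∑ k ∈ a.support, a k * (mFourier k (z + cov (t • y)) *
        (2 * Real.pi * Complex.I * ∑ j, (k j : ℂ) * (y j : ℂ))) := by
    simp only [trig_symMul, Finset.mul_sum]
    rw [Finset.sum_comm]
    refine Finset.sum_congr rfl fun k _ => Finset.sum_congr rfl fun j _ => ?_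
    ring
  rw [e1, e2]
  exact hs

/-- The sum of the moduli of the partial derivatives of a trigonometric polynomial. -/
def gradSum (a : Z2 →₀ ℂ) (x : T2) : ℝ :=
  ∑ j, ‖trig (symMul (fun k => Complex.I * (k j : ℂ)) a) x‖

lemma continuous_gradSum (a : Z2 →₀ ℂ) : Continuous (gradSum a) :=
  continuous_finsetSum _ fun _ _ => (ContinuousMap.continuous _).norm

lemma gradSum_nonneg (a : Z2 →₀ ℂ) (x : T2) : 0 ≤ gradSum a x :=
  Finset.sum_nonneg fun _ _ => norm_nonneg _

lemma enorm_trig_sub_le (a : Z2 →₀ ℂ) (z : T2) {y : Fin 2 → ℝ} (hy : y ∈ unitSq) :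
    ‖trig a (z + cov y) - trig a z‖ₑ ≤
      ENNReal.ofReal (2 * Real.pi) *
        ∫⁻ t in Ioc (0 : ℝ) 1, ENNReal.ofReal (gradSum a (z + cov (t • y))) := by
  have hpath : Continuous fun t : ℝ => z + cov (t • y) :=
    continuous_const.add (continuous_cov.comp (continuous_id.smul continuous_const))
  have hcont : Continuous fun t : ℝ => 2 * Real.pi * ∑ j, (y j : ℂ) *
        trig (symMul (fun k => Complex.I * (k j : ℂ)) a) (z + cov (t • y)) :=
    continuous_const.mul (continuous_finsetSum _ fun j _ => continuous_const.mul
      ((ContinuousMap.continuous _).comp hpath))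
  have h := intervalIntegral.integral_eq_sub_of_hasDerivAt
    (fun t (_ : t ∈ uIcc (0 : ℝ) 1) => hasDerivAt_trig a z y t) (hcont.intervalIntegrable 0 1)
  have hc0 : cov ((0 : ℝ) • y) = 0 := by
    rw [zero_smul]; ext i; simp [cov]
  rw [one_smul, hc0, add_zero, intervalIntegral.integral_of_le zero_le_one] at h
  rw [← h, ← lintegral_const_mul' _ _ ENNReal.ofReal_ne_top]
  refine (enorm_integral_le_lintegral_enorm _).trans (lintegral_mono fun t => ?_)
  rw [← ofReal_norm, ← ENNReal.ofReal_mul (by positivity)]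
  refine ENNReal.ofReal_le_ofReal ?_
  rw [norm_mul]
  have e : ‖(2 * Real.pi : ℂ)‖ = 2 * Real.pi := by
    rw [norm_mul, Complex.norm_real, Real.norm_eq_abs, abs_of_pos Real.pi_pos]; norm_num
  rw [e, gradSum]
  gcongr
  refine (norm_sum_le _ _).trans (Finset.sum_le_sum fun j _ => ?_)
  rw [norm_mul, Complex.norm_real, Real.norm_eq_abs]
  rw [mem_unitSq] at hy
  have := hy j
  exact mul_le_of_le_one_left (norm_nonneg _) (abs_le.2 ⟨by linarith, this.2⟩)

/-- **Morrey's inequality** for trigonometric polynomials without zero mode. -/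
theorem enorm_trig_le {a : Z2 →₀ ℂ} (ha : a 0 = 0) (z : T2) :
    ‖trig a z‖ₑ ≤ ENNReal.ofReal (2 * Real.pi) *
      (coneConst * (1 + ∫⁻ x, ENNReal.ofReal (gradSum a x ^ 4) ∂mu)) := by
  -- The mean over the translated square vanishes, so the value at z is minus the average of the
  -- increments, each an integral of the gradient along a segment.
  have h0 : ∫ y in unitSq, trig a (z + cov y) = 0 := by
    rw [integral_unitSq_add, ← ha, ← mFourierCoeff_trig a 0, mFourierCoeff_eq]
    simp [UnitAddTorus.mFourier_zero]
  have hvol : volume.restrict unitSq univ = 1 := by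
    rw [Measure.restrict_apply_univ, volume_unitSq]
  have : IsFiniteMeasure (volume.restrict unitSq) := ⟨by rw [hvol]; exact ENNReal.one_lt_top⟩
  have hint : Integrable (fun y => trig a (z + cov y)) (volume.restrict unitSq) := by
    refine (integrable_const (‖trig a‖ : ℝ)).mono' ?_ (.of_forall fun y =>
      (trig a).norm_coe_le_norm _)
    exact ((trig a).continuous.comp (continuous_const.add continuous_cov)).aestronglyMeasurable
  have h1 : ∫ y in unitSq, (trig a (z + cov y) - trig a z) = -trig a z := by
    rw [integral_sub hint (integrable_const _), h0, integral_const, Measure.real, hvol]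
    simp
  rw [← enorm_neg, ← h1]
  refine (enorm_integral_le_lintegral_enorm _).trans ?_
  refine (setLIntegral_mono' measurableSet_unitSq fun y hy => enorm_trig_sub_le a z hy).trans ?_
  rw [lintegral_const_mul' _ _ ENNReal.ofReal_ne_top]
  gcongr
  exact lintegral_cone_le (continuous_gradSum a) (gradSum_nonneg a) z

lemma lintegral_gradSum_le (a : Z2 →₀ ℂ) :
    ∫⁻ x, ENNReal.ofReal (gradSum a x ^ 4) ∂mu ≤
      8 * ∑ j, eLpNorm (trig (symMul (fun k => Complex.I * (k j : ℂ)) a)) 4 mu ^ 4 := by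
  have e : ∀ f : C(T2, ℂ), eLpNorm f 4 mu ^ 4 = ∫⁻ x, ENNReal.ofReal (‖f x‖ ^ 4) ∂mu := fun f => by
    rw [eLpNorm_eq_lintegral_rpow_enorm_toReal (by norm_num) (by norm_num), ← ENNReal.rpow_natCast,
      ← ENNReal.rpow_mul]
    norm_num
  simp only [e]
  have hm : ∀ j ∈ (Finset.univ : Finset (Fin 2)), Measurable fun x : T2 =>
      ENNReal.ofReal (‖trig (symMul (fun k => Complex.I * (k j : ℂ)) a) x‖ ^ 4) := fun j _ =>
    ENNReal.measurable_ofReal.comp (((ContinuousMap.continuous _).norm.pow 4).measurable)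
  rw [← lintegral_finsetSum _ hm, ← lintegral_const_mul' _ _ (by norm_num)]
  refine lintegral_mono fun x => ?_
  have e8 : (8 : ℝ≥0∞) = ENNReal.ofReal 8 := by norm_num
  simp only
  rw [← ENNReal.ofReal_sum_of_nonneg fun j _ => by positivity, e8,
    ← ENNReal.ofReal_mul (by norm_num)]
  refine ENNReal.ofReal_le_ofReal ?_
  simp only [gradSum, Fin.sum_univ_two]
  refine (add_pow_le (norm_nonneg _) (norm_nonneg _) 4).trans (le_of_eq ?_)
  norm_num

/-- The symbol of `∂ⱼ Δ⁻¹`. -/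
def gsym (j : Fin 2) (k : Z2) : ℂ :=
  if k = 0 then 0 else -(Complex.I * (k j : ℂ)) / ((freq k ^ 2 : ℝ) : ℂ)

lemma hermitian_gsym (j : Fin 2) : Hermitian (gsym j) := fun k => by
  unfold gsym
  by_cases hk : k = 0
  · simp [hk]
  · simp [hk]

lemma norm_gsym_le (j : Fin 2) (k : Z2) : ‖gsym j k‖ ≤ 1 := by
  unfold gsym
  split_ifs with hk
  · simp
  · have h := one_le_freq hk
    rw [norm_div, norm_neg, Complex.norm_real, Real.norm_eq_abs, abs_of_nonneg (sq_nonneg _),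
      div_le_one (by positivity)]
    exact (norm_partial_le j k).trans (by nlinarith)

/-- Second derivatives of Δ⁻¹ are compositions of two Riesz transforms, hence bounded on L⁴. -/
lemma partial_mul_gsym (i j : Fin 2) (k : Z2) :
    Complex.I * (k i : ℂ) * gsym j k = -(rsym i k * rsym j k) := by
  unfold gsym rsym
  split_ifs with hk
  · simp
  · have : (freq k : ℂ) ≠ 0 := by exact_mod_cast freq_ne_zero hk
    push_cast
    field_simp

lemma eLpNorm_trig_eq {a : Z2 →₀ ℂ} (ha : Hermitian a) (p : ℝ≥0∞) :
    eLpNorm (trig a) p mu = eLpNorm (rtrig a) p mu :=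
  eLpNorm_congr_norm_ae (.of_forall fun x => by
    rw [trig_of_hermitian ha, Complex.norm_real])

lemma eLpNorm_trig_partial_gsym_le {a : Z2 →₀ ℂ} (ha : Hermitian a) (i j : Fin 2) :
    eLpNorm (trig (symMul (fun k => Complex.I * (k i : ℂ)) (symMul (gsym j) a))) 4 mu ≤
      64 * eLpNorm (rtrig a) 4 mu := by
  have e : symMul (fun k => Complex.I * (k i : ℂ)) (symMul (gsym j) a) =
      -symMul (rsym i) (symMul (rsym j) a) := by
    ext k
    simp only [symMul_apply, Finsupp.neg_apply]
    rw [← mul_assoc, partial_mul_gsym]; ring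
  have hj := (hermitian_rsym j).symMul ha
  rw [e, map_neg, ContinuousMap.coe_neg, eLpNorm_neg,
    eLpNorm_trig_eq ((hermitian_rsym i).symMul hj)]
  calc _ ≤ 8 * eLpNorm (rtrig (symMul (rsym j) a)) 4 mu := eLpNorm_rtrig_riesz_le hj i
    _ ≤ 8 * (8 * eLpNorm (rtrig a) 4 mu) := by gcongr; exact eLpNorm_rtrig_riesz_le ha j
    _ = _ := by rw [← mul_assoc]; norm_num

/-- If `ΔΦ ∈ L⁴` then `∇Φ ∈ L^∞`. -/
theorem memLp_top_partialD {Φ : T2 → ℝ}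
    (h2 : Summable fun k => freq k ^ 2 * ‖coeff Φ k‖ ^ 2)
    (h4 : Summable fun k => freq k ^ 4 * ‖coeff Φ k‖ ^ 2) (hl : MemLp (lap Φ) 4 mu) (j : Fin 2) :
    MemLp (partialD j Φ) ∞ mu := by
  have hl2 : MemLp (lap Φ) 2 mu := memLp_multiplier _ _
  -- The gradient is recovered from ΔΦ by a bounded symbol, so approximating ΔΦ in L⁴ approximates
  -- ∇Φ in L², while Morrey's inequality bounds the approximants uniformly.
  have hae : multiplier (gsym j) (lap Φ) =ᵐ[mu] partialD j Φ := by
    refine ae_eq_of_coeff_eq (memLp_multiplier _ _) (memLp_partialD j Φ) fun k => ?_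
    rw [coeff_multiplier (hermitian_gsym j) (memlp_of_bounded (norm_gsym_le j) hl2),
      coeff_lap h4, coeff_partialD h2, gsym]
    split_ifs with hk
    · simp [hk]
    · have : (freq k : ℂ) ≠ 0 := by exact_mod_cast freq_ne_zero hk
      push_cast
      field_simp
  obtain ⟨a, ha, hlim⟩ := exists_rtrig_tendsto (by norm_num) hl
  have hlim2 : Tendsto (fun n => eLpNorm (lap Φ - rtrig (a n)) 2 mu) atTop (𝓝 0) :=
    tendsto_of_tendsto_of_tendsto_of_le_of_le tendsto_const_nhds hlim (fun _ => zero_le)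
      fun n => eLpNorm_le_eLpNorm_of_exponent_le (by norm_num) (hl.1.sub (memLp_rtrig _ 4).1)
  have h3 := tendsto_multiplier (hermitian_gsym j) (norm_gsym_le j) hl2 ha hlim2
  set B := eLpNorm (lap Φ) 4 mu + 1
  have hB : B ≠ ∞ := ENNReal.add_ne_top.2 ⟨hl.eLpNorm_ne_top, ENNReal.one_ne_top⟩
  set K := ENNReal.ofReal (2 * Real.pi) *
      (coneConst * (1 + 8 * ∑ _i : Fin 2, (64 * B) ^ 4))
  have hK : K ≠ ∞ := by
    refine ENNReal.mul_ne_top ENNReal.ofReal_ne_top (ENNReal.mul_ne_top coneConst_ne_top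
      (ENNReal.add_ne_top.2 ⟨ENNReal.one_ne_top, ENNReal.mul_ne_top (by norm_num)
        (ENNReal.sum_ne_top.2 fun i _ => ENNReal.pow_ne_top (ENNReal.mul_ne_top (by norm_num) hB))⟩))
  have hbound : ∀ᶠ n in atTop, eLpNorm (rtrig (symMul (gsym j) (a n))) ∞ mu ≤ K := by
    filter_upwards [hlim.eventually (gt_mem_nhds one_pos)] with n hn
    have hBn : eLpNorm (rtrig (a n)) 4 mu ≤ B := by
      have e : rtrig (a n) = lap Φ - (lap Φ - rtrig (a n)) := by simp
      rw [e]
      exact (eLpNorm_sub_le hl.1 (hl.1.sub (memLp_rtrig _ 4).1) (by norm_num)).trans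
        (add_le_add le_rfl hn.le)
    rw [eLpNorm_exponent_top]
    refine essSup_le_of_ae_le _ (.of_forall fun x => ?_)
    calc ‖rtrig (symMul (gsym j) (a n)) x‖ₑ ≤ ‖trig (symMul (gsym j) (a n)) x‖ₑ := by
          rw [← ofReal_norm, ← ofReal_norm]
          exact ENNReal.ofReal_le_ofReal (Complex.abs_re_le_norm _)
      _ ≤ _ := enorm_trig_le (by simp [gsym]) x
      _ ≤ K := by
          refine mul_le_mul' le_rfl (mul_le_mul' le_rfl (add_le_add le_rfl
            ((lintegral_gradSum_le _).trans (mul_le_mul' le_rfl (Finset.sum_le_sum fun i _ => ?_)))))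
          exact pow_le_pow_left' ((eLpNorm_trig_partial_gsym_le (ha n) i j).trans
            (mul_le_mul' le_rfl hBn)) 4
  have := eLpNorm_le_of_tendsto (fun n => (memLp_rtrig _ 2).1) (memLp_multiplier _ _).1 h3 hbound
  exact (memLp_congr_ae hae).1 ⟨(memLp_multiplier _ _).1, this.trans_lt hK.lt_top⟩

end Morrey

/-! ### Hölder and Cauchy–Schwarz inequalities -/

instance holderTriple_four_four_two : ENNReal.HolderTriple 4 4 2 := ⟨by
  rw [← ENNReal.toReal_eq_toReal_iff' (by simp) (by simp),
    ENNReal.toReal_add (by simp) (by simp)]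
  norm_num⟩

lemma memLp_mul_of_four {f g : T2 → ℝ} (hf : MemLp f 4 mu) (hg : MemLp g 4 mu) :
    MemLp (fun x => f x * g x) 2 mu := MemLp.mul (p := 4) (q := 4) (r := 2) hg hf

lemma integrable_mul_of_two {f g : T2 → ℝ} (hf : MemLp f 2 mu) (hg : MemLp g 2 mu) :
    Integrable (fun x => f x * g x) mu := hf.integrable_mul hg

/-- The Cauchy–Schwarz inequality. -/
lemma sq_integral_mul_le {f g : T2 → ℝ} (hf : MemLp f 2 mu) (hg : MemLp g 2 mu) :
    (∫ x, f x * g x ∂mu) ^ 2 ≤ (∫ x, f x ^ 2 ∂mu) * ∫ x, g x ^ 2 ∂mu := by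
  have h := discrim_le_zero (a := ∫ x, f x ^ 2 ∂mu) (b := 2 * ∫ x, f x * g x ∂mu)
    (c := ∫ x, g x ^ 2 ∂mu) fun t => by
      have e : ∫ x, (t * f x + g x) ^ 2 ∂mu = (∫ x, f x ^ 2 ∂mu) * (t * t) +
          (2 * ∫ x, f x * g x ∂mu) * t + ∫ x, g x ^ 2 ∂mu := by
        have e1 : ∀ x, (t * f x + g x) ^ 2 = t * t * f x ^ 2 + 2 * t * (f x * g x) + g x ^ 2 :=
          fun x => by ring
        simp only [e1]
        have i1 : Integrable (fun x => t * t * f x ^ 2 + 2 * t * (f x * g x)) mu :=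
          (hf.integrable_sq.const_mul _).add ((integrable_mul_of_two hf hg).const_mul _)
        rw [integral_add i1 hg.integrable_sq,
          integral_add (hf.integrable_sq.const_mul _) ((integrable_mul_of_two hf hg).const_mul _),
          integral_const_mul, integral_const_mul]
        ring
      rw [← e]
      exact integral_nonneg fun x => sq_nonneg _
  rw [discrim] at h
  nlinarith

/-- Cauchy–Schwarz twice; the fourth power avoids roots. -/
lemma integral_mul_mul_pow_four_le {f g h : T2 → ℝ} (hf : MemLp f 2 mu) (hg : MemLp g 4 mu)
    (hh : MemLp h 4 mu) : (∫ x, f x * (g x * h x) ∂mu) ^ 4 ≤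
      (∫ x, f x ^ 2 ∂mu) ^ 2 * ((∫ x, g x ^ 4 ∂mu) * ∫ x, h x ^ 4 ∂mu) := by
  have h1 := sq_integral_mul_le hf (memLp_mul_of_four hg hh)
  have h2 := sq_integral_mul_le (memLp_mul_of_four hg hg) (memLp_mul_of_four hh hh)
  have e : ∀ x : T2, g x * g x * (h x * h x) = (g x * h x) ^ 2 := fun x => by ring
  have e4 : ∀ p : T2 → ℝ, ∀ x, (p x * p x) ^ 2 = p x ^ 4 := fun p x => by ring
  simp only [e, e4] at h2
  calc (∫ x, f x * (g x * h x) ∂mu) ^ 4 = ((∫ x, f x * (g x * h x) ∂mu) ^ 2) ^ 2 := by ring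
    _ ≤ ((∫ x, f x ^ 2 ∂mu) * ∫ x, (g x * h x) ^ 2 ∂mu) ^ 2 := by gcongr
    _ = (∫ x, f x ^ 2 ∂mu) ^ 2 * (∫ x, (g x * h x) ^ 2 ∂mu) ^ 2 := by ring
    _ ≤ _ := by gcongr

/-! ### Sobolev hypotheses -/

lemma InSobolev.memLp {s : ℝ} {f : T2 → ℝ} (h : InSobolev s f) : MemLp f 2 mu :=
  memLp_dx_iff.1 h.1

lemma InSobolev.summable_two {f : T2 → ℝ} (h : InSobolev 2 f) :
    Summable fun k => (1 + freq k ^ 2) ^ 2 * ‖coeff f k‖ ^ 2 := by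
  simpa only [Real.rpow_two] using h.2

lemma InSobolev.summable_one {f : T2 → ℝ} (h : InSobolev 1 f) :
    Summable fun k => freq k ^ 2 * ‖coeff f k‖ ^ 2 := by
  refine .of_nonneg_of_le (fun k => by positivity) (fun k => ?_) h.2
  rw [Real.rpow_one]
  have := freq_nonneg k
  gcongr
  linarith

lemma summable_freq_two {f : T2 → ℝ}
    (h : Summable fun k => (1 + freq k ^ 2) ^ 2 * ‖coeff f k‖ ^ 2) :
    Summable fun k => freq k ^ 2 * ‖coeff f k‖ ^ 2 := by
  refine .of_nonneg_of_le (fun k => by positivity) (fun k => ?_) h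
  exact mul_le_mul_of_nonneg_right (by nlinarith [sq_nonneg (freq k)]) (by positivity)

lemma summable_freq_two_sub {f g : T2 → ℝ} (hf : MemLp f 2 mu) (hg : MemLp g 2 mu)
    (h1 : Summable fun k => freq k ^ 2 * ‖coeff f k‖ ^ 2)
    (h2 : Summable fun k => freq k ^ 2 * ‖coeff g k‖ ^ 2) :
    Summable fun k => freq k ^ 2 * ‖coeff (f - g) k‖ ^ 2 := by
  refine .of_nonneg_of_le (fun k => by positivity) (fun k => ?_) ((h1.add h2).mul_left 2)
  rw [coeff_sub (integrable_of_memLp hf) (integrable_of_memLp hg), ← mul_add, mul_left_comm]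
  gcongr
  nlinarith [norm_sub_le (coeff f k) (coeff g k), norm_nonneg (coeff f k - coeff g k),
    sq_nonneg (‖coeff f k‖ - ‖coeff g k‖), norm_nonneg (coeff f k), norm_nonneg (coeff g k)]

/-! ### Differences -/

lemma riesz_sub (j : Fin 2) {f g : T2 → ℝ} (hf : MemLp f 2 mu) (hg : MemLp g 2 mu) :
    multiplier (rsym j) (f - g) =ᵐ[mu] multiplier (rsym j) f - multiplier (rsym j) g := by
  refine ae_eq_of_coeff_eq (memLp_multiplier _ _)
    ((memLp_multiplier _ _).sub (memLp_multiplier _ _)) fun k => ?_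
  rw [coeff_riesz j (hf.sub hg), coeff_sub (integrable_of_memLp (memLp_multiplier _ _))
    (integrable_of_memLp (memLp_multiplier _ _)), coeff_riesz j hf, coeff_riesz j hg,
    coeff_sub (integrable_of_memLp hf) (integrable_of_memLp hg), mul_sub]

lemma partialD_sub (j : Fin 2) {f g : T2 → ℝ} (hf : MemLp f 2 mu) (hg : MemLp g 2 mu)
    (h1 : Summable fun k => freq k ^ 2 * ‖coeff f k‖ ^ 2)
    (h2 : Summable fun k => freq k ^ 2 * ‖coeff g k‖ ^ 2) :
    partialD j (f - g) =ᵐ[mu] partialD j f - partialD j g := by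
  refine ae_eq_of_coeff_eq (memLp_multiplier _ _)
    ((memLp_multiplier _ _).sub (memLp_multiplier _ _)) fun k => ?_
  rw [coeff_partialD (summable_freq_two_sub hf hg h1 h2),
    coeff_sub (integrable_of_memLp (memLp_partialD j f)) (integrable_of_memLp (memLp_partialD j g)),
    coeff_partialD h1, coeff_partialD h2,
    coeff_sub (integrable_of_memLp hf) (integrable_of_memLp hg), mul_sub]

lemma summable_freq_two_lam {q : T2 → ℝ} (hq : MemLp q 2 mu) :
    Summable fun k => freq k ^ 2 * ‖coeff (lam (-1) q) k‖ ^ 2 := by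
  refine .of_nonneg_of_le (fun k => by positivity) (fun k => ?_) (summable_coeff hq)
  rw [coeff_lam (by norm_num) hq]
  split_ifs with hk
  · simp
  · have := freq_ne_zero hk
    rw [norm_mul, Complex.norm_real, Real.rpow_neg_one, mul_pow, Real.norm_eq_abs, sq_abs]
    field_simp
    exact le_rfl

lemma partialD_lam (j : Fin 2) {q : T2 → ℝ} (hq : MemLp q 2 mu) :
    partialD j (lam (-1) q) =ᵐ[mu] multiplier (rsym j) q := by
  refine ae_eq_of_coeff_eq (memLp_multiplier _ _) (memLp_multiplier _ _) fun k => ?_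
  rw [coeff_partialD (summable_freq_two_lam hq), coeff_riesz j hq, coeff_lam (by norm_num) hq,
    ← mul_assoc, rsym]
  split_ifs with hk
  · simp
  · rw [Real.rpow_neg_one, Complex.ofReal_inv, div_eq_mul_inv]

/-- Λ has an unbounded symbol, but its product with the coefficients of Λ⁻¹q is again square
summable. Zero mean is needed because Λ⁻¹ discards the zero mode. -/
lemma lam_one_lam {q : T2 → ℝ} (hq : MemLp q 2 mu) (h0 : coeff q 0 = 0) :
    lam 1 (lam (-1) q) =ᵐ[mu] q := by
  refine ae_eq_of_coeff_eq (memLp_multiplier _ _) hq fun k => ?_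
  have e : ∀ k, (if k = 0 then 0 else ((freq k ^ (1 : ℝ) : ℝ) : ℂ)) * coeff (lam (-1) q) k =
      coeff q k := fun k => by
    rw [coeff_lam (by norm_num) hq]
    split_ifs with hk
    · simp [hk, h0]
    · have : (freq k : ℂ) ≠ 0 := by exact_mod_cast freq_ne_zero hk
      rw [Real.rpow_neg_one, Real.rpow_one, Complex.ofReal_inv, mul_inv_cancel_left₀ this]
  rw [← e k]
  refine coeff_multiplier (fun k => ?_) ?_ k
  · by_cases hk : k = 0
    · simp [hk]
    · simp [hk]
  · simp only [e]
    exact memlp_iff_summable.2 (summable_coeff hq)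

/-! ### Elementary inequalities -/

lemma abs_le_of_sq_le_mul {t Q X : ℝ} (hQ : 0 ≤ Q) (hX : 0 ≤ X) (h : t ^ 2 ≤ X * Q) :
    |t| ≤ Q / 4 + X := by
  refine abs_le_of_sq_le_sq (h.trans ?_) (by positivity)
  nlinarith [sq_nonneg (Q / 4 - X)]

/-- Expand the square of the right-hand side: (c r A)² absorbs the term in A², and the cross term
(c/8) r² A B absorbs the one in AB. This is why both first and second powers of the norms appear in
K. -/
lemma le_of_sq_le_interpolate {y c K r A B : ℝ} (hr : 0 ≤ r) (hA : 0 ≤ A) (hB : 0 ≤ B)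
    (hc : 0 ≤ c) (hK : K ≤ c / 8) (hK2 : K ≤ c ^ 2)
    (h : y ^ 2 ≤ K * r ^ 2 * (A * (A + B))) : |y| ≤ B / 16 + c * (r + r ^ 2) * A := by
  refine abs_le_of_sq_le_sq (h.trans ?_) (by positivity)
  have h1 : K * (r ^ 2 * A ^ 2) ≤ c ^ 2 * (r ^ 2 * A ^ 2) := by gcongr
  have h2 : K * (r ^ 2 * A * B) ≤ c / 8 * (r ^ 2 * A * B) := by gcongr
  have h3 : 0 ≤ (B / 16) ^ 2 + B / 8 * c * r * A + 2 * (c * r * A * (c * r ^ 2 * A)) +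
    (c * r ^ 2 * A) ^ 2 := by positivity
  nlinarith

lemma abs_le_of_pow_four_le {t g A B : ℝ} (hg : 0 ≤ g) (hA : 0 ≤ A) (hB : 0 ≤ B)
    (h : t ^ 4 ≤ (g ^ 2) ^ 2 * (128 * (A * (A + B))) ^ 2) :
    |t| ≤ B / 16 + 1024 * (g + g ^ 2) * A := by
  refine le_of_sq_le_interpolate (K := 128) hg hA hB (by norm_num) (by norm_num) (by norm_num) ?_
  refine (abs_le_of_sq_le_sq' (a := t ^ 2) ?_ (by positivity)).2
  calc (t ^ 2) ^ 2 = t ^ 4 := by ring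
    _ ≤ _ := h
    _ = _ := by ring

/-- Young's inequality twice: first on r²A(A + B), giving Y, then on t² ≤ QY. Here 2¹⁹ = 2¹² · 128
and c = 2²² = 8 · 2¹⁹. -/
lemma abs_le_of_pow_four_le_mul {t Q r A B : ℝ} (hQ : 0 ≤ Q) (hr : 0 ≤ r) (hA : 0 ≤ A)
    (hB : 0 ≤ B) (h : t ^ 4 ≤ Q ^ 2 * (2 ^ 12 * r ^ 2 * (128 * (A * (A + B))))) :
    |t| ≤ Q / 8 + B / 8 + 2 ^ 23 * (r + r ^ 2) * A := by
  set Y := B / 16 + 2 ^ 22 * (r + r ^ 2) * A with hY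
  have h0 : 0 ≤ 2 ^ 19 * r ^ 2 * (A * (A + B)) := by positivity
  have h1 := le_of_sq_le_interpolate (K := 2 ^ 19) (c := 2 ^ 22)
    (y := Real.sqrt (2 ^ 19 * r ^ 2 * (A * (A + B)))) hr hA hB
    (by norm_num) (by norm_num) (by norm_num) (Real.sq_sqrt h0).le
  rw [abs_of_nonneg (Real.sqrt_nonneg _)] at h1
  have hY0 : 0 ≤ Y := (Real.sqrt_nonneg _).trans h1
  have h2 : t ^ 2 ≤ Q * Y := by
    refine (abs_le_of_sq_le_sq' (a := t ^ 2) ?_ (by positivity)).2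
    calc (t ^ 2) ^ 2 = t ^ 4 := by ring
      _ ≤ _ := h
      _ = Q ^ 2 * Real.sqrt (2 ^ 19 * r ^ 2 * (A * (A + B))) ^ 2 := by rw [Real.sq_sqrt h0]; ring
      _ ≤ Q ^ 2 * Y ^ 2 := by gcongr
      _ = _ := by ring
  have h3 : |t| ≤ Q / 8 + 2 * Y := by
    refine abs_le_of_sq_le_sq (h2.trans ?_) (by positivity)
    nlinarith [sq_nonneg (Q / 8 - 2 * Y)]
  linarith

/-! ### The reduced form and its lower bound -/

lemma integral_riesz_pow_four_le {f : T2 → ℝ} (hf : MemLp f 4 mu) (j : Fin 2) :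
    MemLp (multiplier (rsym j) f) 4 mu ∧
      ∫ x, multiplier (rsym j) f x ^ 4 ∂mu ≤ 2 ^ 12 * ∫ x, f x ^ 4 ∂mu := by
  have h := eLpNorm_riesz_le hf j
  have hm : MemLp (multiplier (rsym j) f) 4 mu :=
    ⟨(memLp_multiplier _ _).1, h.trans_lt (ENNReal.mul_lt_top (by norm_num) hf.2)⟩
  refine ⟨hm, ?_⟩
  have h0 : ∀ g : T2 → ℝ, 0 ≤ ∫ x, g x ^ 4 ∂mu := fun g => integral_nonneg fun x => by positivity
  have e8 : (8 : ℝ≥0∞) = ENNReal.ofReal 8 := by norm_num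
  have hr : ∀ g : T2 → ℝ, ((∫ x, g x ^ 4 ∂mu) ^ (1 / 4 : ℝ)) ^ 4 = ∫ x, g x ^ 4 ∂mu := fun g => by
    rw [← Real.rpow_natCast, ← Real.rpow_mul (h0 g)]
    norm_num
  have hpos := fun g => Real.rpow_nonneg (h0 g) (1 / 4)
  rw [eLpNorm_four_eq hm, eLpNorm_four_eq hf, e8, ← ENNReal.ofReal_mul (by norm_num),
    ENNReal.ofReal_le_ofReal_iff (mul_nonneg (by norm_num) (hpos f))] at h
  have := pow_le_pow_left₀ (hpos _) h 4
  rw [mul_pow, hr, hr] at this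
  linarith

/-- The integrand of the pairing after cancellations, with `q = q₁ - q₂`, `u = u₁ - u₂`,
`v = u₁`, `w = u₂` and `P = ∇Φ`. -/
def reducedDensity (q q₁ : T2 → ℝ) (u v w P : Fin 2 → T2 → ℝ) (x : T2) : ℝ :=
  -(∑ j, multiplier (rsym j) q x * (v j x * q x)) + q x ^ 2
    + ∑ i, ∑ j, partialD j (v i) x * (u j x * u i x)
    + ∑ i, ∑ j, partialD j (u i) x * (w j x * u i x)
    + ∑ i, ∑ j, partialD j (u i) x ^ 2
    + ∑ j, q x * (multiplier (rsym j) q₁ x * u j x)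
    + ∑ j, q x * (P j x * u j x)

lemma integral_reducedDensity {q q₁ : T2 → ℝ} {u v w P : Fin 2 → T2 → ℝ}
    (hq : MemLp q 2 mu) (hq₁ : MemLp q₁ 4 mu) (hv : ∀ j, MemLp (v j) ∞ mu)
    (hu : ∀ j, MemLp (u j) 4 mu) (hw : ∀ j, MemLp (w j) 4 mu) (hP : ∀ j, MemLp (P j) ∞ mu) :
    Integrable (reducedDensity q q₁ u v w P) mu ∧
    ∫ x, reducedDensity q q₁ u v w P x ∂mu =
      -(∑ j, ∫ x, multiplier (rsym j) q x * (v j x * q x) ∂mu) + ∫ x, q x ^ 2 ∂mu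
        + ∑ i, ∑ j, ∫ x, partialD j (v i) x * (u j x * u i x) ∂mu
        + ∑ i, ∑ j, ∫ x, partialD j (u i) x * (w j x * u i x) ∂mu
        + ∑ i, ∑ j, ∫ x, partialD j (u i) x ^ 2 ∂mu
        + ∑ j, ∫ x, q x * (multiplier (rsym j) q₁ x * u j x) ∂mu
        + ∑ j, ∫ x, q x * (P j x * u j x) ∂mu := by
  have hu2 := fun j => (hu j).mono_exponent (p := 2) (by norm_num)
  have i1 : ∀ j, Integrable (fun x => multiplier (rsym j) q x * (v j x * q x)) mu := fun j =>
    integrable_mul_of_two (memLp_multiplier _ _) (memLp_mul_of_top (hv j) hq)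
  have i2 := hq.integrable_sq
  have i3 : ∀ i j, Integrable (fun x => partialD j (v i) x * (u j x * u i x)) mu := fun i j =>
    integrable_mul_of_two (memLp_partialD _ _) (memLp_mul_of_four (hu j) (hu i))
  have i4 : ∀ i j, Integrable (fun x => partialD j (u i) x * (w j x * u i x)) mu := fun i j =>
    integrable_mul_of_two (memLp_partialD _ _) (memLp_mul_of_four (hw j) (hu i))
  have i5 : ∀ i j, Integrable (fun x => partialD j (u i) x ^ 2) mu := fun i j =>
    (memLp_partialD _ _).integrable_sq
  have i6 : ∀ j, Integrable (fun x => q x * (multiplier (rsym j) q₁ x * u j x)) mu := fun j =>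
    integrable_mul_of_two hq (memLp_mul_of_four (integral_riesz_pow_four_le hq₁ j).1 (hu j))
  have i7 : ∀ j, Integrable (fun x => q x * (P j x * u j x)) mu := fun j =>
    integrable_mul_of_two hq (memLp_mul_of_top (hP j) (hu2 j))
  have s : ∀ {F : Fin 2 → T2 → ℝ}, (∀ j, Integrable (F j) mu) →
      Integrable (fun x => ∑ j, F j x) mu ∧ ∫ x, ∑ j, F j x ∂mu = ∑ j, ∫ x, F j x ∂mu :=
    fun h => ⟨integrable_finsetSum _ fun j _ => h j, integral_finsetSum _ fun j _ => h j⟩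
  have s2 : ∀ {F : Fin 2 → Fin 2 → T2 → ℝ}, (∀ i j, Integrable (F i j) mu) →
      Integrable (fun x => ∑ i, ∑ j, F i j x) mu ∧
        ∫ x, ∑ i, ∑ j, F i j x ∂mu = ∑ i, ∑ j, ∫ x, F i j x ∂mu := fun h => by
    refine ⟨(s fun i => (s (h i)).1).1, ?_⟩
    rw [(s fun i => (s (h i)).1).2]
    exact Finset.sum_congr rfl fun i _ => (s (h i)).2
  have a : ∀ {F G : T2 → ℝ} {a b : ℝ}, (Integrable F mu ∧ ∫ x, F x ∂mu = a) →
      (Integrable G mu ∧ ∫ x, G x ∂mu = b) →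
      Integrable (fun x => F x + G x) mu ∧ ∫ x, (F x + G x) ∂mu = a + b := fun hF hG =>
    ⟨hF.1.add hG.1, by rw [integral_add hF.1 hG.1, hF.2, hG.2]⟩
  have n1 : Integrable (fun x => -∑ j, multiplier (rsym j) q x * (v j x * q x)) mu ∧
      ∫ x, -∑ j, multiplier (rsym j) q x * (v j x * q x) ∂mu =
        -∑ j, ∫ x, multiplier (rsym j) q x * (v j x * q x) ∂mu :=
    ⟨(s i1).1.neg, by rw [integral_neg, (s i1).2]⟩
  exact a (a (a (a (a (a n1 ⟨i2, rfl⟩) (s2 i3)) (s2 i4)) (s2 i5)) (s i6)) (s i7)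

lemma integral_mul_mul_le_of_bounded {q P u : T2 → ℝ} {M : ℝ} (hq : MemLp q 2 mu)
    (hP : MemLp P ∞ mu) (hM : ∀ᵐ x ∂mu, |P x| ≤ M) (hu : MemLp u 2 mu) :
    |∫ x, q x * (P x * u x) ∂mu| ≤ (∫ x, q x ^ 2 ∂mu) / 8 + 2 * M ^ 2 * ∫ x, u x ^ 2 ∂mu := by
  rw [← Real.norm_eq_abs]
  refine (norm_integral_le_integral_norm _).trans ?_
  rw [← integral_div, ← integral_const_mul, ← integral_add (hq.integrable_sq.div_const _)
    (hu.integrable_sq.const_mul _)]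
  refine integral_mono_ae (integrable_mul_of_two hq (memLp_mul_of_top hP hu)).norm
    ((hq.integrable_sq.div_const _).add (hu.integrable_sq.const_mul _)) ?_
  filter_upwards [hM] with x hx
  have h1 : P x ^ 2 ≤ M ^ 2 := sq_le_sq' (abs_le.1 hx).1 (abs_le.1 hx).2
  have h2 : P x ^ 2 * u x ^ 2 ≤ M ^ 2 * u x ^ 2 := by gcongr
  rw [Real.norm_eq_abs]
  refine abs_le.2 ⟨?_, ?_⟩
  · nlinarith [sq_nonneg (q x + 4 * (P x * u x))]
  · nlinarith [sq_nonneg (q x - 4 * (P x * u x))]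

lemma le_sum_fin_two {a : ℝ} {F : Fin 2 → ℝ} (h : ∀ j, a ≤ F j) : 2 * a ≤ ∑ j, F j := by
  rw [Fin.sum_univ_two]
  linarith [h 0, h 1]

/-- The budget: three errors of Q/4 against Q, and two of B/4 against B. The literal 0 is the
transport term; the multiplicities 4 and 2 count index pairs and indices. -/
lemma nonneg_of_estimates {C Q E A B D M g r T₁ T₂ T₃ T₄ : ℝ} (hC : 0 ≤ C) (hQ : 0 ≤ Q)
    (hE : 0 ≤ E) (hA : 0 ≤ A) (hB : 0 ≤ B) (hD : 0 ≤ D) (hg : 0 ≤ g) (hr : 0 ≤ r)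
    (h₁ : T₁ ≤ Q / 4 + C * D * E) (h₂ : -(4 * (B / 16 + 1024 * (g + g ^ 2) * A)) ≤ T₂)
    (h₃ : 2 * -(Q / 8 + B / 8 + 2 ^ 23 * (r + r ^ 2) * A) ≤ T₃)
    (h₄ : 2 * -(Q / 8 + 2 * M ^ 2 * A) ≤ T₄) :
    0 ≤ -T₁ + Q + T₂ + 0 + B + T₃ + T₄ +
      (C + 2 ^ 24) * (M ^ 2 + g ^ 2 + g + r + r ^ 2 + D) * (E + A) := by
  set X := M ^ 2 + g ^ 2 + g + r + r ^ 2 + D with hX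
  have e1 : C * D * E ≤ C * X * E := by gcongr; rw [hX]; nlinarith [sq_nonneg M]
  have e2 : (2 : ℝ) ^ 24 * (M ^ 2 + g ^ 2 + g + r + r ^ 2) * A ≤ 2 ^ 24 * X * A := by
    gcongr; linarith
  have e3 : 0 ≤ C * X * A + 2 ^ 24 * X * E := by positivity
  have e4 : 4096 * (g + g ^ 2) * A ≤ 2 ^ 24 * (g + g ^ 2) * A := by gcongr; norm_num
  have e5 : 4 * M ^ 2 * A ≤ 2 ^ 24 * M ^ 2 * A := by gcongr; norm_num
  linarith

/-- The parameters `M`, `g`, `r`, `D` are arbitrary upper bounds, so that norms for `dx`, which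
exceed those for `mu`, may be inserted. Here `r` plays the role of the squared L⁴ norm of q₁. -/
theorem exists_integral_reducedDensity_ge : ∃ C, 0 < C ∧
    ∀ (q q₁ : T2 → ℝ) (u v w P : Fin 2 → T2 → ℝ) (M g r D : ℝ),
      MemLp q 2 mu → coeff q 0 = 0 → MemLp q₁ 4 mu →
      (∀ j, MemLp (u j) 2 mu) → (∀ j, Summable fun k => freq k ^ 2 * ‖coeff (u j) k‖ ^ 2) →
      (∀ j, MemLp (v j) 2 mu) →
      (∀ j, Summable fun k => (1 + freq k ^ 2) ^ 2 * ‖coeff (v j) k‖ ^ 2) →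
      (∀ k : Z2, ∑ j, (k j : ℂ) * coeff (v j) k = 0) →
      (∀ j, MemLp (w j) 2 mu) → (∀ j, Summable fun k => freq k ^ 2 * ‖coeff (w j) k‖ ^ 2) →
      (∀ k : Z2, ∑ j, (k j : ℂ) * coeff (w j) k = 0) →
      (∀ j, MemLp (P j) ∞ mu) → (∀ j, ∀ᵐ x ∂mu, |P j x| ≤ M) →
      0 ≤ g → ∑ i, ∑ j, ∫ x, partialD j (v i) x ^ 2 ∂mu ≤ g ^ 2 →
      0 ≤ r → ∫ x, q₁ x ^ 4 ∂mu ≤ r ^ 2 →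
      ∑ j, ∫ x, lap (v j) x ^ 2 ∂mu ≤ D →
      Integrable (reducedDensity q q₁ u v w P) mu ∧
      0 ≤ ∫ x, reducedDensity q q₁ u v w P x ∂mu + C * (M ^ 2 + g ^ 2 + g + r + r ^ 2 + D) *
        (∫ x, lam (-(1 / 2)) q x ^ 2 ∂mu + ∑ j, ∫ x, u j x ^ 2 ∂mu) := by
  obtain ⟨C, hC, hcomm⟩ := sq_sum_integral_commutator_le
  obtain ⟨C', hC'⟩ : ∃ C', C + 2 ^ 24 = C' := ⟨_, rfl⟩
  refine ⟨C', hC' ▸ add_pos_of_nonneg_of_pos hC (by norm_num), ?_⟩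
  intro q q₁ u v w P M g r D hq hq0 hq₁ hu hu1 hv hv2 hvdiv hw hw1 hwdiv hP hM hg hgb hr hrb hD
  have hvt := fun j => memLp_top_of_summable (hv j) (hv2 j)
  have hu4 := fun j => (memLp_four_and_le one_pos (hu j) (hu1 j)).1
  have hw4 := fun j => (memLp_four_and_le one_pos (hw j) (hw1 j)).1
  obtain ⟨hint, heq⟩ := integral_reducedDensity hq hq₁ hvt hu4 hw4 hP
  refine ⟨hint, ?_⟩
  rw [heq]
  have sq0 : ∀ f : T2 → ℝ, 0 ≤ ∫ x, f x ^ 2 ∂mu := fun f => integral_nonneg fun x => sq_nonneg _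
  have q0 : ∀ f : T2 → ℝ, 0 ≤ ∫ x, f x ^ 4 ∂mu := fun f => integral_nonneg fun x => (by decide : Even 4).pow_nonneg _
  have h1 := hcomm v q hv hv2 hvdiv hq hq0
  set Q := ∫ x, q x ^ 2 ∂mu with hQ
  set E := ∫ x, lam (-(1 / 2)) q x ^ 2 ∂mu
  set A := ∑ j, ∫ x, u j x ^ 2 ∂mu with hA
  set B := ∑ i, ∑ j, ∫ x, partialD j (u i) x ^ 2 ∂mu with hB
  have hQ0 : 0 ≤ Q := sq0 _
  have hE0 : 0 ≤ E := sq0 _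
  have hA0 : 0 ≤ A := Finset.sum_nonneg fun j _ => sq0 _
  have hB0 : 0 ≤ B := Finset.sum_nonneg fun i _ => Finset.sum_nonneg fun j _ => sq0 _
  have hD0 : 0 ≤ D := (Finset.sum_nonneg fun j _ => sq0 _).trans hD
  have hAj : ∀ j, ∫ x, u j x ^ 2 ∂mu ≤ A := fun j =>
    Finset.single_le_sum (f := fun j => ∫ x, u j x ^ 2 ∂mu) (fun j _ => sq0 _) (Finset.mem_univ j)
  have hu44 : ∀ j, ∫ x, u j x ^ 4 ∂mu ≤ 128 * (A * (A + B)) := fun j => by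
    have h := integral_pow_four_le (hu j) (hu1 j)
    rw [← sum_integral_partialD_sq (hu1 j)] at h
    have hBj : ∑ i, ∫ x, partialD i (u j) x ^ 2 ∂mu ≤ B :=
      Finset.single_le_sum (f := fun j => ∑ i, ∫ x, partialD i (u j) x ^ 2 ∂mu)
        (fun j _ => Finset.sum_nonneg fun i _ => sq0 _) (Finset.mem_univ j)
    refine h.trans ?_
    rw [mul_assoc]
    exact mul_le_mul_of_nonneg_left (mul_le_mul (hAj j) (add_le_add (hAj j) hBj)
      (add_nonneg (sq0 _) (Finset.sum_nonneg fun i _ => sq0 _)) hA0) (by norm_num)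
  have hAB : 0 ≤ 128 * (A * (A + B)) :=
    mul_nonneg (by norm_num) (mul_nonneg hA0 (add_nonneg hA0 hB0))
  have t1 : |∑ j, ∫ x, multiplier (rsym j) q x * (v j x * q x) ∂mu| ≤ Q / 4 + C * D * E := by
    refine abs_le_of_sq_le_mul hQ0 (mul_nonneg (mul_nonneg hC hD0) hE0) (h1.trans ?_)
    calc _ ≤ C * D * Q * E := mul_le_mul_of_nonneg_right (mul_le_mul_of_nonneg_right
          (mul_le_mul_of_nonneg_left hD hC) hQ0) hE0
      _ = _ := by ring
  have t2 : ∀ i j, |∫ x, partialD j (v i) x * (u j x * u i x) ∂mu| ≤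
      B / 16 + 1024 * (g + g ^ 2) * A := fun i j => by
    refine abs_le_of_pow_four_le hg hA0 hB0
      ((integral_mul_mul_pow_four_le (memLp_partialD _ _) (hu4 j) (hu4 i)).trans ?_)
    have hgj : ∫ x, partialD j (v i) x ^ 2 ∂mu ≤ g ^ 2 := by
      refine le_trans ?_ hgb
      refine (Finset.single_le_sum (f := fun j => ∫ x, partialD j (v i) x ^ 2 ∂mu)
        (fun j _ => sq0 _) (Finset.mem_univ j)).trans ?_
      exact Finset.single_le_sum (f := fun i => ∑ j, ∫ x, partialD j (v i) x ^ 2 ∂mu)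
        (fun j _ => Finset.sum_nonneg fun i _ => sq0 _) (Finset.mem_univ i)
    rw [sq (128 * _)]
    exact mul_le_mul (pow_le_pow_left₀ (sq0 _) hgj 2) (mul_le_mul (hu44 j) (hu44 i) (q0 _)
      hAB) (mul_nonneg (q0 _) (q0 _)) (sq_nonneg _)
  have t3 : ∀ i, ∑ j, ∫ x, partialD j (u i) x * (w j x * u i x) ∂mu = 0 := fun i =>
    sum_integral_transport_eq_zero hw hw1 hwdiv (hu i) (hu1 i)
      fun j => memLp_mul_of_four (hw4 j) (hu4 i)
  have t4 : ∀ j, |∫ x, q x * (multiplier (rsym j) q₁ x * u j x) ∂mu| ≤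
      Q / 8 + B / 8 + 2 ^ 23 * (r + r ^ 2) * A := fun j => by
    obtain ⟨hR, hR4⟩ := integral_riesz_pow_four_le hq₁ j
    refine abs_le_of_pow_four_le_mul hQ0 hr hA0 hB0
      ((integral_mul_mul_pow_four_le hq hR (hu4 j)).trans ?_)
    refine mul_le_mul_of_nonneg_left (mul_le_mul (hR4.trans ?_) (hu44 j) (q0 _)
      (mul_nonneg (by norm_num) (sq_nonneg _))) (sq_nonneg _)
    exact mul_le_mul_of_nonneg_left hrb (by norm_num)
  have t5 : ∀ j, |∫ x, q x * (P j x * u j x) ∂mu| ≤ Q / 8 + 2 * M ^ 2 * A := fun j => by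
    refine (integral_mul_mul_le_of_bounded hq (hP j) (hM j) (hu j)).trans ?_
    exact add_le_add le_rfl (mul_le_mul_of_nonneg_left (hAj j) (mul_nonneg (by norm_num)
      (sq_nonneg _)))
  have s2 : -(4 * (B / 16 + 1024 * (g + g ^ 2) * A)) ≤
      ∑ i, ∑ j, ∫ x, partialD j (v i) x * (u j x * u i x) ∂mu := by
    simp only [Fin.sum_univ_two]
    linarith [(abs_le.1 (t2 0 0)).1, (abs_le.1 (t2 0 1)).1, (abs_le.1 (t2 1 0)).1,
      (abs_le.1 (t2 1 1)).1]
  have s3 : ∑ i, ∑ j, ∫ x, partialD j (u i) x * (w j x * u i x) ∂mu = 0 :=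
    Finset.sum_eq_zero fun i _ => t3 i
  have s4 := le_sum_fin_two fun j => (abs_le.1 (t4 j)).1
  have s5 := le_sum_fin_two fun j => (abs_le.1 (t5 j)).1
  rw [s3, ← hC']
  exact nonneg_of_estimates hC hQ0 hE0 hA0 hB0 hD0 hg hr (abs_le.1 t1).2 s2 s4 s5

/-! ### Norms with respect to `dx` and reduction of the pairing -/

lemma lpNorm_two_sq {E : Type*} [NormedAddCommGroup E] {f : T2 → E} (hf : MemLp f 2 mu) :
    lpNorm f 2 dx ^ 2 = (2 * Real.pi) ^ 2 * ∫ x, ‖f x‖ ^ 2 ∂mu := by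
  rw [lpNorm_eq_integral_norm_rpow_toReal (by norm_num) (by norm_num) (memLp_dx_iff.2 hf).1,
    ← integral_dx, ← Real.rpow_natCast, ← Real.rpow_mul (integral_nonneg fun x => by positivity)]
  norm_num

lemma lpNorm_four_pow {f : T2 → ℝ} (hf : MemLp f 4 mu) :
    lpNorm f 4 dx ^ 4 = (2 * Real.pi) ^ 2 * ∫ x, f x ^ 4 ∂mu := by
  rw [lpNorm_eq_integral_norm_rpow_toReal (by norm_num) (by norm_num) (memLp_dx_iff.2 hf).1,
    ← integral_dx, ← Real.rpow_natCast, ← Real.rpow_mul (integral_nonneg fun x => by positivity)]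
  norm_num
  refine integral_congr_ae (.of_forall fun x => ?_)
  exact (by decide : Even 4).pow_abs _

lemma lpNorm_two_sq_piLp {ι : Type*} [Fintype ι] {f : T2 → EuclideanSpace ℝ ι}
    (hf : ∀ i, MemLp (fun x => f x i) 2 mu) :
    lpNorm f 2 dx ^ 2 = (2 * Real.pi) ^ 2 * ∑ i, ∫ x, f x i ^ 2 ∂mu := by
  rw [lpNorm_two_sq (MemLp.of_eval_piLp hf), ← integral_finsetSum _ fun i _ => (hf i).integrable_sq]
  simp only [EuclideanSpace.norm_sq_eq, Real.norm_eq_abs, sq_abs]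

lemma le_four_pi_sq_mul {a : ℝ} (ha : 0 ≤ a) : a ≤ (2 * Real.pi) ^ 2 * a :=
  le_mul_of_one_le_left ha one_le_four_pi_sq

lemma riesz_apply (f : T2 → ℝ) (x : T2) (j : Fin 2) : riesz f x j = multiplier (rsym j) f x := rfl

/-- The identities q₁u₁ − q₂u₂ = q u₁ + q₂u and q₁Rq₁ − q₂Rq₂ = q Rq₁ + q₂Rq make the q₂ terms
cancel pointwise; likewise u₁·∇u₁ − u₂·∇u₂ = u·∇u₁ + u₂·∇u. The terms with f and ΔΦ drop out.
Equality is only almost everywhere because multipliers are linear only up to null sets. -/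
lemma driftDiffDensity_ae_eq {q₁ q₂ : T2 → ℝ} {u₁ u₂ : T2 → Vec} (Φ : T2 → ℝ) (f : T2 → Vec)
    (hq₁ : MemLp q₁ 2 mu) (hq₂ : MemLp q₂ 2 mu) (h0 : coeff (q₁ - q₂) 0 = 0)
    (hu₁ : ∀ i, MemLp (fun x => u₁ x i) 2 mu) (hu₂ : ∀ i, MemLp (fun x => u₂ x i) 2 mu)
    (h₁ : ∀ i, Summable fun k => freq k ^ 2 * ‖coeff (fun x => u₁ x i) k‖ ^ 2)
    (h₂ : ∀ i, Summable fun k => freq k ^ 2 * ‖coeff (fun x => u₂ x i) k‖ ^ 2) :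
    driftDiffDensity Φ f q₁ u₁ q₂ u₂ (lam (-1) (q₁ - q₂)) (u₁ - u₂) =ᵐ[mu]
      reducedDensity (q₁ - q₂) q₁ (fun i x => (u₁ - u₂) x i) (fun i x => u₁ x i)
        (fun i x => u₂ x i) fun j => partialD j Φ := by
  have e1 := ae_all_iff.2 fun j => partialD_lam j (hq₁.sub hq₂)
  have e2 := lam_one_lam (hq₁.sub hq₂) h0
  have e3 := ae_all_iff.2 fun j => riesz_sub j hq₁ hq₂
  have e4 := ae_all_iff.2 fun i => ae_all_iff.2 fun j => partialD_sub j (hu₁ i) (hu₂ i) (h₁ i) (h₂ i)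
  have eu : ∀ i, (fun x => (u₁ - u₂) x i) = (fun x => u₁ x i) - fun x => u₂ x i := fun i => by
    ext x; simp
  filter_upwards [e1, e2, e3, e4] with x h1 h2 h3 h4
  simp only [driftDiffDensity, driftDensity, reducedDensity, PiLp.inner_apply, grad, advect, gradV,
    riesz_apply, Fintype.sum_prod_type, Fin.sum_univ_two, eu, h1, h2, h3, h4]
  simp only [Pi.sub_apply, PiLp.sub_apply, RCLike.inner_apply, conj_trivial]
  ring

end Electroconvection

end

theorem proposition3p2 :
    ∃ C₀ : ℝ, 0 < C₀ ∧
      ∀ (Φ : T2 → ℝ) (f : T2 → Vec),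
        MemLp f 2 dx → InSobolev 2 Φ → MemLp (lap Φ) 4 dx →
      ∀ (q₁ q₂ : T2 → ℝ) (u₁ u₂ : T2 → Vec),
        MemLp q₁ 4 dx → MeanZero q₁ →
        MemLp q₂ 2 dx → MeanZero q₂ →
        InSobolevV 2 u₁ → DivFree u₁ →
        InSobolevV 1 u₂ → DivFree u₂ →
        Integrable (driftDiffDensity Φ f q₁ u₁ q₂ u₂ (lam (-1) (q₁ - q₂)) (u₁ - u₂)) dx ∧
        0 ≤ driftDiffPairing Φ f q₁ u₁ q₂ u₂ (lam (-1) (q₁ - q₂)) (u₁ - u₂)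
            + C₀ * bigK Φ u₁ q₁ *
              (lpNorm (lam (-(1 / 2)) (q₁ - q₂)) 2 dx ^ 2 + lpNorm (u₁ - u₂) 2 dx ^ 2) := by
  obtain ⟨C, hC, hmain⟩ := exists_integral_reducedDensity_ge
  refine ⟨C, hC, ?_⟩
  intro Φ f _ hΦ hlap q₁ q₂ u₁ u₂ hq₁ hm₁ hq₂ hm₂ hu₁ hd₁ hu₂ hd₂
  rw [memLp_dx_iff] at hlap hq₁ hq₂
  have hq₁2 : MemLp q₁ 2 mu := hq₁.mono_exponent (by norm_num)
  have hmean : ∀ {g : T2 → ℝ}, MeanZero g → coeff g 0 = 0 := fun {g} h => by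
    rw [MeanZero, integral_dx] at h
    rw [coeff_zero_freq, (mul_eq_zero.1 h).resolve_left four_pi_sq_pos.ne', Complex.ofReal_zero]
  have h0 : coeff (q₁ - q₂) 0 = 0 := by
    rw [coeff_sub (integrable_of_memLp hq₁2) (integrable_of_memLp hq₂), hmean hm₁, hmean hm₂,
      sub_zero]
  have hu₁L := fun i => (hu₁ i).memLp
  have hu₂L := fun i => (hu₂ i).memLp
  have hu₁s := fun i => (hu₁ i).summable_two
  have hu₁f := fun i => summable_freq_two (hu₁s i)
  have hu₂f := fun i => (hu₂ i).summable_one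
  have hae := driftDiffDensity_ae_eq Φ f hq₁2 hq₂ h0 hu₁L hu₂L hu₁f hu₂f
  have hgrad : ∀ j, MemLp (partialD j Φ) ∞ mu := fun j =>
    memLp_top_partialD (summable_freq_two hΦ.summable_two) (summable_freq_four hΦ.summable_two)
      hlap j
  have hgradbound : ∀ j, ∀ᵐ x ∂mu, |partialD j Φ x| ≤ lpNorm (grad Φ) ∞ dx := fun j => by
    -- Membership is essential: an infinite norm would become 0 as a real number and bound nothing.
    have hG : MemLp (grad Φ) ∞ dx := memLp_dx_iff.2 (MemLp.of_eval_piLp hgrad)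
    filter_upwards [ae_dx_iff.1 (ae_le_lpNorm_exponent_top hG)] with x hx
    exact (PiLp.norm_apply_le (grad Φ x) j).trans hx
  have sq0 : ∀ g : T2 → ℝ, 0 ≤ ∫ x, g x ^ 2 ∂mu := fun g => integral_nonneg fun x => sq_nonneg _
  have hgV : ∑ i, ∑ j, ∫ x, partialD j (fun y => u₁ y i) x ^ 2 ∂mu ≤ lpNorm (gradV u₁) 2 dx ^ 2 := by
    rw [lpNorm_two_sq_piLp fun p => memLp_partialD p.2 _, Fintype.sum_prod_type]
    exact le_four_pi_sq_mul (Finset.sum_nonneg fun i _ => Finset.sum_nonneg fun j _ => sq0 _)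
  have hq4 : ∫ x, q₁ x ^ 4 ∂mu ≤ (lpNorm q₁ 4 dx ^ 2) ^ 2 := by
    rw [← pow_mul, lpNorm_four_pow hq₁]
    exact le_four_pi_sq_mul (integral_nonneg fun x => (by decide : Even 4).pow_nonneg _)
  have hlV : ∑ j, ∫ x, lap (fun y => u₁ y j) x ^ 2 ∂mu ≤ lpNorm (lapV u₁) 2 dx ^ 2 := by
    rw [lpNorm_two_sq_piLp fun j => memLp_multiplier _ _]
    exact le_four_pi_sq_mul (Finset.sum_nonneg fun i _ => sq0 _)
  have huL : ∀ i, MemLp (fun x => (u₁ - u₂) x i) 2 mu := fun i => (hu₁L i).sub (hu₂L i)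
  obtain ⟨hint, hge⟩ := hmain (q₁ - q₂) q₁ (fun i x => (u₁ - u₂) x i) (fun i x => u₁ x i)
    (fun i x => u₂ x i) (fun j => partialD j Φ) (lpNorm (grad Φ) ∞ dx) (lpNorm (gradV u₁) 2 dx)
    (lpNorm q₁ 4 dx ^ 2) (lpNorm (lapV u₁) 2 dx ^ 2) (hq₁2.sub hq₂) h0 hq₁ huL
    (fun i => summable_freq_two_sub (hu₁L i) (hu₂L i) (hu₁f i) (hu₂f i))
    hu₁L hu₁s hd₁ hu₂L hu₂f hd₂ hgrad hgradbound lpNorm_nonneg hgV (sq_nonneg _) hq4 hlV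
  have hlam : MemLp (lam (-(1 / 2)) (q₁ - q₂)) 2 mu := memLp_multiplier _ _
  refine ⟨integrable_dx_iff.2 ((integrable_congr hae).2 hint), ?_⟩
  rw [driftDiffPairing, integral_dx, integral_congr_ae hae, lpNorm_two_sq hlam,
    lpNorm_two_sq_piLp huL, bigK]
  simp only [Real.norm_eq_abs, sq_abs]
  -- The pairing and the two squared norms outside K all carry the same factor (2π)², so the
  -- inequality for `mu` only has to be scaled.
  have := mul_nonneg four_pi_sq_pos.le hge
  refine this.trans (le_of_eq ?_)
  ring
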